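/- **Elfs process transducer.** *Graph quantities.* Let $G=(V,E,w)$ be a finite undirected graph with positive edge weights $w_{xy}=w_{yx}$ (and $w_{xy}=0$ off $E$), degrees $d_x=\sum_y w_{xy}$, and let $M\subseteq V$ be a sink that can be reached from every vertex. For $x\notin M$ let $f_x$ be the unit electric flow from $x$ to $M$, i.e. the unit flow that minimizes $\mathcal E(f)=\frac12\sum_{(y,z)\in E} f_{yz}^2/w_{yz}$, and let $R_x=\mathcal E(f_x)$ be the effective resistance. For the random walk $X_0=x,X_1,\dots$ with transition probabilities $w_{yz}/d_y$, stopped at $\tau=\min\{t:X_t\in M\}$, let $\mathrm{HT}_x=\mathbb E[\tau]$ and $\mathrm{ET}_x=\mathbb E[1+\max\{t<\tau:X_t=x\}]$. The elfs process from $s\notin M$ is the Markov chain $Y_0=s,Y_1,\dots$ with $\Pr(Y_{t+1}=y\mid Y_t=x)=\frac1{2R_x}\sum_{z}(f_x)_{yz}^2/w_{yz}$ (sum over $z$ with $(y,z)\in E$), stopped at its first visit to $M$, at time $\rho$; let $\mathrm{EHT}_s=\mathbb E[\rho]$. *Transducers.* A unitary $S$ on $\mathcal H\oplus\mathcal L$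 (public and private space) transduces $\xi\in\mathcal H$ into $\tau\in\mathcal H$ with catalyst $c\in\mathcal L$ if $S(\xi\oplus c)=\tau\oplus c$; the transduction complexity is $\|c\|^2$. *Quantum walk.* For $u\notin M$ and $\eta>0$ let $\hat G_{u}$ be $G$ with an extra vertex $\sigma$ attached to $u$ by an edge of weight $\eta\, d_u$. The quantum walk operator of $\hat G_u$ with source $\sigma$ and sink $M$ is $(2\hat\Pi_*-I)\cdot\mathrm{SWAP}$, where $\mathrm{SWAP}|x,z\rangle=|z,x\rangle$ and $\hat\Pi_*$ projects onto the span of the star states $|\hat\phi_x\rangle=\hat d_x^{-1/2}\sum_z\sqrt{\hat w_{xz}}\,|x,z\rangle$, $x\notin\{\sigma\}\cup M$. A controlled call applies it to two registers of the memory, with $u$ read from a third register. *Memory and elementary operations.* The memory has a fixed number of registers and of infinite arrays of registers, each register holding an integer or a vertex of $V\cup\{\sigma\}$. Elementary operations, controlled by finitely many tests of registers (equality, order, being in $M$, …), are: a sign flip, additions, copying or swapping registers, accessing an array at an address held in a register, exchanging a fixed integer with the symbol $\sigma$ in a register, and rotating a qubit by a fixed angle or by an angle that is a fixed function of the two given numbers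 $\overline{\mathrm{ET}}_x,r_x$ of the vertex $x$ held in a register. Public and private space are distinguished by a flag register. **Theorem.** For every $\kappa\ge1$ there are a constant $C$ and fixed finite lists $A,B$ of elementary operations, depending only on $\kappa$, such that the following holds for all $G,M,s\notin M$ as above and all numbers $\overline{\mathrm{ET}}_x,r_x$ with $$\overline{\mathrm{ET}}_x\ge \mathrm{ET}_x,\qquad \tfrac1\kappa R_xd_x\le r_x\le\kappa R_xd_x\qquad(x\notin M).$$ 1. Let $S$ be the unitary that performs $A$, then one controlled call to the quantum walk operator of $\hat G_u$ with $\eta=\overline{\mathrm{ET}}_u/r_u$, then $B$ (so $S$ uses one controlled walk call and $O(1)$ elementary operations). Then $S$ transduces the initial basis state, in which an array holds $s$ and everything else is blank, exactly into a quantum sample of the full elfs process $$|h\rangle=\sum_{(y_0,\dots,y_\rho)}\sqrt{\Pr(y_0,\dots,y_\rho)}\;|y_0,\dots,y_\rho,0,0,\dots\rangle\,|\Gamma(y_0,\dots,y_\rho)\rangle$$ with normalized garbage states $\Gamma(\cdot)$, with transduction complexity at most $$C\cdot\mathbb E\Big[\sum_{t=0}^{\rho-1}\sqrt{\overline{\mathrm{ET}}_{Y_t}}\Big].$$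 2. The controlled walk call itself is a product of elementary operations from fixed finite lists (depending only on $\kappa$), one controlled use of any unitary that prepares the star states $|x\rangle|0\rangle\mapsto|x\rangle\sum_z\sqrt{w_{xz}/d_x}\,|z\rangle$ of $G$ itself, and one use of the inverse. 3. The elfs process and the random walk from $s$ reach $M$ almost surely, and $Y_\rho$ has the same distribution as $X_\tau$. If moreover $\overline{\mathrm{ET}}_x\le\beta\,\mathrm{ET}_x$ for all $x\notin M$, then $$\mathbb E\Big[\sum_{t=0}^{\rho-1}\sqrt{\overline{\mathrm{ET}}_{Y_t}}\Big]\le\sqrt{2\beta\cdot\mathrm{EHT}_s\cdot\mathrm{HT}_s},$$ so that the transduction complexity is $O(\sqrt{\mathrm{EHT}_s\,\mathrm{HT}_s})$ for tight bounds, $\beta=O(1)$. -/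

import Mathlib

open scoped ENNReal NNReal

universe u

noncomputable section

namespace Elfs

/-! ### Weighted graphs, electric flows -/

section Graph

variable {X : Type u} [Fintype X] [DecidableEq X]

/-- A finite undirected weighted graph, given by its symmetric nonnegative weights: `(x, y)` is an
edge iff `0 < w x y`. The sink `M` can be reached from every vertex. -/
structure IsNetwork (w : X → X → ℝ) (M : Finset X) : Prop where
  symm : ∀ x y, w x y = w y x
  nonneg : ∀ x y, 0 ≤ w x y
  reach : ∀ x, ∃ m ∈ M, Relation.ReflTransGen (fun a b => 0 < w a b) x m

/-- The degree `d_x`. -/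
def deg (w : X → X → ℝ) (x : X) : ℝ := ∑ y, w x y

/-- `g` is a unit flow from `s` to `M`, supported on the edges. -/
structure IsUnitFlow (w : X → X → ℝ) (M : Finset X) (s : X) (g : X → X → ℝ) : Prop where
  supp : ∀ x y, w x y = 0 → g x y = 0
  antisymm : ∀ x y, g x y = -g y x
  source : ∑ y, g s y = 1
  sink : ∑ m ∈ M, ∑ y, g y m = 1
  inner : ∀ x, x ≠ s → x ∉ M → ∑ z, g x z = 0

/-- The dissipated energy `½ ∑_{(x,y) ∈ E} g_{xy}² / w_{xy}`. -/
def energy (w : X → X → ℝ) (g : X → X → ℝ) : ℝ :=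
  (1 / 2) * ∑ x, ∑ y, g x y ^ 2 / w x y

/-- `f` is a unit flow from `s` to `M` of minimal energy. -/
def IsElectricFlow (w : X → X → ℝ) (M : Finset X) (s : X) (f : X → X → ℝ) : Prop :=
  IsUnitFlow w M s f ∧ ∀ g, IsUnitFlow w M s g → energy w f ≤ energy w g

open Classical in
/-- The unit electric flow from `s` to `M`. -/
def electricFlow (w : X → X → ℝ) (M : Finset X) (s : X) : X → X → ℝ :=
  if h : ∃ f, IsElectricFlow w M s f then h.choose else 0

/-- The effective resistance `R_s` between `s` and `M`. -/
def effRes (w : X → X → ℝ) (M : Finset X) (s : X) : ℝ := energy w (electricFlow w M s)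

/-! ### Markov chains stopped in `M`

The stopped chain is the random finite sequence `y_0, …, y_n` whose last entry is the first one in
`M`; it is described through its law on finite sequences. -/

/-- Finite sequences `y_0, …, y_n`, with `n` the number of steps. -/
abbrev Path (X : Type u) : Type u := (n : ℕ) × (Fin (n + 1) → X)

/-- The probability that the chain with transition probabilities `P`, started from `s` and stopped
at its first visit to `M`, equals the path `p`. -/
def pathProb (P : X → X → ℝ) (M : Finset X) (s : X) (p : Path X) : ℝ :=
  if p.2 0 = s ∧ (∀ i : Fin p.1, p.2 i.castSucc ∉ M) ∧ p.2 (Fin.last p.1) ∈ M then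
    ∏ i : Fin p.1, P (p.2 i.castSucc) (p.2 i.succ)
  else 0

/-- The expectation of a functional of the stopped chain. -/
def expect (P : X → X → ℝ) (M : Finset X) (s : X) (F : Path X → ℝ≥0∞) : ℝ≥0∞ :=
  ∑' p : Path X, ENNReal.ofReal (pathProb P M s p) * F p

/-- The probability that the stopped chain ends in the vertex `m`. -/
def arrival (P : X → X → ℝ) (M : Finset X) (s m : X) : ℝ≥0∞ :=
  expect P M s (fun p => if p.2 (Fin.last p.1) = m then 1 else 0)

/-- Transition probabilities `w_{xy} / d_x` of the random walk. -/
def rwStep (w : X → X → ℝ) (x y : X) : ℝ := w x y / deg w x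

/-- Transition probabilities of the elfs process: sample an edge with probability proportional to
`f_e² / w_e`, with `f` the unit electric flow from `x` to `M`, then a uniform endpoint of it. -/
def elfStep (w : X → X → ℝ) (M : Finset X) (x y : X) : ℝ :=
  1 / (2 * effRes w M x) * ∑ z, electricFlow w M x y z ^ 2 / w y z

/-- The hitting time `HT_s = E[τ]`. -/
def hittingTime (w : X → X → ℝ) (M : Finset X) (s : X) : ℝ≥0∞ :=
  expect (rwStep w) M s (fun p => (p.1 : ℝ≥0∞))

/-- `1 + max {t < n : y_t = s}` for a path `y_0, …, y_n` (and `0` if there is no such `t`). -/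
def lastExit (s : X) (p : Path X) : ℕ :=
  Finset.univ.sup (fun i : Fin p.1 => if p.2 i.castSucc = s then (i : ℕ) + 1 else 0)

/-- The escape time `ET_s`: expected time at which the random walk leaves `s` for the last time
before hitting `M`. -/
def escapeTime (w : X → X → ℝ) (M : Finset X) (s : X) : ℝ≥0∞ :=
  expect (rwStep w) M s (fun p => (lastExit s p : ℝ≥0∞))

/-- The electric hitting time `EHT_s = E[ρ]`. -/
def elecHittingTime (w : X → X → ℝ) (M : Finset X) (s : X) : ℝ≥0∞ :=
  expect (elfStep w M) M s (fun p => (p.1 : ℝ≥0∞))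

/-- `E[∑_{t < ρ} √(b_{Y_t})]` for the elfs process `Y_0 = s, …, Y_ρ ∈ M`. -/
def elfCost (w : X → X → ℝ) (M : Finset X) (s : X) (b : X → ℝ) : ℝ≥0∞ :=
  expect (elfStep w M) M s
    (fun p => ∑ i : Fin p.1, ENNReal.ofReal (Real.sqrt (b (p.2 i.castSucc))))

/-! ### Quantum walks -/

/-- The star state `|φ_x⟩ = d_x^{-1/2} ∑_y √(w_{xy}) |x y⟩`. -/
def starState (w : X → X → ℝ) (x : X) : X × X → ℂ :=
  fun p => if p.1 = x then ((Real.sqrt (w x p.2 / deg w x) : ℝ) : ℂ) else 0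

/-- The quantum walk operator `(2 Π_* - I) · SWAP` with source `s` and sink `M`, where `Π_*`
projects onto the span of the (orthonormal) star states of the vertices outside `{s} ∪ M`. It is
written on all pairs of vertices; pairs that are not edges span an invariant subspace. -/
def walkMatrix (w : X → X → ℝ) (M : Finset X) (s : X) : Matrix (X × X) (X × X) ℂ :=
  ((2 : ℂ) • (∑ x ∈ Finset.univ.filter (fun x => x ≠ s ∧ x ∉ M),
      Matrix.vecMulVec (starState w x) (star (starState w x))) - 1) *
    Matrix.of (fun p q => if p = Prod.swap q then 1 else 0)

/-- The graph `Ĝ` obtained from a graph by attaching to the vertex `y` a new vertex `none`, through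
an edge of weight `η d_y`. -/
def attach (w : X → X → ℝ) (η : ℝ) (y : X) : Option X → Option X → ℝ
  | some a, some b => w a b
  | none, some b => if b = y then η * deg w y else 0
  | some a, none => if a = y then η * deg w y else 0
  | none, none => 0

/-- The quantum walk operator on the graph `Ĝ` with a new vertex attached to `y`, from that new
vertex to the sink `M`. -/
def attachedWalk (w : X → X → ℝ) (M : Finset X) (η : ℝ) (y : X) :
    Matrix (Option X × Option X) (Option X × Option X) ℂ :=
  walkMatrix (attach w η y) (M.map Function.Embedding.some) none

/-- A unitary, controlled on a vertex `x`, that prepares the star states of the graph from a blank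
`none`: `|x⟩|blank⟩ ↦ |x⟩ ∑_z √(w_{xz} / d_x) |z⟩`. -/
def IsStarPreparation (w : X → X → ℝ)
    (coin : X → Matrix (Option X) (Option X) ℂ) : Prop :=
  ∀ x, coin x ∈ Matrix.unitaryGroup (Option X) ℂ ∧
    (0 < deg w x → coin x none none = 0 ∧
      ∀ z, coin x (some z) none = ((Real.sqrt (w x z / deg w x) : ℝ) : ℂ))

end Graph

/-! ### Transducers -/

/-- The unitary `S` transduces `ξ` into `τ` with catalyst `w`, for the public space `H` and the
private space `Hᗮ`: `S : ξ ⊕ w ↦ τ ⊕ w`. -/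
structure Transduces {K : Type*} [NormedAddCommGroup K] [InnerProductSpace ℂ K]
    (S : K ≃ₗᵢ[ℂ] K) (H : Submodule ℂ K) (ξ τ w : K) : Prop where
  mem_in : ξ ∈ H
  mem_out : τ ∈ H
  mem_private : w ∈ Hᗮ
  map_eq : S (ξ + w) = τ + w

/-! ### The memory

A memory of `k + 1` cells and `k + 1` infinite arrays of cells. The basis states of a cell are
the integers (`0` also serves as the blank), the vertices of the graph, and the additional vertex
of `Ĝ`. -/

/-- Basis states of one cell: a number, or a vertex of `Ĝ` (`none` is the attached vertex). -/
inductive Word (V : Type u) : Type u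
  | num (a : ℤ)
  | vtx (x : Option V)

/-- Basis states of the memory. -/
structure Config (V : Type u) (k : ℕ) : Type u where
  cell : Fin (k + 1) → Word V
  arr : Fin (k + 1) → ℤ → Word V

/-- The Hilbert space of the memory. -/
abbrev Space (V : Type u) (k : ℕ) : Type u := lp (fun _ : Config V k => ℂ) 2

section Memory

variable {V : Type u} {k : ℕ}

open Classical in
/-- The basis state `|c⟩`. -/
def ket (c : Config V k) : Space V k := lp.single 2 c (1 : ℂ)

/-- Overwrite a cell. -/
def Config.set (c : Config V k) (i : Fin (k + 1)) (a : Word V) : Config V k :=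
  { c with cell := Function.update c.cell i a }

/-- Overwrite an entry of an array. -/
def Config.setArr (c : Config V k) (a : Fin (k + 1)) (l : ℤ) (b : Word V) : Config V k :=
  { c with arr := Function.update c.arr a (Function.update (c.arr a) l b) }

/-- The public space: cell `0` is the flag that separates public (`0`) from private. -/
def publicSpace (V : Type u) (k : ℕ) : Submodule ℂ (Space V k) where
  carrier := {ψ | ∀ c : Config V k, c.cell 0 ≠ Word.num 0 → ψ c = 0}
  add_mem' := by
    intro a b ha hb c hc
    simp [ha c hc, hb c hc]
  zero_mem' := by
    intro c _
    simp
  smul_mem' := by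
    intro r a ha c hc
    simp [ha c hc]

/-- The content `y_0, …, y_n, 0, 0, …` of an array that records a path. -/
def record (p : Path V) : ℤ → Word V := fun j =>
  if h : 0 ≤ j ∧ j.toNat < p.1 + 1 then Word.vtx (some (p.2 ⟨j.toNat, h.2⟩)) else Word.num 0

/-- The initial basis state: array `0` records the path of length zero at `s`, and everything else
is blank. -/
def initConfig (k : ℕ) (s : V) : Config V k where
  cell := fun _ => Word.num 0
  arr := fun a => if a = 0 then record ⟨0, fun _ => s⟩ else fun _ => Word.num 0

/-- `h = ∑_p √(Pr p) |p⟩ |Γ(p)⟩`, where array `0` records the path `p`, and where `Γ(p)` is a unit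
vector of the remaining memory. -/
def IsQuantumSample (Pr : Path V → ℝ) (h : Space V k) : Prop :=
  ∃ Γ : Path V → Space V k,
    (∀ p, ‖Γ p‖ = 1 ∧ ∀ c : Config V k, c.arr 0 ≠ record p → Γ p c = 0) ∧
    HasSum (fun p => ((Real.sqrt (Pr p) : ℝ) : ℂ) • Γ p) h

end Memory

/-! ### Elementary operations -/

/-- Tests on a basis state: is a cell a number; is it the number `a`; is it the attached vertex; is
it a vertex of the sink; do two cells agree; are they numbers in strictly increasing order. -/
inductive Test (k : ℕ) : Type
  | number (i : Fin (k + 1))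
  | isNum (i : Fin (k + 1)) (a : ℤ)
  | attached (i : Fin (k + 1))
  | sink (i : Fin (k + 1))
  | same (i j : Fin (k + 1))
  | less (i j : Fin (k + 1))

/-- A control: the conjunction of finitely many tests, each to be passed (`true`) or failed
(`false`). -/
abbrev Guard (k : ℕ) : Type := List (Test k × Bool)

/-- Basic operations. -/
inductive Op (k : ℕ) : Type
  /-- multiply by `-1` -/
  | neg
  /-- add the constant `a` to the number in cell `i` -/
  | addConst (i : Fin (k + 1)) (a : ℤ)
  /-- add the number in cell `j` to the number in cell `i` -/
  | addCell (i j : Fin (k + 1))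
  /-- exchange the values "number `a`" and "attached vertex" of cell `i` -/
  | exchange (i : Fin (k + 1)) (a : ℤ)
  /-- copy cell `j` to cell `i` if the latter is blank, and blank it if it is such a copy -/
  | copyCell (i j : Fin (k + 1))
  /-- swap two cells -/
  | swapCells (i j : Fin (k + 1))
  /-- swap cell `i` with the entry of array `a` whose address is the number in cell `j` -/
  | swapArr (i a j : Fin (k + 1))
  /-- rotate the basis states "number `0`", "number `1`" of cell `i` by the angle `θ` -/
  | rotate (i : Fin (k + 1)) (θ : ℝ)
  /-- the same with the angle `θ b_y r_y`, where `y` is the vertex in cell `j`, and `b`, `r` are the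
  two given tables of numbers -/
  | rotateBy (i j : Fin (k + 1)) (θ : ℝ → ℝ → ℝ)

/-- An elementary operation: a basic operation, applied if its control is satisfied. -/
abbrev Gate (k : ℕ) : Type := Guard k × Op k

section Semantics

variable {V : Type u} [Fintype V] [DecidableEq V] {k : ℕ}

/-- The outcome of a test in a basis state. -/
def Test.Holds (M : Finset V) (c : Config V k) : Test k → Prop
  | .number i => ∃ a, c.cell i = Word.num a
  | .isNum i a => c.cell i = Word.num a
  | .attached i => c.cell i = Word.vtx none
  | .sink i => ∃ m ∈ M, c.cell i = Word.vtx (some m)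
  | .same i j => c.cell i = c.cell j
  | .less i j => ∃ a b, c.cell i = Word.num a ∧ c.cell j = Word.num b ∧ a < b

/-- The control is satisfied in a basis state. -/
def Guard.Holds (M : Finset V) (c : Config V k) (G : Guard k) : Prop :=
  ∀ t ∈ G, (t.1.Holds M c ↔ t.2 = true)

open Classical in
/-- Rotation of the basis states "number `0`", "number `1`" of cell `i`. -/
def rotation (c : Config V k) (i : Fin (k + 1)) (θ : ℝ) : Space V k :=
  if c.cell i = Word.num 0 then
    ((Real.cos θ : ℝ) : ℂ) • ket c + ((Real.sin θ : ℝ) : ℂ) • ket (c.set i (Word.num 1))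
  else if c.cell i = Word.num 1 then
    ((Real.cos θ : ℝ) : ℂ) • ket c - ((Real.sin θ : ℝ) : ℂ) • ket (c.set i (Word.num 0))
  else ket c

open Classical in
/-- The image of the basis state `|c⟩` under a basic operation. -/
def Op.act (b r : V → ℝ) (c : Config V k) : Op k → Space V k
  | .neg => -ket c
  | .addConst i a =>
    match c.cell i with
    | .num l => ket (c.set i (Word.num (l + a)))
    | .vtx _ => ket c
  | .addCell i j =>
    match c.cell i, c.cell j with
    | .num l, .num l' => ket (c.set i (Word.num (l + l')))
    | _, _ => ket c
  | .exchange i a =>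
    if c.cell i = Word.num a then ket (c.set i (Word.vtx none))
    else if c.cell i = Word.vtx none then ket (c.set i (Word.num a))
    else ket c
  | .copyCell i j =>
    if c.cell i = Word.num 0 then ket (c.set i (c.cell j))
    else if c.cell i = c.cell j then ket (c.set i (Word.num 0))
    else ket c
  | .swapCells i j => ket ((c.set i (c.cell j)).set j (c.cell i))
  | .swapArr i a j =>
    match c.cell j with
    | .num l => ket ((c.set i (c.arr a l)).setArr a l (c.cell i))
    | .vtx _ => ket c
  | .rotate i θ => rotation c i θ
  | .rotateBy i j θ =>
    match c.cell j with
    | .vtx (some y) => rotation c i (θ (b y) (r y))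
    | _ => ket c

open Classical in
/-- The image of the basis state `|c⟩` under an elementary operation. -/
def Gate.act (M : Finset V) (b r : V → ℝ) (c : Config V k) (g : Gate k) : Space V k :=
  if Guard.Holds M c g.1 then g.2.act b r c else ket c

/-- The unitary `T` is the product of the given elementary operations (first one applied first). -/
inductive Runs (M : Finset V) (b r : V → ℝ) :
    List (Gate k) → (Space V k ≃ₗᵢ[ℂ] Space V k) → Prop
  | nil : Runs M b r [] (LinearIsometryEquiv.refl ℂ (Space V k))
  | cons {g : Gate k} {L : List (Gate k)} {T T' : Space V k ≃ₗᵢ[ℂ] Space V k}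
      (hg : ∀ c, T (ket c) = Gate.act M b r c g) (hL : Runs M b r L T') :
      Runs M b r (g :: L) (T.trans T')

open Classical in
/-- The unitary `T` is the controlled call to the quantum walk operator of `Ĝ`: if the control `G`
is satisfied, cell `y` holds a vertex `u` outside the sink, and cells `x`, `z` hold two vertices of
`Ĝ`, then the walk operator of the graph with a new vertex attached to `u` by an edge of weight
`(b_u / r_u) d_u` is applied to the cells `x`, `z`. -/
def IsWalkCall (w : V → V → ℝ) (M : Finset V) (b r : V → ℝ) (G : Guard k)
    (y x z : Fin (k + 1)) (T : Space V k ≃ₗᵢ[ℂ] Space V k) : Prop :=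
  ∀ c : Config V k, T (ket c) =
    if Guard.Holds M c G then
      match c.cell y, c.cell x, c.cell z with
      | .vtx (some u), .vtx p, .vtx q =>
        if u ∉ M then
          ∑ e : Option V × Option V,
            attachedWalk w M (b u / r u) u e (p, q) •
              ket ((c.set x (Word.vtx e.1)).set z (Word.vtx e.2))
        else ket c
      | _, _, _ => ket c
    else ket c

/-- A cell content that encodes a basis state of the second register of a star preparation. -/
def coinWord : Option V → Word V
  | none => Word.num 0
  | some v => Word.vtx (some v)

open Classical in
/-- The unitary `T` is the controlled call to the star preparation `coin`: if the control `G` is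
satisfied, cell `x` holds a vertex `v` of the graph, and cell `z` is blank or holds a vertex of the
graph, then `coin v` is applied to the cell `z`. -/
def IsCoinCall (M : Finset V) (coin : V → Matrix (Option V) (Option V) ℂ) (G : Guard k)
    (x z : Fin (k + 1)) (T : Space V k ≃ₗᵢ[ℂ] Space V k) : Prop :=
  ∀ c : Config V k, T (ket c) =
    if Guard.Holds M c G then
      match c.cell x, c.cell z with
      | .vtx (some v), .num a =>
        if a = 0 then ∑ e, coin v e none • ket (c.set z (coinWord e)) else ket c
      | .vtx (some v), .vtx (some q) =>
        ∑ e, coin v e (some q) • ket (c.set z (coinWord e))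
      | _, _ => ket c
    else ket c

end Semantics

end Elfs

end

/-! For a vertex u let v be the potential of the unit electric flow from u to M: it vanishes on M,
and its Laplacian is the unit mass at u off M. Then the flow is w_{xy}(v_x - v_y), the resistance
R_u is v_u, and self-adjointness of the Laplacian L gives ET_u = (∑ d_x v_x²)/v_u
(`IsNetwork.escapeTime_eq`).

Classical part. From ∑_z w_{yz}(v_y - v_z)² = 2 v_y Lv(y) - L(v²)(y) one elfs step from u changes
the mean of any function h by -(1/(2R_u)) ∑ (Lh) v² (`IsPotential.sum_elfStep`). Functions that are
harmonic for the random walk are thus harmonic for the elfs process, which gives equal arrival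
distributions. For the hitting time, Lh = d off M, so 2·HT drops by exactly ET_u in the mean; hence
E ∑ ET_{Y_t} = 2·HT_s, and the bound for tight estimates is Cauchy–Schwarz.

Quantum part, one move. Put m = √b_u, with b_u the bound on ET_u, and q = η d_u R_u. Consider the
vectors on ordered pairs with amplitude √(η d_u w_{ab})·((v_a + v_b)/2 + μ(v_a - v_b)), completed on
the attached edge. After the swap, the one with μ = m - 1/2 reads v_a - m(v_a - v_b). The first term
lies in the span of the stars, the second is a flow and hence orthogonal to the stars, so the
reflection flips its sign and μ grows by 1 (`attachedWalk_mulVec`). A rotation of the part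
antisymmetric under the swap brings μ back to m - 1/2 and deposits √(2m) times the flow in a marked
branch (`mark_sum`), whose squared amplitudes are proportional to the elfs transition probabilities.
The attached edge is repaired by a rotation that couples it to the state "at u" (`feed_sum`).
Altogether the walk vector, scaled by α = b_u^{1/4}/(q + b_u), is returned unchanged, "at u" is
consumed, the move is made with probability 1 - ε², and an amplitude ε = (q - b_u)/(q + b_u) of "at
u" remains. Since q agrees with b_u up to a factor κ, |ε| ≤ (κ-1)/(κ+1). The bound ET_u ≤ b_u gives
the scaled walk vector squared norm at most 3√b_u (`IsEstimate.sum_sq_catAmp`); the choice m = √b_u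
balances its potential part against its flow part.

Assembly. The remaining ε counts as a failed attempt, with a counter j, and the step is summed as a
geometric series in ε (`map_geometric`). The counter and the other endpoint of the sampled edge are
recorded, so different histories of a path are orthogonal and the squared norm of the histories of a
path is exactly its probability (`norm_sq_pathVec`): no approximation error arises, and the records
become garbage. Summing over all paths, the output of each move is the input of the next
(`map_total`). The memory shows the path, so the pieces of the catalyst for different paths are
orthogonal, and its squared norm is at most a constant times ∑_p Pr(p follows the running
process)·√b at the end of p, that is, E ∑ √b_{Y_t}.

Walk call. Conjugating the reflection about a blank second register by the star preparation gives
the reflection about the stars of G. At the vertex u the star of the attached graph is (star of G +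
√η σ)/√(1+η), so there the blank is reflected together with σ, which takes one rotation by 2 arctan
√η. -/

noncomputable section

set_option linter.unusedSectionVars false

namespace Elfs

/-! ### Path sums and first-step analysis for absorbing Markov chains. -/

section Markov

variable {X : Type u} [Fintype X] [DecidableEq X]

/-- The path of length zero at `x`. -/
def Path.single (x : X) : Path X := ⟨0, fun _ => x⟩

/-- Prepend a vertex to a path. -/
def Path.cons (x : X) (p : Path X) : Path X := ⟨p.1 + 1, Fin.cons x p.2⟩

/-- The probability that the chain started from `s`, and not stopped earlier, follows the path. -/
def stepWt (P : X → X → ℝ) (M : Finset X) (s : X) (p : Path X) : ℝ :=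
  if p.2 0 = s ∧ ∀ i : Fin p.1, p.2 i.castSucc ∉ M then
    ∏ i : Fin p.1, P (p.2 i.castSucc) (p.2 i.succ)
  else 0

/-- The part of a path sum that comes from paths of length `n`. -/
def level (P : X → X → ℝ) (M : Finset X) (n : ℕ) (s : X) (F : Path X → ℝ≥0∞) : ℝ≥0∞ :=
  ∑ f : Fin (n + 1) → X, ENNReal.ofReal (stepWt P M s ⟨n, f⟩) * F ⟨n, f⟩

/-- The sum of a functional over all paths that stop in `M` at their last step at the earliest. -/
def pathSum (P : X → X → ℝ) (M : Finset X) (s : X) (F : Path X → ℝ≥0∞) : ℝ≥0∞ :=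
  ∑' p : Path X, ENNReal.ofReal (stepWt P M s p) * F p

/-- `1` for the paths that end in `M`, `0` for the others. -/
def stopped (M : Finset X) (p : Path X) : ℝ≥0∞ := if p.2 (Fin.last p.1) ∈ M then 1 else 0

theorem Path.cons_last (x : X) (p : Path X) :
    (Path.cons x p).2 (Fin.last (Path.cons x p).1) = p.2 (Fin.last p.1) := by
  change (Fin.cons x p.2 : Fin (p.1 + 2) → X) (Fin.last (p.1 + 1)) = _
  rw [← Fin.succ_last, Fin.cons_succ]

theorem stopped_cons (M : Finset X) (x : X) (p : Path X) :
    stopped M (Path.cons x p) = stopped M p := by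
  unfold stopped; rw [Path.cons_last]

theorem stepWt_cons (P : X → X → ℝ) (M : Finset X) (s x : X) (p : Path X) :
    stepWt P M s (Path.cons x p) =
      if x = s ∧ x ∉ M then P x (p.2 0) * stepWt P M (p.2 0) p else 0 := by
  have h0 : (Path.cons x p).2 0 = x := rfl
  have h1 : (∀ i : Fin (Path.cons x p).1, (Path.cons x p).2 i.castSucc ∉ M) ↔
      x ∉ M ∧ ∀ i : Fin p.1, p.2 i.castSucc ∉ M := by
    change (∀ i : Fin (p.1 + 1), (Fin.cons x p.2 : Fin (p.1 + 2) → X) i.castSucc ∉ M) ↔ _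
    rw [Fin.forall_fin_succ]
    simp only [Fin.castSucc_zero, Fin.cons_zero, Fin.castSucc_succ, Fin.cons_succ]
  have h2 : ∏ i : Fin (Path.cons x p).1,
      P ((Path.cons x p).2 i.castSucc) ((Path.cons x p).2 i.succ) =
      P x (p.2 0) * ∏ i : Fin p.1, P (p.2 i.castSucc) (p.2 i.succ) := by
    change ∏ i : Fin (p.1 + 1), P ((Fin.cons x p.2 : Fin (p.1 + 2) → X) i.castSucc)
      ((Fin.cons x p.2 : Fin (p.1 + 2) → X) i.succ) = _
    rw [Fin.prod_univ_succ]
    simp only [Fin.castSucc_zero, Fin.cons_zero, Fin.castSucc_succ, Fin.cons_succ]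
  unfold stepWt
  simp only [h0, h1, h2]
  by_cases hx : x = s <;> by_cases hM : x ∈ M <;>
    by_cases hp : ∀ i : Fin p.1, p.2 i.castSucc ∉ M <;> simp_all

theorem pathProb_eq (P : X → X → ℝ) (M : Finset X) (s : X) (p : Path X) :
    pathProb P M s p = if p.2 (Fin.last p.1) ∈ M then stepWt P M s p else 0 := by
  unfold pathProb stepWt
  by_cases h : p.2 (Fin.last p.1) ∈ M <;> simp [h]

theorem expect_eq_pathSum (P : X → X → ℝ) (M : Finset X) (s : X) (F : Path X → ℝ≥0∞) :
    expect P M s F = pathSum P M s (fun p => stopped M p * F p) := by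
  unfold expect pathSum
  refine tsum_congr fun p => ?_
  rw [pathProb_eq]
  unfold stopped
  by_cases h : p.2 (Fin.last p.1) ∈ M <;> simp [h]

theorem pathSum_eq_tsum_level (P : X → X → ℝ) (M : Finset X) (s : X) (F : Path X → ℝ≥0∞) :
    pathSum P M s F = ∑' n, level P M n s F := by
  unfold pathSum level
  rw [ENNReal.tsum_sigma']
  exact tsum_congr fun n => tsum_fintype _

theorem level_zero (P : X → X → ℝ) (M : Finset X) (s : X) (F : Path X → ℝ≥0∞) :
    level P M 0 s F = F (Path.single s) := by
  unfold level
  rw [Finset.sum_eq_single (fun _ => s)]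
  · simp [stepWt, Path.single]
  · intro f _ hf
    have : f 0 ≠ s := fun h => hf (funext fun i => by rw [show i = 0 from Fin.fin_one_eq_zero i, h])
    simp [stepWt, this]
  · simp

/-- Splitting off the first vertex of the paths. Nonnegativity is needed because `ENNReal.ofReal` is
multiplicative only on nonnegative factors. All sums live in `ℝ≥0∞`, so the first-step equations
hold before any convergence is known. -/
theorem level_succ (P : X → X → ℝ) (M : Finset X) (hP : ∀ x ∉ M, ∀ y, 0 ≤ P x y) (n : ℕ) (s : X)
    (F : Path X → ℝ≥0∞) :
    level P M (n + 1) s F = if s ∈ M then 0 else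
      ∑ y, ENNReal.ofReal (P s y) * level P M n y (fun p => F (Path.cons s p)) := by
  have key : ∀ x (g : Fin (n + 1) → X),
      ENNReal.ofReal (stepWt P M s ⟨n + 1, Fin.cons x g⟩) * F ⟨n + 1, Fin.cons x g⟩ =
      if x = s ∧ x ∉ M then ENNReal.ofReal (P x (g 0)) *
        (ENNReal.ofReal (stepWt P M (g 0) ⟨n, g⟩) * F (Path.cons x ⟨n, g⟩)) else 0 := by
    intro x g
    have := stepWt_cons P M s x ⟨n, g⟩
    unfold Path.cons at this ⊢
    dsimp only at this ⊢
    rw [this]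
    split_ifs with h
    · rw [ENNReal.ofReal_mul (hP x h.2 _), mul_assoc]
    · simp
  unfold level
  rw [← (Fin.consEquiv (fun _ : Fin (n + 2) => X)).sum_comp, Fintype.sum_prod_type]
  have hc : ∀ x (g : Fin (n + 1) → X), (Fin.consEquiv fun _ : Fin (n + 2) => X) (x, g) =
    (Fin.cons x g : Fin (n + 2) → X) := fun _ _ => rfl
  simp only [hc, key]
  split_ifs with hs
  · refine Finset.sum_eq_zero fun x _ => Finset.sum_eq_zero fun g _ => ?_
    rw [if_neg]
    rintro ⟨rfl, h⟩
    exact h hs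
  · rw [Finset.sum_eq_single s]
    · simp only [hs, not_false_eq_true, and_self, if_true, Finset.mul_sum]
      rw [Finset.sum_comm]
      refine Finset.sum_congr rfl fun g _ => ?_
      rw [Finset.sum_eq_single (g 0)]
      · intro y _ hy
        simp [stepWt, hy.symm]
      · exact fun h => absurd (Finset.mem_univ _) h
    · intro x _ hx
      simp [hx]
    · simp

theorem pathSum_step (P : X → X → ℝ) (M : Finset X) (hP : ∀ x ∉ M, ∀ y, 0 ≤ P x y) (s : X)
    (F : Path X → ℝ≥0∞) :
    pathSum P M s F = F (Path.single s) + if s ∈ M then 0 else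
      ∑ y, ENNReal.ofReal (P s y) * pathSum P M y (fun p => F (Path.cons s p)) := by
  rw [pathSum_eq_tsum_level, tsum_eq_zero_add' ENNReal.summable, level_zero]
  congr 1
  simp only [level_succ P M hP]
  split_ifs with hs
  · simp
  · rw [Summable.tsum_finsetSum (fun _ _ => ENNReal.summable)]
    simp only [ENNReal.tsum_mul_left, pathSum_eq_tsum_level]

theorem expect_sink (P : X → X → ℝ) (M : Finset X) (hP : ∀ x ∉ M, ∀ y, 0 ≤ P x y) {s : X}
    (hs : s ∈ M) (F : Path X → ℝ≥0∞) : expect P M s F = F (Path.single s) := by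
  rw [expect_eq_pathSum, pathSum_step P M hP, if_pos hs]
  simp [stopped, Path.single, hs]

theorem expect_step (P : X → X → ℝ) (M : Finset X) (hP : ∀ x ∉ M, ∀ y, 0 ≤ P x y) {s : X}
    (hs : s ∉ M) (F : Path X → ℝ≥0∞) : expect P M s F =
      ∑ y, ENNReal.ofReal (P s y) * expect P M y (fun p => F (Path.cons s p)) := by
  rw [expect_eq_pathSum, pathSum_step P M hP, if_neg hs]
  simp only [expect_eq_pathSum, stopped_cons]
  simp [stopped, Path.single, hs]

theorem expect_add (P : X → X → ℝ) (M : Finset X) (s : X) (F G : Path X → ℝ≥0∞) :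
    expect P M s (fun p => F p + G p) = expect P M s F + expect P M s G := by
  unfold expect
  rw [← ENNReal.tsum_add]
  exact tsum_congr fun p => mul_add _ _ _

theorem expect_const_mul (P : X → X → ℝ) (M : Finset X) (s : X) (c : ℝ≥0∞) (F : Path X → ℝ≥0∞) :
    expect P M s (fun p => c * F p) = c * expect P M s F := by
  unfold expect
  rw [← ENNReal.tsum_mul_left]
  exact tsum_congr fun p => by ring

theorem expect_mono (P : X → X → ℝ) (M : Finset X) (s : X) {F G : Path X → ℝ≥0∞}
    (h : ∀ p, F p ≤ G p) : expect P M s F ≤ expect P M s G :=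
  ENNReal.tsum_le_tsum fun p => mul_le_mul_right (h p) _

/-- Transition probabilities off `M` of a chain that can reach `M` from everywhere. -/
structure IsAbsorbing (P : X → X → ℝ) (M : Finset X) : Prop where
  nonneg : ∀ x ∉ M, ∀ y, 0 ≤ P x y
  sum_one : ∀ x ∉ M, ∑ y, P x y = 1
  reach : ∀ x, ∃ m ∈ M, Relation.ReflTransGen (fun a b => 0 < P a b) x m

namespace IsAbsorbing

variable {P : X → X → ℝ} {M : Finset X}

/-- A negative minimum would be attained off M. There an average is at most the minimum, so every
successor of positive probability attains it too, and the minimum spreads along a path into M, where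
D is nonnegative. -/
theorem min_principle (h : IsAbsorbing P M) (D : X → ℝ) (hM : ∀ m ∈ M, 0 ≤ D m)
    (hD : ∀ x ∉ M, ∑ y, P x y * D y ≤ D x) (x : X) : 0 ≤ D x := by
  obtain ⟨x₀, -, hx₀⟩ := Finset.exists_min_image Finset.univ D ⟨x, Finset.mem_univ x⟩
  refine le_trans ?_ (hx₀ x (Finset.mem_univ x))
  by_contra! hneg
  obtain ⟨m, hm, hr⟩ := h.reach x₀
  have key : D m = D x₀ := by
    clear hm
    induction hr with
    | refl => rfl
    | @tail b c _ hbc ih =>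
      have hbM : b ∉ M := fun hb => absurd (hM b hb) (by rw [ih]; exact not_le.2 hneg)
      have hsum : ∑ y, P b y * (D y - D x₀) ≤ 0 := by
        simp only [mul_sub, Finset.sum_sub_distrib, ← Finset.sum_mul, h.sum_one b hbM]
        have := hD b hbM
        rw [ih] at this
        linarith
      have hnn : ∀ y ∈ Finset.univ, 0 ≤ P b y * (D y - D x₀) := fun y hy =>
        mul_nonneg (h.nonneg b hbM y) (sub_nonneg.2 (hx₀ y hy))
      have h0 := (Finset.sum_eq_zero_iff_of_nonneg hnn).1
        (le_antisymm hsum (Finset.sum_nonneg hnn)) c (Finset.mem_univ c)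
      rcases mul_eq_zero.1 h0 with h1 | h1
      · exact absurd h1 hbc.ne'
      · linarith
  exact absurd (hM m hm) (by rw [key]; exact not_le.2 hneg)

theorem unique (h : IsAbsorbing P M) {u v c : X → ℝ} (hM : ∀ m ∈ M, u m = v m)
    (hu : ∀ x ∉ M, u x = c x + ∑ y, P x y * u y) (hv : ∀ x ∉ M, v x = c x + ∑ y, P x y * v y) :
    u = v := by
  have aux : ∀ u v : X → ℝ, (∀ m ∈ M, u m = v m) → (∀ x ∉ M, u x = c x + ∑ y, P x y * u y) →
      (∀ x ∉ M, v x = c x + ∑ y, P x y * v y) → ∀ x, v x ≤ u x := by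
    intro u v hM hu hv x
    have := h.min_principle (fun x => u x - v x) (fun m hm => by simp [hM m hm])
      (fun x hx => by
        simp only [mul_sub, Finset.sum_sub_distrib]
        linarith [hu x hx, hv x hx]) x
    simpa using this
  exact funext fun x => le_antisymm (aux v u (fun m hm => (hM m hm).symm) hv hu x)
    (aux u v hM hu hv x)

/-- The linear system has as many equations as unknowns, and the minimum principle makes it
injective, hence surjective. -/
theorem exists_solution (h : IsAbsorbing P M) (b c : X → ℝ) :
    ∃ u : X → ℝ, (∀ m ∈ M, u m = b m) ∧ ∀ x ∉ M, u x = c x + ∑ y, P x y * u y := by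
  let L : (X → ℝ) →ₗ[ℝ] (X → ℝ) :=
    { toFun := fun u x => if x ∈ M then u x else u x - ∑ y, P x y * u y
      map_add' := by
        intro u v; ext x
        simp only [Pi.add_apply, mul_add, Finset.sum_add_distrib]
        split_ifs <;> ring
      map_smul' := by
        intro a u; ext x
        simp only [Pi.smul_apply, smul_eq_mul, RingHom.id_apply, mul_left_comm _ a,
          ← Finset.mul_sum]
        split_ifs <;> ring }
  have hL : ∀ u x, L u x = if x ∈ M then u x else u x - ∑ y, P x y * u y := fun _ _ => rfl
  have hinj : Function.Injective L := by
    rw [injective_iff_map_eq_zero]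
    intro u hu
    have hu' : ∀ x, (if x ∈ M then u x else u x - ∑ y, P x y * u y) = 0 := fun x => by
      rw [← hL, hu]; rfl
    refine h.unique (c := 0) (fun m hm => ?_) (fun x hx => ?_) (fun x hx => ?_)
    · have := hu' m
      rw [if_pos hm] at this
      simpa using this
    · have := hu' x
      rw [if_neg hx] at this
      simp only [Pi.zero_apply]
      linarith
    · simp
  obtain ⟨u, hu⟩ := LinearMap.injective_iff_surjective.1 hinj (fun x => if x ∈ M then b x else c x)
  have hu' : ∀ x, (if x ∈ M then u x else u x - ∑ y, P x y * u y) = if x ∈ M then b x else c x :=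
    fun x => by rw [← hL, hu]
  refine ⟨u, fun m hm => by simpa [hm] using hu' m, fun x hx => ?_⟩
  have := hu' x
  rw [if_neg hx, if_neg hx] at this
  linarith

/-- A supersolution U dominates every partial sum over path lengths, by induction on the cutoff.
Invariance of F under prepending makes the tail of the sum another sum of the same kind. This
supplies finiteness, which the uniqueness argument needs first. -/
theorem pathSum_le (h : IsAbsorbing P M) {F : Path X → ℝ≥0∞}
    (hF : ∀ x p, F (Path.cons x p) = F p) {U : X → ℝ≥0∞}
    (hU : ∀ x, F (Path.single x) + (if x ∈ M then 0 else ∑ y, ENNReal.ofReal (P x y) * U y) ≤ U x)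
    (s : X) : pathSum P M s F ≤ U s := by
  have key : ∀ n x, ∑ i ∈ Finset.range n, level P M i x F ≤ U x := by
    intro n
    induction n with
    | zero => simp
    | succ n ih =>
      intro x
      rw [Finset.sum_range_succ', level_zero, add_comm]
      refine le_trans (add_le_add_right ?_ _) (hU x)
      simp only [level_succ P M h.nonneg, hF]
      split_ifs
      · simp
      · rw [Finset.sum_comm]
        refine Finset.sum_le_sum fun y _ => ?_
        rw [← Finset.mul_sum]
        exact mul_le_mul_right (ih y) _
  rw [pathSum_eq_tsum_level]
  exact ENNReal.tsum_le_of_sum_range_le fun n => key n s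

theorem sum_ofReal_mul (h : IsAbsorbing P M) {x : X} (hx : x ∉ M) {u : X → ℝ}
    (hu : ∀ y, 0 ≤ u y) : ∑ y, ENNReal.ofReal (P x y) * ENNReal.ofReal (u y) =
      ENNReal.ofReal (∑ y, P x y * u y) := by
  rw [ENNReal.ofReal_sum_of_nonneg fun y _ => mul_nonneg (h.nonneg x hx y) (hu y)]
  exact Finset.sum_congr rfl fun y _ => (ENNReal.ofReal_mul (h.nonneg x hx y)).symm

theorem sum_ofReal (h : IsAbsorbing P M) {x : X} (hx : x ∉ M) :
    ∑ y, ENNReal.ofReal (P x y) = 1 := by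
  have := h.sum_ofReal_mul hx (u := fun _ => 1) (fun _ => zero_le_one)
  simpa [h.sum_one x hx] using this

theorem expect_one_le (h : IsAbsorbing P M) (s : X) : expect P M s (fun _ => 1) ≤ 1 := by
  rw [expect_eq_pathSum]
  refine h.pathSum_le (U := fun _ => 1) (fun x p => by rw [stopped_cons]) (fun x => ?_) s
  by_cases hx : x ∈ M
  · simp [stopped, Path.single, hx]
  · simp [stopped, Path.single, hx, h.sum_ofReal hx]

/-- A finite function that satisfies the first-step equations is determined by them. -/
theorem ofReal_of_step (h : IsAbsorbing P M) {E : X → ℝ≥0∞} (hfin : ∀ x, E x ≠ ∞)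
    {u c : X → ℝ} (hc : ∀ x ∉ M, 0 ≤ c x)
    (hM : ∀ m ∈ M, (E m).toReal = u m)
    (hE : ∀ x ∉ M, E x = ENNReal.ofReal (c x) + ∑ y, ENNReal.ofReal (P x y) * E y)
    (hu : ∀ x ∉ M, u x = c x + ∑ y, P x y * u y) (s : X) : E s = ENNReal.ofReal (u s) := by
  have : (fun x => (E x).toReal) = u := by
    refine h.unique (c := c) hM (fun x hx => ?_) hu
    have hsum : ∑ y, ENNReal.ofReal (P x y) * E y ≠ ∞ :=
      ENNReal.sum_ne_top.2 fun y _ => ENNReal.mul_ne_top ENNReal.ofReal_ne_top (hfin y)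
    rw [hE x hx, ENNReal.toReal_add ENNReal.ofReal_ne_top hsum, ENNReal.toReal_ofReal (hc x hx),
      ENNReal.toReal_sum fun y _ => ENNReal.mul_ne_top ENNReal.ofReal_ne_top (hfin y)]
    simp only [ENNReal.toReal_mul]
    congr 1
    exact Finset.sum_congr rfl fun y _ => by rw [ENNReal.toReal_ofReal (h.nonneg x hx y)]
  rw [← this, ENNReal.ofReal_toReal (hfin s)]

/-- Almost sure absorption: the absorption probability and the constant 1 solve the same first-step
equations with the same boundary values, and the former is known to be at most 1, hence finite. -/
theorem expect_one (h : IsAbsorbing P M) (s : X) : expect P M s (fun _ => 1) = 1 := by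
  have := h.ofReal_of_step (E := fun x => expect P M x (fun _ => 1)) (u := fun _ => 1) (c := 0)
    (fun x => ne_top_of_le_ne_top ENNReal.one_ne_top (h.expect_one_le x)) (fun _ _ => le_rfl)
    (fun m hm => by simp [expect_sink P M h.nonneg hm])
    (fun x hx => by simp [expect_step P M h.nonneg hx])
    (fun x hx => by simp [h.sum_one x hx]) s
  simpa using this

/-- The total cost of a path, with a terminal payment. -/
def cost (c u : X → ℝ≥0∞) (p : Path X) : ℝ≥0∞ :=
  ∑ i : Fin p.1, c (p.2 i.castSucc) + u (p.2 (Fin.last p.1))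

theorem cost_single (c u : X → ℝ≥0∞) (x : X) : cost c u (Path.single x) = u x := by
  change ∑ i : Fin 0, _ + _ = _
  simp [Path.single]

theorem cost_cons (c u : X → ℝ≥0∞) (x : X) (p : Path X) :
    cost c u (Path.cons x p) = c x + cost c u p := by
  unfold cost
  rw [Path.cons_last, ← add_assoc]
  congr 1
  change ∑ i : Fin (p.1 + 1), c ((Fin.cons x p.2 : Fin (p.1 + 2) → X) i.castSucc) = _
  rw [Fin.sum_univ_succ]
  simp only [Fin.castSucc_zero, Fin.cons_zero, Fin.castSucc_succ, Fin.cons_succ]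

theorem expect_cost_step (h : IsAbsorbing P M) (c u : X → ℝ≥0∞) {x : X} (hx : x ∉ M) :
    expect P M x (cost c u) = c x + ∑ y, ENNReal.ofReal (P x y) * expect P M y (cost c u) := by
  rw [expect_step P M h.nonneg hx]
  have : ∀ y, expect P M y (fun p => cost c u (Path.cons x p)) =
      c x + expect P M y (cost c u) := by
    intro y
    simp only [cost_cons]
    rw [expect_add]
    have := expect_const_mul P M y (c x) (fun _ => 1)
    simp only [mul_one, h.expect_one] at this
    rw [this]
  simp only [this, mul_add, Finset.sum_add_distrib, ← Finset.sum_mul, h.sum_ofReal hx, one_mul]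

/-- The supersolution argument again. A cost is not invariant under prepending: a new first vertex x
adds c x times the total weight of the truncated stopping paths, which is at most 1 (`hone`). -/
theorem expect_cost_le (h : IsAbsorbing P M) {c u : X → ℝ≥0∞} {U : X → ℝ≥0∞}
    (hM : ∀ m ∈ M, u m ≤ U m)
    (hU : ∀ x ∉ M, c x + ∑ y, ENNReal.ofReal (P x y) * U y ≤ U x) (s : X) :
    expect P M s (cost c u) ≤ U s := by
  have hone : ∀ n x, ∑ i ∈ Finset.range n, level P M i x (stopped M) ≤ 1 := by
    intro n x
    refine le_trans (ENNReal.sum_le_tsum _) ?_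
    rw [← pathSum_eq_tsum_level]
    simpa [expect_eq_pathSum] using h.expect_one_le x
  have key : ∀ n x,
      ∑ i ∈ Finset.range n, level P M i x (fun p => stopped M p * cost c u p) ≤ U x := by
    intro n
    induction n with
    | zero => simp
    | succ n ih =>
      intro x
      rw [Finset.sum_range_succ', level_zero]
      simp only [level_succ P M h.nonneg]
      by_cases hx : x ∈ M
      · rw [show stopped M (Path.single x) = 1 by simp [stopped, Path.single, hx], cost_single]
        simpa [hx] using hM x hx
      · simp only [hx, if_false]
        rw [show stopped M (Path.single x) = 0 by simp [stopped, Path.single, hx], zero_mul,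
          add_zero, Finset.sum_comm]
        refine le_trans ?_ (hU x hx)
        have : ∀ y, ∑ i ∈ Finset.range n, ENNReal.ofReal (P x y) * level P M i y
            (fun p => stopped M (Path.cons x p) * cost c u (Path.cons x p)) ≤
            ENNReal.ofReal (P x y) * c x + ENNReal.ofReal (P x y) * U y := by
          intro y
          rw [← Finset.mul_sum, ← mul_add]
          refine mul_le_mul_right ?_ _
          have e : ∀ i, level P M i y
              (fun p => stopped M (Path.cons x p) * cost c u (Path.cons x p)) =
              level P M i y (stopped M) * c x +
              level P M i y (fun p => stopped M p * cost c u p) := by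
            intro i
            unfold level
            rw [Finset.sum_mul, ← Finset.sum_add_distrib]
            refine Finset.sum_congr rfl fun f _ => ?_
            simp only [stopped_cons, cost_cons]
            ring
          simp only [e, Finset.sum_add_distrib, ← Finset.sum_mul]
          refine add_le_add ?_ (ih y)
          exact (mul_le_mul_left (hone n y) _).trans (one_mul _).le
        refine (Finset.sum_le_sum fun y _ => this y).trans ?_
        rw [Finset.sum_add_distrib, ← Finset.sum_mul, h.sum_ofReal hx, one_mul]
  rw [expect_eq_pathSum, pathSum_eq_tsum_level]
  exact ENNReal.tsum_le_of_sum_range_le fun n => key n s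

/-- The solution u is in particular a supersolution, so the expectation is finite; uniqueness then
turns the inequality into an equality. -/
theorem expect_cost (h : IsAbsorbing P M) {c u : X → ℝ} (hc : ∀ x ∉ M, 0 ≤ c x)
    (hu : ∀ x, 0 ≤ u x) (hs : ∀ x ∉ M, u x = c x + ∑ y, P x y * u y) (s : X) :
    expect P M s (cost (fun x => ENNReal.ofReal (c x)) (fun x => ENNReal.ofReal (u x))) =
      ENNReal.ofReal (u s) := by
  set E : X → ℝ≥0∞ := fun x =>
    expect P M x (cost (fun x => ENNReal.ofReal (c x)) (fun x => ENNReal.ofReal (u x)))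
  have hle : ∀ x, E x ≤ ENNReal.ofReal (u x) := fun x =>
    h.expect_cost_le (fun _ _ => le_rfl) (fun y hy => by
      rw [h.sum_ofReal_mul hy hu, ← ENNReal.ofReal_add (hc y hy)
        (Finset.sum_nonneg fun z _ => mul_nonneg (h.nonneg y hy z) (hu z)), ← hs y hy]) x
  refine h.ofReal_of_step (E := E) (fun x => ne_top_of_le_ne_top ENNReal.ofReal_ne_top (hle x)) hc
    (fun m hm => ?_) (fun x hx => h.expect_cost_step _ _ hx) hs s
  change (expect P M m _).toReal = _
  rw [expect_sink P M h.nonneg hm]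
  simp [cost_single, hu m]

/-- A nonnegative additive cost is the value of a nonnegative solution of the first-step equations. -/
theorem exists_cost (h : IsAbsorbing P M) {c : X → ℝ} (hc : ∀ x ∉ M, 0 ≤ c x) :
    ∃ u : X → ℝ, (∀ x, 0 ≤ u x) ∧ (∀ m ∈ M, u m = 0) ∧ (∀ x ∉ M, u x = c x + ∑ y, P x y * u y) ∧
      ∀ s, expect P M s (fun p => ∑ i : Fin p.1, ENNReal.ofReal (c (p.2 i.castSucc))) =
        ENNReal.ofReal (u s) := by
  obtain ⟨u, hM, hs⟩ := h.exists_solution 0 c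
  have hu : ∀ x, 0 ≤ u x := h.min_principle u (fun m hm => (hM m hm).ge) (fun x hx => by
    have := hs x hx
    linarith [hc x hx])
  refine ⟨u, hu, hM, hs, fun s => ?_⟩
  rw [← h.expect_cost hc hu hs s]
  unfold expect
  refine tsum_congr fun p => ?_
  by_cases hp : p.2 (Fin.last p.1) ∈ M
  · simp [cost, hM _ hp]
  · simp [pathProb, hp]

/-- The expected cost, written as a sum over the running paths. -/
theorem running_le_expect (h : IsAbsorbing P M) {c : X → ℝ} (hc : ∀ x ∉ M, 0 ≤ c x) (s : X) :
    pathSum P M s (fun p => if p.2 (Fin.last p.1) ∈ M then 0 else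
      ENNReal.ofReal (c (p.2 (Fin.last p.1)))) ≤
      expect P M s (fun p => ∑ i : Fin p.1, ENNReal.ofReal (c (p.2 i.castSucc))) := by
  obtain ⟨u, hu, hM, hs, hE⟩ := h.exists_cost hc
  rw [hE]
  -- The summand depends only on the endpoint of the path, and the expected cost u solves the
  -- corresponding equations, so it serves as the supersolution.
  refine h.pathSum_le (U := fun x => ENNReal.ofReal (u x)) (fun x p => by rw [Path.cons_last])
    (fun x => ?_) s
  by_cases hx : x ∈ M
  · simp [Path.single, hx]
  · simp only [Path.single, hx, if_false]
    rw [h.sum_ofReal_mul hx hu, ← ENNReal.ofReal_add (hc x hx)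
      (Finset.sum_nonneg fun z _ => mul_nonneg (h.nonneg x hx z) (hu z)), ← hs x hx]

end IsAbsorbing

end Markov

/-! ### Laplacian, electric potentials, escape times and the elfs chain. -/

section Network

variable {X : Type u} [Fintype X] [DecidableEq X]

/-- The graph Laplacian. -/
def lap (w : X → X → ℝ) (u : X → ℝ) (x : X) : ℝ := ∑ y, w x y * (u x - u y)

/-- The potential, grounded in `M`, of the unit electric flow from `s` to `M`. -/
structure IsPotential (w : X → X → ℝ) (M : Finset X) (s : X) (v : X → ℝ) : Prop where
  zero : ∀ m ∈ M, v m = 0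
  source : lap w v s = 1
  harmonic : ∀ x, x ≠ s → x ∉ M → lap w v x = 0

namespace IsNetwork

variable {w : X → X → ℝ} {M : Finset X}

theorem mono (h : IsNetwork w M) {M' : Finset X} (hM : M ⊆ M') : IsNetwork w M' :=
  ⟨h.symm, h.nonneg, fun x => by
    obtain ⟨m, hm, hr⟩ := h.reach x
    exact ⟨m, hM hm, hr⟩⟩

theorem deg_pos (h : IsNetwork w M) {x : X} (hx : x ∉ M) : 0 < deg w x := by
  obtain ⟨m, hm, hr⟩ := h.reach x
  rcases Relation.ReflTransGen.cases_head hr with rfl | ⟨y, hy, -⟩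
  · exact absurd hm hx
  · exact lt_of_lt_of_le hy
      (Finset.single_le_sum (f := fun y => w x y) (fun z _ => h.nonneg x z) (Finset.mem_univ y))

theorem weight_le_deg (h : IsNetwork w M) (x y : X) : w x y ≤ deg w x :=
  Finset.single_le_sum (f := fun y => w x y) (fun z _ => h.nonneg x z) (Finset.mem_univ y)

theorem rw_absorbing (h : IsNetwork w M) : IsAbsorbing (rwStep w) M := by
  refine ⟨fun x hx y => div_nonneg (h.nonneg x y) (h.deg_pos hx).le, fun x hx => ?_, fun x => ?_⟩
  · unfold rwStep
    rw [← Finset.sum_div]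
    exact div_self (h.deg_pos hx).ne'
  · obtain ⟨m, hm, hr⟩ := h.reach x
    exact ⟨m, hm, Relation.ReflTransGen.mono (fun a b hab =>
      div_pos hab (lt_of_lt_of_le hab (h.weight_le_deg a b))) _ _ hr⟩

theorem lap_eq (h : IsNetwork w M) {x : X} (hx : x ∉ M) (u : X → ℝ) :
    lap w u x = deg w x * (u x - ∑ y, rwStep w x y * u y) := by
  have hd := (h.deg_pos hx).ne'
  unfold lap rwStep
  simp only [mul_sub, Finset.sum_sub_distrib, ← Finset.sum_mul, Finset.mul_sum]
  congr 1
  refine Finset.sum_congr rfl fun y _ => ?_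
  field_simp

/-- The dictionary between Poisson equations and first-step equations of the random walk; the Markov
results of the previous part thereby become results on potentials. -/
theorem lap_eq_iff (h : IsNetwork w M) {x : X} (hx : x ∉ M) (u : X → ℝ) (c : ℝ) :
    lap w u x = deg w x * c ↔ u x = c + ∑ y, rwStep w x y * u y := by
  rw [h.lap_eq hx, mul_right_inj' (h.deg_pos hx).ne', sub_eq_iff_eq_add]

/-- Summation by parts: gradients pair with antisymmetric functions through the divergence. -/
theorem _root_.Elfs.sum_sub_mul (g : X → X → ℝ) (hg : ∀ x y, g x y = -g y x) (a : X → ℝ) :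
    ∑ x, ∑ y, (a x - a y) * g x y = 2 * ∑ x, a x * ∑ y, g x y := by
  have : ∑ x, ∑ y, a y * g x y = - ∑ x, ∑ y, a x * g x y := by
    rw [Finset.sum_comm, ← Finset.sum_neg_distrib]
    refine Finset.sum_congr rfl fun x _ => ?_
    rw [← Finset.sum_neg_distrib]
    exact Finset.sum_congr rfl fun y _ => by rw [hg y x]; ring
  simp only [sub_mul, Finset.sum_sub_distrib, this, Finset.mul_sum]
  simp only [← Finset.mul_sum]
  ring

theorem sum_mul_lap (h : IsNetwork w M) (a b : X → ℝ) :
    ∑ x, ∑ y, w x y * ((a x - a y) * (b x - b y)) = 2 * ∑ x, a x * lap w b x := by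
  have := sum_sub_mul (fun x y => w x y * (b x - b y))
    (fun x y => by rw [h.symm x y]; ring) a
  unfold lap
  rw [← this]
  exact Finset.sum_congr rfl fun x _ => Finset.sum_congr rfl fun y _ => by ring

theorem lap_comm (h : IsNetwork w M) (a b : X → ℝ) :
    ∑ x, a x * lap w b x = ∑ x, b x * lap w a x := by
  have h1 := h.sum_mul_lap a b
  have h2 := h.sum_mul_lap b a
  have : ∑ x, ∑ y, w x y * ((a x - a y) * (b x - b y)) =
      ∑ x, ∑ y, w x y * ((b x - b y) * (a x - a y)) :=
    Finset.sum_congr rfl fun x _ => Finset.sum_congr rfl fun y _ => by ring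
  linarith

theorem sum_lap (h : IsNetwork w M) (b : X → ℝ) : ∑ x, lap w b x = 0 := by
  have := h.lap_comm (fun _ => 1) b
  simpa [lap] using this

theorem exists_potential (h : IsNetwork w M) {s : X} (hs : s ∉ M) : ∃ v, IsPotential w M s v := by
  -- The cost 1/d_s at s is what makes the Laplacian equal to 1 there.
  obtain ⟨v, hM, hv⟩ := h.rw_absorbing.exists_solution 0
    (fun x => if x = s then (deg w s)⁻¹ else 0)
  refine ⟨v, hM, ?_, fun x hxs hx => ?_⟩
  · rw [(h.lap_eq_iff hs v _).2 (hv s hs), if_pos rfl]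
    exact mul_inv_cancel₀ (h.deg_pos hs).ne'
  · rw [(h.lap_eq_iff hx v _).2 (hv x hx), if_neg hxs, mul_zero]

end IsNetwork

/-- The potential of the unit electric flow from `s` to `M`. -/
def potential (w : X → X → ℝ) (M : Finset X) (s : X) : X → ℝ :=
  open Classical in if h : ∃ v, IsPotential w M s v then h.choose else 0

theorem IsNetwork.isPotential {w : X → X → ℝ} {M : Finset X} (h : IsNetwork w M) {s : X}
    (hs : s ∉ M) : IsPotential w M s (potential w M s) := by
  have := h.exists_potential hs
  unfold potential
  rw [dif_pos this]
  exact this.choose_spec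

/-- The escape time as a real number. -/
def escape (w : X → X → ℝ) (M : Finset X) (s : X) : ℝ :=
  (∑ x, deg w x * potential w M s x ^ 2) / potential w M s s

namespace IsPotential

variable {w : X → X → ℝ} {M : Finset X} {s : X} {v : X → ℝ}

theorem sum_mul_div (hv : IsPotential w M s v) {g : X → ℝ}
    (hg : ∀ x, x ≠ s → x ∉ M → g x = 0) : ∑ x, v x * g x = v s * g s := by
  rw [Finset.sum_eq_single s]
  · intro x _ hx
    by_cases hM : x ∈ M
    · simp [hv.zero x hM]
    · simp [hg x hx hM]
  · simp

theorem sum_mul_lap (hv : IsPotential w M s v) {h : X → ℝ} (hh : ∀ m ∈ M, h m = 0) :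
    ∑ x, h x * lap w v x = h s := by
  rw [Finset.sum_eq_single s, hv.source, mul_one]
  · intro x _ hx
    by_cases hM : x ∈ M
    · simp [hh x hM]
    · simp [hv.harmonic x hx hM]
  · simp

theorem nonneg (hN : IsNetwork w M) (hv : IsPotential w M s v) (x : X) : 0 ≤ v x := by
  refine hN.rw_absorbing.min_principle v (fun m hm => (hv.zero m hm).ge) (fun x hx => ?_) x
  have h1 := hN.lap_eq hx v
  have h2 : 0 ≤ lap w v x := by
    by_cases hxs : x = s
    · rw [hxs, hv.source]; norm_num
    · rw [hv.harmonic x hxs hx]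
  rw [h1] at h2
  have := nonneg_of_mul_nonneg_right h2 (hN.deg_pos hx)
  linarith

theorem one_le (hN : IsNetwork w M) (hv : IsPotential w M s v) : 1 ≤ deg w s * v s := by
  rw [← hv.source]
  unfold lap deg
  rw [Finset.sum_mul]
  refine Finset.sum_le_sum fun y _ => mul_le_mul_of_nonneg_left ?_ (hN.nonneg s y)
  linarith [hv.nonneg hN y]

theorem pos (hN : IsNetwork w M) (hv : IsPotential w M s v) : 0 < v s := by
  rcases (hv.nonneg hN s).lt_or_eq with h | h
  · exact h
  · have := hv.one_le hN
    rw [← h] at this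
    norm_num at this

theorem isUnitFlow (hN : IsNetwork w M) (hs : s ∉ M) (hv : IsPotential w M s v) :
    IsUnitFlow w M s (fun x y => w x y * (v x - v y)) where
  supp x y h := by simp [h]
  antisymm x y := by rw [hN.symm x y]; ring
  source := hv.source
  inner := hv.harmonic
  sink := by
    have h1 : ∑ m ∈ M, ∑ y, w y m * (v y - v m) = - ∑ m ∈ M, lap w v m := by
      unfold lap
      rw [← Finset.sum_neg_distrib]
      refine Finset.sum_congr rfl fun m _ => ?_
      rw [← Finset.sum_neg_distrib]
      exact Finset.sum_congr rfl fun y _ => by rw [hN.symm y m]; ring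
    have h2 := hN.sum_lap v
    rw [← Finset.sum_add_sum_compl M] at h2
    have h3 : ∑ x ∈ Mᶜ, lap w v x = 1 := by
      rw [Finset.sum_eq_single s, hv.source]
      · intro x hx hxs
        exact hv.harmonic x hxs (Finset.mem_compl.1 hx)
      · intro h
        exact absurd (Finset.mem_compl.2 hs) h
    rw [h1]
    linarith

theorem sum_potential_mul (hv : IsPotential w M s v)
    {g : X → X → ℝ} (hg : IsUnitFlow w M s g) : ∑ x, ∑ y, (v x - v y) * g x y = 2 * v s := by
  rw [sum_sub_mul g hg.antisymm, hv.sum_mul_div hg.inner, hg.source, mul_one]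

/-- Pythagoras: the pairing of the gradient of v with any unit flow is 2v_s, so the difference
between a unit flow and the potential flow is orthogonal to the latter in the energy product.
Minimality, uniqueness and the value v_s of the resistance all follow. -/
theorem energy_eq (hN : IsNetwork w M) (hs : s ∉ M) (hv : IsPotential w M s v)
    {g : X → X → ℝ} (hg : IsUnitFlow w M s g) :
    energy w g = v s + energy w (fun x y => g x y - w x y * (v x - v y)) := by
  have h1 := hv.sum_potential_mul hg
  have h2 := hv.sum_potential_mul (hv.isUnitFlow hN hs)
  unfold energy
  have : ∑ x, ∑ y, g x y ^ 2 / w x y = 2 * (∑ x, ∑ y, (v x - v y) * g x y) -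
      (∑ x, ∑ y, (v x - v y) * (w x y * (v x - v y))) +
      ∑ x, ∑ y, (g x y - w x y * (v x - v y)) ^ 2 / w x y := by
    simp only [Finset.mul_sum, ← Finset.sum_add_distrib, ← Finset.sum_sub_distrib]
    refine Finset.sum_congr rfl fun x _ => Finset.sum_congr rfl fun y _ => ?_
    by_cases hw : w x y = 0
    · simp [hw, hg.supp x y hw]
    · field_simp
      ring
  rw [this, h1, h2]
  ring

theorem energy_flow (hN : IsNetwork w M) (hs : s ∉ M) (hv : IsPotential w M s v) :
    energy w (fun x y => w x y * (v x - v y)) = v s := by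
  rw [hv.energy_eq hN hs (hv.isUnitFlow hN hs)]
  simp [energy]

theorem isElectricFlow (hN : IsNetwork w M) (hs : s ∉ M) (hv : IsPotential w M s v) :
    IsElectricFlow w M s (fun x y => w x y * (v x - v y)) := by
  refine ⟨hv.isUnitFlow hN hs, fun g hg => ?_⟩
  rw [hv.energy_flow hN hs, hv.energy_eq hN hs hg, le_add_iff_nonneg_right]
  unfold energy
  have : 0 ≤ ∑ x, ∑ y, (g x y - w x y * (v x - v y)) ^ 2 / w x y :=
    Finset.sum_nonneg fun x _ => Finset.sum_nonneg fun y _ =>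
      div_nonneg (sq_nonneg _) (hN.nonneg x y)
  linarith

theorem electricFlow_eq (hN : IsNetwork w M) (hs : s ∉ M) (hv : IsPotential w M s v) :
    electricFlow w M s = fun x y => w x y * (v x - v y) := by
  have hex : ∃ f, IsElectricFlow w M s f := ⟨_, hv.isElectricFlow hN hs⟩
  have hf : IsElectricFlow w M s (electricFlow w M s) := by
    unfold electricFlow
    rw [dif_pos hex]
    exact hex.choose_spec
  set f := electricFlow w M s
  have hle := hf.2 _ (hv.isUnitFlow hN hs)
  rw [hv.energy_flow hN hs, hv.energy_eq hN hs hf.1] at hle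
  have hnn : ∀ x y, 0 ≤ (f x y - w x y * (v x - v y)) ^ 2 / w x y := fun x y =>
    div_nonneg (sq_nonneg _) (hN.nonneg x y)
  have h0 : ∑ x, ∑ y, (f x y - w x y * (v x - v y)) ^ 2 / w x y = 0 := by
    refine le_antisymm ?_ (Finset.sum_nonneg fun x _ => Finset.sum_nonneg fun y _ => hnn x y)
    unfold energy at hle
    linarith
  ext x y
  have h1 := (Finset.sum_eq_zero_iff_of_nonneg
    (fun x _ => Finset.sum_nonneg fun y _ => hnn x y)).1 h0 x (Finset.mem_univ x)
  have h2 := (Finset.sum_eq_zero_iff_of_nonneg (fun y _ => hnn x y)).1 h1 y (Finset.mem_univ y)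
  -- Where the weight is 0, the quotient is 0 by convention and says nothing; there the support
  -- condition on flows gives equality.
  by_cases hw : w x y = 0
  · simp [hw, hf.1.supp x y hw]
  · rcases div_eq_zero_iff.1 h2 with h3 | h3
    · linarith [pow_eq_zero_iff (two_ne_zero) |>.1 h3]
    · exact absurd h3 hw

theorem effRes_eq (hN : IsNetwork w M) (hs : s ∉ M) (hv : IsPotential w M s v) :
    effRes w M s = v s := by
  unfold effRes
  rw [hv.electricFlow_eq hN hs, hv.energy_flow hN hs]

theorem elfStep_eq (hN : IsNetwork w M) (hs : s ∉ M) (hv : IsPotential w M s v) (y : X) :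
    elfStep w M s y = 1 / (2 * v s) * ∑ z, w y z * (v y - v z) ^ 2 := by
  unfold elfStep
  rw [hv.effRes_eq hN hs, hv.electricFlow_eq hN hs]
  congr 1
  refine Finset.sum_congr rfl fun z _ => ?_
  by_cases hw : w y z = 0
  · simp [hw]
  · field_simp

/-- The transition weights are 2 v Lv - L(v²) up to normalisation. Against h, the first term sees
only s, where Lv = 1 (v vanishes on M), and the second moves to h by self-adjointness. -/
theorem sum_elfStep (hN : IsNetwork w M) (hs : s ∉ M) (hv : IsPotential w M s v) (h : X → ℝ) :
    ∑ y, elfStep w M s y * h y = h s - 1 / (2 * v s) * ∑ y, lap w h y * v y ^ 2 := by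
  have hpos := hv.pos hN
  have h1 : ∀ y, ∑ z, w y z * (v y - v z) ^ 2 = 2 * v y * lap w v y - lap w (fun x => v x ^ 2) y := by
    intro y
    unfold lap
    rw [Finset.mul_sum, ← Finset.sum_sub_distrib]
    exact Finset.sum_congr rfl fun z _ => by ring
  have h2 : ∑ y, v y * (h y * lap w v y) = v s * (h s * lap w v s) :=
    hv.sum_mul_div fun x hx hM => by rw [hv.harmonic x hx hM, mul_zero]
  have h3 := hN.lap_comm h (fun x => v x ^ 2)
  simp only [hv.elfStep_eq hN hs, h1]
  have h4 : ∑ y, 1 / (2 * v s) * (2 * v y * lap w v y - lap w (fun x => v x ^ 2) y) * h y =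
      1 / (2 * v s) * (2 * ∑ y, v y * (h y * lap w v y) -
        ∑ y, h y * lap w (fun x => v x ^ 2) y) := by
    rw [Finset.mul_sum, ← Finset.sum_sub_distrib, Finset.mul_sum]
    exact Finset.sum_congr rfl fun y _ => by ring
  rw [h4, h2, h3, hv.source]
  have h5 : ∑ x, v x ^ 2 * lap w h x = ∑ y, lap w h y * v y ^ 2 :=
    Finset.sum_congr rfl fun y _ => mul_comm _ _
  rw [h5]
  field_simp

end IsPotential

namespace IsNetwork

variable {w : X → X → ℝ} {M : Finset X}

theorem elf_absorbing (hN : IsNetwork w M) : IsAbsorbing (elfStep w M) M := by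
  have hnn : ∀ x ∉ M, ∀ y, 0 ≤ elfStep w M x y := fun x hx y => by
    have hv := hN.isPotential hx
    rw [hv.elfStep_eq hN hx]
    have := hv.pos hN
    exact mul_nonneg (by positivity)
      (Finset.sum_nonneg fun z _ => mul_nonneg (hN.nonneg y z) (sq_nonneg _))
  refine ⟨hnn, fun x hx => ?_, fun x => ?_⟩
  · have := (hN.isPotential hx).sum_elfStep hN hx (fun _ => 1)
    simpa [lap] using this
  · by_cases hx : x ∈ M
    · exact ⟨x, hx, .refl⟩
    have hv := hN.isPotential hx
    have hpos := hv.pos hN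
    -- Unit flow arrives in the sink, so some edge into some m ∈ M carries flow, and a single elfs
    -- step reaches m.
    obtain ⟨m, hm, hne⟩ := Finset.exists_ne_zero_of_sum_ne_zero
      (ne_of_eq_of_ne (hv.isUnitFlow hN hx).sink one_ne_zero)
    obtain ⟨y, -, hy⟩ := Finset.exists_ne_zero_of_sum_ne_zero hne
    refine ⟨m, hm, .single ?_⟩
    rw [hv.elfStep_eq hN hx]
    refine mul_pos (by positivity) (lt_of_lt_of_le ?_ (Finset.single_le_sum
      (f := fun z => w m z * (potential w M x m - potential w M x z) ^ 2)
      (fun z _ => mul_nonneg (hN.nonneg m z) (sq_nonneg _)) (Finset.mem_univ y)))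
    have h1 : w y m ≠ 0 := left_ne_zero_of_mul hy
    have h2 := right_ne_zero_of_mul hy
    rw [hN.symm m y]
    have h3 : potential w M x m - potential w M x y ≠ 0 := fun h => h2 (by linarith)
    exact mul_pos (lt_of_le_of_ne (hN.nonneg y m) h1.symm) (by positivity)

/-- The hitting time as a function on the vertices. -/
theorem exists_hittingTime (hN : IsNetwork w M) : ∃ h : X → ℝ, (∀ x, 0 ≤ h x) ∧
    (∀ m ∈ M, h m = 0) ∧ (∀ x ∉ M, lap w h x = deg w x) ∧
    ∀ s, hittingTime w M s = ENNReal.ofReal (h s) := by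
  obtain ⟨u, hu, hM, hs, hE⟩ := hN.rw_absorbing.exists_cost (c := fun _ => 1) (fun _ _ => zero_le_one)
  refine ⟨u, hu, hM, fun x hx => ?_, fun s => ?_⟩
  · rw [(hN.lap_eq_iff hx u 1).2 (hs x hx), mul_one]
  · rw [← hE s]
    unfold hittingTime
    simp

theorem lastExit_cons (s x : X) (p : Path X) :
    lastExit s (Path.cons x p) =
      if 0 < lastExit s p then lastExit s p + 1 else if x = s then 1 else 0 := by
  have h1 : lastExit s (Path.cons x p) = (if x = s then 1 else 0) ⊔
      Finset.univ.sup (fun i : Fin p.1 => if p.2 i.castSucc = s then (i : ℕ) + 1 + 1 else 0) := by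
    unfold lastExit
    change Finset.univ.sup (fun i : Fin (p.1 + 1) =>
      if (Fin.cons x p.2 : Fin (p.1 + 2) → X) i.castSucc = s then (i : ℕ) + 1 else 0) = _
    rw [Fin.univ_succ, Finset.sup_cons, Finset.sup_map]
    congr 1
  have h2 : Finset.univ.sup (fun i : Fin p.1 => if p.2 i.castSucc = s then (i : ℕ) + 1 + 1 else 0) =
      if 0 < lastExit s p then lastExit s p + 1 else 0 := by
    unfold lastExit
    generalize (Finset.univ : Finset (Fin p.1)) = A
    induction A using Finset.induction_on with
    | empty => simp
    | insert i A _ ih =>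
      rw [Finset.sup_insert, Finset.sup_insert, ih]
      generalize A.sup (fun i : Fin p.1 => if p.2 i.castSucc = s then (i : ℕ) + 1 else 0) = a
      split_ifs <;> simp_all
  rw [h1, h2]
  split_ifs <;> simp

theorem lastExit_le (s : X) (p : Path X) : lastExit s p ≤ p.1 := by
  unfold lastExit
  refine Finset.sup_le fun i _ => ?_
  split_ifs
  · exact i.2
  · exact Nat.zero_le _

/-- `1` if the path visits `s` before its last step. -/
def hit (s : X) (p : Path X) : ℝ≥0∞ := if 0 < lastExit s p then 1 else 0

theorem hit_cons (s x : X) (p : Path X) :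
    hit s (Path.cons x p) = if x = s then 1 else hit s p := by
  unfold hit
  rw [lastExit_cons]
  split_ifs <;> simp_all

/-- Prepending a vertex delays the last exit by one step, or creates one at time 1 if x = s, exactly
when the extended path visits s. So the expected last exit is an additive cost with running cost the
hitting probability of s. -/
theorem lastExit_cons_eq (s x : X) (p : Path X) :
    (lastExit s (Path.cons x p) : ℝ≥0∞) = lastExit s p + hit s (Path.cons x p) := by
  rw [hit_cons]
  unfold hit
  rw [lastExit_cons]
  split_ifs <;> simp_all

theorem lastExit_single (s x : X) : lastExit s (Path.single x) = 0 :=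
  Nat.le_zero.1 (lastExit_le s (Path.single x))

/-- Both sides are harmonic off M ∪ {s}, with values 1 at s and 0 on M; uniqueness is applied to the
enlarged sink. -/
theorem expect_hit (hN : IsNetwork w M) {s : X} (hs : s ∉ M) {v : X → ℝ}
    (hv : IsPotential w M s v) (x : X) :
    expect (rwStep w) M x (hit s) = ENNReal.ofReal (v x / v s) := by
  have hA := hN.rw_absorbing
  have hA' := (hN.mono (Finset.subset_insert s M)).rw_absorbing
  have hpos := hv.pos hN
  refine hA'.ofReal_of_step (E := fun x => expect (rwStep w) M x (hit s)) (u := fun x => v x / v s)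
    (c := 0) (fun x => ?_) (fun _ _ => le_rfl) (fun m hm => ?_) (fun x hx => ?_) (fun x hx => ?_) x
  · refine ne_top_of_le_ne_top ENNReal.one_ne_top (le_trans (expect_mono _ _ _ fun p => ?_)
      (hA.expect_one_le x))
    unfold hit
    split_ifs <;> simp
  · rcases Finset.mem_insert.1 hm with rfl | hm
    · rw [expect_step _ _ hA.nonneg hs]
      simp only [hit_cons, if_true, hA.expect_one, mul_one, hA.sum_ofReal hs, ENNReal.toReal_one]
      rw [div_self hpos.ne']
    · rw [expect_sink _ _ hA.nonneg hm]
      simp [hit, lastExit_single, hv.zero m hm]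
  · rw [Finset.mem_insert, not_or] at hx
    rw [expect_step _ _ hA.nonneg hx.2]
    simp [hit_cons, hx.1]
  · rw [Finset.mem_insert, not_or] at hx
    have := (hN.lap_eq_iff hx.2 v 0).1 (by rw [hv.harmonic x hx.1 hx.2, mul_zero])
    simp only [Pi.zero_apply]
    rw [this]
    simp only [zero_add, Finset.sum_div, mul_div_assoc]

/-- The expected last exit u from a variable starting vertex satisfies Lu = d·v/v_s off M. Pairing
with the Green function gives u(s) = ∑ u Lv = ∑ v Lu. Finiteness comes from the hitting time, which
bounds u. -/
theorem escapeTime_eq (hN : IsNetwork w M) {s : X} (hs : s ∉ M) {v : X → ℝ}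
    (hv : IsPotential w M s v) :
    escapeTime w M s = ENNReal.ofReal ((∑ x, deg w x * v x ^ 2) / v s) := by
  have hA := hN.rw_absorbing
  have hpos := hv.pos hN
  obtain ⟨h, -, -, -, hh⟩ := hN.exists_hittingTime
  obtain ⟨u, hM, hu⟩ := hA.exists_solution 0 (fun x => v x / v s)
  have key := hA.ofReal_of_step
    (E := fun x => expect (rwStep w) M x (fun p => (lastExit s p : ℝ≥0∞))) (u := u)
    (c := fun x => v x / v s) (fun x => ?_) (fun x _ => div_nonneg (hv.nonneg hN x) hpos.le)
    (fun m hm => ?_) (fun x hx => ?_) hu s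
  · unfold escapeTime
    rw [key]
    congr 1
    have h1 := hv.sum_mul_lap (h := u) hM
    rw [hN.lap_comm] at h1
    rw [← h1, Finset.sum_div]
    refine Finset.sum_congr rfl fun x _ => ?_
    by_cases hx : x ∈ M
    · simp [hv.zero x hx]
    · rw [(hN.lap_eq_iff hx u _).2 (hu x hx)]
      ring
  · refine ne_top_of_le_ne_top (b := hittingTime w M x) (by rw [hh]; exact ENNReal.ofReal_ne_top) ?_
    exact expect_mono _ _ _ fun p => by exact_mod_cast lastExit_le s p
  · rw [expect_sink _ _ hA.nonneg hm]
    simp [lastExit_single, hM m hm]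
  · rw [← hN.expect_hit hs hv, expect_step _ _ hA.nonneg hx, expect_step _ _ hA.nonneg hx,
      ← Finset.sum_add_distrib]
    refine Finset.sum_congr rfl fun y _ => ?_
    rw [← mul_add, ← expect_add]
    congr 2
    ext p
    rw [lastExit_cons_eq, add_comm]

theorem escapeTime_eq_escape (hN : IsNetwork w M) {s : X} (hs : s ∉ M) :
    escapeTime w M s = ENNReal.ofReal (escape w M s) :=
  hN.escapeTime_eq hs (hN.isPotential hs)

theorem deg_nonneg (hN : IsNetwork w M) (x : X) : 0 ≤ deg w x :=
  Finset.sum_nonneg fun y _ => hN.nonneg x y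

theorem one_le_escape (hN : IsNetwork w M) {s : X} (hs : s ∉ M) : 1 ≤ escape w M s := by
  have hv := hN.isPotential hs
  have hpos := hv.pos hN
  unfold escape
  rw [le_div_iff₀ hpos, one_mul]
  refine le_trans ?_ (Finset.single_le_sum (f := fun x => deg w x * potential w M s x ^ 2)
    (fun x _ => mul_nonneg (hN.deg_nonneg x) (sq_nonneg _)) (Finset.mem_univ s))
  have := hv.one_le hN
  nlinarith

/-- `IsPotential.sum_elfStep` with Lh = d: the drift is half the escape time. So 2·HT is the
expected sum of the escape times along the elfs process. -/
theorem elf_hitting (hN : IsNetwork w M) {h : X → ℝ} (hh : ∀ x ∉ M, lap w h x = deg w x)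
    {x : X} (hx : x ∉ M) :
    2 * h x = escape w M x + ∑ y, elfStep w M x y * (2 * h y) := by
  have hv := hN.isPotential hx
  have hpos := hv.pos hN
  have h1 := hv.sum_elfStep hN hx h
  have h2 : ∑ y, lap w h y * potential w M x y ^ 2 = ∑ y, deg w y * potential w M x y ^ 2 := by
    refine Finset.sum_congr rfl fun y _ => ?_
    by_cases hy : y ∈ M
    · simp [hv.zero y hy]
    · rw [hh y hy]
  have h3 : ∑ y, elfStep w M x y * (2 * h y) = 2 * ∑ y, elfStep w M x y * h y := by
    rw [Finset.mul_sum]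
    exact Finset.sum_congr rfl fun y _ => by ring
  rw [h3, h1, h2]
  unfold escape
  field_simp
  ring

/-- The probability u that the random walk arrives in m has Lu = 0 off M, so it is harmonic for the
elfs chain as well, with the same boundary values. -/
theorem arrival_elf_eq_rw (hN : IsNetwork w M) (s m : X) :
    arrival (elfStep w M) M s m = arrival (rwStep w) M s m := by
  have hA := hN.rw_absorbing
  obtain ⟨u, hM, hu⟩ := hA.exists_solution (fun x => if x = m then 1 else 0) 0
  have hnn : ∀ x, 0 ≤ u x := hA.min_principle u
    (fun x hx => by rw [hM x hx]; split_ifs <;> norm_num)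
    (fun x hx => by rw [hu x hx]; simp)
  have hu' : ∀ x ∉ M, u x = (0 : X → ℝ) x + ∑ y, elfStep w M x y * u y := fun x hx => by
    have hv := hN.isPotential hx
    rw [hv.sum_elfStep hN hx]
    have : ∑ y, lap w u y * potential w M x y ^ 2 = 0 := by
      refine Finset.sum_eq_zero fun y _ => ?_
      by_cases hy : y ∈ M
      · simp [hv.zero y hy]
      · rw [(hN.lap_eq_iff hy u 0).2 (hu y hy)]
        simp
    rw [this]
    simp
  have key : ∀ P, IsAbsorbing P M → (∀ x ∉ M, u x = (0 : X → ℝ) x + ∑ y, P x y * u y) →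
      arrival P M s m = ENNReal.ofReal (u s) := by
    intro P hP hs
    rw [← hP.expect_cost (fun _ _ => le_rfl) hnn hs s]
    unfold arrival expect
    refine tsum_congr fun p => ?_
    by_cases hp : p.2 (Fin.last p.1) ∈ M
    · simp only [IsAbsorbing.cost, ENNReal.ofReal_zero, Finset.sum_const_zero,
        zero_add, hM _ hp]
      split_ifs <;> simp
    · simp [pathProb, hp]
  rw [key _ hN.elf_absorbing hu', key _ hA hu]

/-- Cauchy–Schwarz for E ∑ √b in the form of a weighted mean inequality: √(β·ET) ≤ (l + β·ET/l)/2 at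
each vertex, summed along the process by the minimum principle, then optimised over l. -/
theorem elfCost_le (hN : IsNetwork w M) {s : X} (hs : s ∉ M) {b : X → ℝ} {β : ℝ}
    (hb : ∀ v, v ∉ M → escapeTime w M v ≤ ENNReal.ofReal (b v))
    (hβ : ∀ v, v ∉ M → ENNReal.ofReal (b v) ≤ ENNReal.ofReal β * escapeTime w M v) :
    elfCost w M s b ≤
      (2 * ENNReal.ofReal β * elecHittingTime w M s * hittingTime w M s) ^ (1 / 2 : ℝ) := by
  have hA := hN.elf_absorbing
  obtain ⟨h, hnn, hM, hh, hHT⟩ := hN.exists_hittingTime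
  have hβ0 : 0 < β := by
    by_contra! hneg
    have h1 := (hb s hs).trans (hβ s hs)
    rw [ENNReal.ofReal_of_nonpos hneg, zero_mul, hN.escapeTime_eq_escape hs, nonpos_iff_eq_zero,
      ENNReal.ofReal_eq_zero] at h1
    linarith [hN.one_le_escape hs]
  have hb' : ∀ v, v ∉ M → b v ≤ β * escape w M v := fun v hv => by
    have h1 := hβ v hv
    have h2 := hN.one_le_escape hv
    rw [hN.escapeTime_eq_escape hv, ← ENNReal.ofReal_mul hβ0.le] at h1
    exact (ENNReal.ofReal_le_ofReal_iff (by positivity)).1 h1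
  obtain ⟨e, he, heM, hes, heE⟩ := hA.exists_cost (c := fun _ => 1) (fun _ _ => zero_le_one)
  obtain ⟨c, hc, hcM, hcs, hcE⟩ := hA.exists_cost (c := fun x => Real.sqrt (b x))
    (fun _ _ => Real.sqrt_nonneg _)
  have hEHT : elecHittingTime w M s = ENNReal.ofReal (e s) := by
    rw [← heE s]
    unfold elecHittingTime
    simp
  have he1 : 1 ≤ e s := by
    rw [hes s hs]
    have : 0 ≤ ∑ y, elfStep w M s y * e y :=
      Finset.sum_nonneg fun y _ => mul_nonneg (hA.nonneg s hs y) (he y)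
    linarith
  have hh1 : 0 < h s := by
    have h1 := hN.elf_hitting hh hs
    have : 0 ≤ ∑ y, elfStep w M s y * (2 * h y) :=
      Finset.sum_nonneg fun y _ => mul_nonneg (hA.nonneg s hs y) (by linarith [hnn y])
    linarith [hN.one_le_escape hs]
  have hcost : elfCost w M s b = ENNReal.ofReal (c s) := hcE s
  have key : ∀ l : ℝ, 0 < l → c s ≤ (l * e s + 2 * β * h s / l) / 2 := by
    intro l hl
    have := hA.min_principle (fun x => (l * e x + 2 * β * h x / l) / 2 - c x)
      (fun m hm => by simp [hM m hm, heM m hm, hcM m hm])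
      (fun x hx => by
        have h1 : ∑ y, elfStep w M x y * ((l * e y + 2 * β * h y / l) / 2 - c y) =
            (l * ∑ y, elfStep w M x y * e y) / 2 +
              β / l * (∑ y, elfStep w M x y * (2 * h y)) / 2 - ∑ y, elfStep w M x y * c y := by
          simp only [Finset.mul_sum, Finset.sum_div, ← Finset.sum_add_distrib,
            ← Finset.sum_sub_distrib]
          exact Finset.sum_congr rfl fun y _ => by ring
        have h2 : Real.sqrt (b x) ≤ (l + β / l * escape w M x) / 2 := by
          have h3 := hb' x hx
          have hE := hN.one_le_escape hx
          have h4 : Real.sqrt (b x) ≤ Real.sqrt (β * escape w M x) := Real.sqrt_le_sqrt h3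
          refine h4.trans ?_
          have h5 : Real.sqrt (β * escape w M x) ^ 2 = β * escape w M x :=
            Real.sq_sqrt (by positivity)
          have h6 : β / l * escape w M x = Real.sqrt (β * escape w M x) ^ 2 / l := by
            rw [h5]; ring
          rw [h6]
          set q := Real.sqrt (β * escape w M x)
          have h7 : l + q ^ 2 / l - 2 * q = (l - q) ^ 2 / l := by field_simp; ring
          have : 0 ≤ (l - q) ^ 2 / l := by positivity
          linarith
        have h3 := hes x hx
        have h4 := hcs x hx
        have h5 := hN.elf_hitting hh hx
        rw [h1]
        have h6 : 2 * β * h x / l = β / l * (2 * h x) := by ring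
        rw [h6, h5, h3, h4]
        linarith [h2]) s
    linarith
  have hfin : c s ≤ Real.sqrt (2 * β * e s * h s) := by
    have h1 : 0 < Real.sqrt (2 * β * e s * h s) := Real.sqrt_pos.2 (by positivity)
    have h2 : Real.sqrt (2 * β * e s * h s) ^ 2 = 2 * β * e s * h s := Real.sq_sqrt (by positivity)
    -- The minimiser l = √(2β·HT/EHT), at which the two terms agree.
    have := key (Real.sqrt (2 * β * e s * h s) / e s) (by positivity)
    refine this.trans (le_of_eq ?_)
    set q := Real.sqrt (2 * β * e s * h s)
    have h3 : e s ≠ 0 := by positivity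
    have h4 : 2 * β * h s / (q / e s) = q := by
      field_simp
      linarith
    rw [h4]
    field_simp
    ring
  rw [hcost, hEHT, hHT, show (2 : ℝ≥0∞) = ENNReal.ofReal 2 by simp,
    ← ENNReal.ofReal_mul (by norm_num), ← ENNReal.ofReal_mul (by positivity),
    ← ENNReal.ofReal_mul (by positivity), ENNReal.ofReal_rpow_of_nonneg (by positivity) (by norm_num),
    ← Real.sqrt_eq_rpow]
  exact ENNReal.ofReal_le_ofReal hfin

end IsNetwork

end Network

/-! ### Orthogonal series -/

section Orthogonal

variable {ι E : Type*} [NormedAddCommGroup E] [InnerProductSpace ℂ E]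

theorem summable_of_orthogonal [CompleteSpace E] {x : ι → E}
    (ho : Pairwise fun i j => inner ℂ (x i) (x j) = 0) (hs : Summable fun i => ‖x i‖ ^ 2) :
    Summable x := by
  have hV : OrthogonalFamily ℂ (fun i => (Submodule.span ℂ {x i} : Submodule ℂ E))
      (fun i => (Submodule.span ℂ {x i}).subtypeₗᵢ) := by
    refine OrthogonalFamily.of_pairwise fun i j hij => ?_
    change Submodule.span ℂ {x i} ⟂ Submodule.span ℂ {x j}
    rw [Submodule.isOrtho_span]
    intro u hu v hv
    rw [Set.mem_singleton_iff.1 hu, Set.mem_singleton_iff.1 hv, ho hij]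
  exact (hV.summable_iff_norm_sq_summable
    (fun i => ⟨x i, Submodule.mem_span_singleton_self (x i)⟩)).2 hs

theorem hasSum_norm_sq_of_orthogonal {x : ι → E}
    (ho : Pairwise fun i j => inner ℂ (x i) (x j) = 0) {S : E} (hS : HasSum x S) :
    HasSum (fun i => ‖x i‖ ^ 2) (‖S‖ ^ 2) := by
  have h1 : ∀ i, inner ℂ (x i) S = ((‖x i‖ ^ 2 : ℝ) : ℂ) := fun i => by
    have h := hS.mapL (innerSL ℂ (x i))
    have h2 : HasSum (fun j => innerSL ℂ (x i) (x j)) (innerSL ℂ (x i) (x i)) :=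
      hasSum_single i fun j hj => by
        rw [innerSL_apply_apply]
        exact ho hj.symm
    have h3 := h.unique h2
    rw [innerSL_apply_apply, innerSL_apply_apply] at h3
    rw [h3, inner_self_eq_norm_sq_to_K]
    simp
  have h2 := hS.mapL (innerSL ℂ S)
  simp only [innerSL_apply_apply] at h2
  have h3 : ∀ i, inner ℂ S (x i) = ((‖x i‖ ^ 2 : ℝ) : ℂ) := fun i => by
    rw [← inner_conj_symm, h1]
    simp
  simp only [h3] at h2
  rw [inner_self_eq_norm_sq_to_K] at h2
  have h4 : ((‖S‖ : ℂ)) ^ 2 = ((‖S‖ ^ 2 : ℝ) : ℂ) := by simp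
  exact Complex.hasSum_ofReal.1 (by rw [← h4]; exact h2)

end Orthogonal

/-! ### Basis states -/

section Kets

variable {V : Type u} {k : ℕ}

theorem ket_apply_self (c : Config V k) : (ket c : Space V k) c = 1 := by
  simp [ket]

theorem ket_apply_ne {c c' : Config V k} (h : c' ≠ c) : (ket c : Space V k) c' = 0 := by
  simp [ket, h]

theorem inner_ket (c : Config V k) (ψ : Space V k) : inner ℂ (ket c) ψ = ψ c := by
  classical
  unfold ket
  rw [lp.inner_single_left]
  simp

theorem orthonormal_ket : Orthonormal ℂ (ket : Config V k → Space V k) := by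
  classical
  rw [orthonormal_iff_ite]
  intro c c'
  rw [inner_ket]
  split_ifs with h
  · rw [h, ket_apply_self]
  · exact ket_apply_ne h

theorem norm_ket (c : Config V k) : ‖(ket c : Space V k)‖ = 1 := orthonormal_ket.1 c

theorem hasSum_ket (ψ : Space V k) : HasSum (fun c => ψ c • ket c) ψ := by
  classical
  have h := lp.hasSum_single (E := fun _ : Config V k => ℂ) (p := 2) (by simp) ψ
  convert h using 2 with c
  unfold ket
  rw [← lp.single_smul]
  congr 1
  simp

/-- `ψ` is a superposition of basis states from `D`. -/
def SuppIn (D : Set (Config V k)) (ψ : Space V k) : Prop := ∀ c, c ∉ D → ψ c = 0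

theorem SuppIn.mono {D D' : Set (Config V k)} {ψ : Space V k} (h : SuppIn D ψ) (hD : D ⊆ D') :
    SuppIn D' ψ := fun c hc => h c fun hc' => hc (hD hc')

theorem suppIn_ket {D : Set (Config V k)} {c : Config V k} (hc : c ∈ D) : SuppIn D (ket c) :=
  fun _ hc' => ket_apply_ne fun h => hc' (h ▸ hc)

theorem suppIn_zero {D : Set (Config V k)} : SuppIn D (0 : Space V k) := fun _ _ => rfl

theorem SuppIn.add {D : Set (Config V k)} {ψ φ : Space V k} (h : SuppIn D ψ) (h' : SuppIn D φ) :
    SuppIn D (ψ + φ) := fun c hc => by simp [h c hc, h' c hc]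

theorem SuppIn.smul {D : Set (Config V k)} {ψ : Space V k} (h : SuppIn D ψ) (a : ℂ) :
    SuppIn D (a • ψ) := fun c hc => by simp [h c hc]

theorem SuppIn.sum {ι : Type*} {D : Set (Config V k)} {s : Finset ι} {f : ι → Space V k}
    (h : ∀ i ∈ s, SuppIn D (f i)) : SuppIn D (∑ i ∈ s, f i) := by
  classical
  induction s using Finset.induction_on with
  | empty => simpa using suppIn_zero
  | insert i s hi ih =>
    rw [Finset.sum_insert hi]
    exact (h i (Finset.mem_insert_self i s)).add
      (ih fun j hj => h j (Finset.mem_insert_of_mem hj))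

theorem hasSum_coord {ι : Type*} {f : ι → Space V k} {S : Space V k} (h : HasSum f S)
    (c : Config V k) : HasSum (fun i => f i c) (S c) := by
  have := h.mapL (innerSL ℂ (ket c))
  simpa only [innerSL_apply_apply, inner_ket] using this

theorem SuppIn.of_hasSum {ι : Type*} {D : Set (Config V k)} {f : ι → Space V k} {S : Space V k}
    (hS : HasSum f S) (h : ∀ i, SuppIn D (f i)) : SuppIn D S := fun c hc => by
  have := hasSum_coord hS c
  simp only [h _ c hc] at this
  exact this.unique hasSum_zero

theorem SuppIn.tsum {ι : Type*} {D : Set (Config V k)} {f : ι → Space V k}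
    (h : ∀ i, SuppIn D (f i)) : SuppIn D (∑' i, f i) := by
  by_cases hf : Summable f
  · exact SuppIn.of_hasSum hf.hasSum h
  · rw [tsum_eq_zero_of_not_summable hf]
    exact suppIn_zero

theorem SuppIn.inner_eq_zero {D D' : Set (Config V k)} {ψ φ : Space V k} (h : SuppIn D ψ)
    (h' : SuppIn D' φ) (hD : Disjoint D D') : inner ℂ ψ φ = 0 := by
  rw [lp.inner_eq_tsum]
  convert tsum_zero with c
  by_cases hc : c ∈ D
  · rw [h' c (Set.disjoint_left.1 hD hc), inner_zero_right]
  · rw [h c hc, inner_zero_left]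

/-- Continuous linear maps that agree on the basis states from `D` agree on their
superpositions. -/
theorem SuppIn.map_eq {E : Type*} [NormedAddCommGroup E] [NormedSpace ℂ E]
    {D : Set (Config V k)} {ψ : Space V k} (h : SuppIn D ψ) {S T : Space V k →L[ℂ] E}
    (hST : ∀ c ∈ D, S (ket c) = T (ket c)) : S ψ = T ψ := by
  have h1 := (hasSum_ket ψ).mapL S
  have h2 := (hasSum_ket ψ).mapL T
  refine h1.unique ?_
  convert h2 using 2 with c
  rw [map_smul, map_smul]
  by_cases hc : c ∈ D
  · rw [hST c hc]
  · rw [h c hc, zero_smul, zero_smul]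

/-- The span condition makes the orthonormal images total, hence a Hilbert basis. In this
infinite-dimensional space orthonormality alone would yield only an isometry. -/
theorem exists_unitary (act : Config V k → Space V k) (h1 : Orthonormal ℂ act)
    (h2 : ∀ c, ket c ∈ Submodule.span ℂ (Set.range act)) :
    ∃ T : Space V k ≃ₗᵢ[ℂ] Space V k, ∀ c, T (ket c) = act c := by
  classical
  have h3 : (⊤ : Submodule ℂ (Space V k)) ≤
      (Submodule.span ℂ (Set.range act)).topologicalClosure := by
    intro ψ _
    exact (Submodule.isClosed_topologicalClosure _).mem_of_tendsto (hasSum_ket ψ)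
      (Filter.Eventually.of_forall fun s => Submodule.sum_mem _ fun c _ =>
        Submodule.smul_mem _ _ (Submodule.le_topologicalClosure _ (h2 c)))
  let b := HilbertBasis.mk h1 h3
  refine ⟨b.repr.symm, fun c => ?_⟩
  have h4 := b.repr_symm_single c
  rw [HilbertBasis.coe_mk] at h4
  rw [← h4]
  congr 1

theorem eq_of_ket {S T : Space V k ≃ₗᵢ[ℂ] Space V k} (h : ∀ c, S (ket c) = T (ket c)) : S = T := by
  ext1 ψ
  have : SuppIn Set.univ ψ := fun c hc => absurd (Set.mem_univ c) hc
  exact this.map_eq (S := (S.toContinuousLinearEquiv : Space V k →L[ℂ] Space V k))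
    (T := (T.toContinuousLinearEquiv : Space V k →L[ℂ] Space V k)) fun c _ => h c

/-- A unitary that acts by matrices on blocks of basis states. -/
theorem exists_block_unitary {ι : Type*} [Fintype ι] [DecidableEq ι] (idx : Config V k → Option ι)
    (place : Config V k → ι → Config V k) (mat : Config V k → Matrix ι ι ℂ)
    (h1 : ∀ c e, idx c ≠ none → idx (place c e) = some e)
    (h2 : ∀ c e, idx c = some e → place c e = c)
    (h3 : ∀ c e e', idx c ≠ none → place (place c e) e' = place c e')
    (h4 : ∀ c e, idx c ≠ none → mat (place c e) = mat c)
    (h5 : ∀ c, idx c ≠ none → mat c ∈ Matrix.unitaryGroup ι ℂ) :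
    ∃ T : Space V k ≃ₗᵢ[ℂ] Space V k, ∀ c, T (ket c) = match idx c with
      | some e => ∑ e', mat c e' e • ket (place c e')
      | none => ket c := by
  classical
  set act : Config V k → Space V k := fun c => match idx c with
      | some e => ∑ e', mat c e' e • ket (place c e')
      | none => ket c with hact
  have act_none : ∀ c, idx c = none → act c = ket c := fun c hc => by simp [hact, hc]
  have act_some : ∀ c e, idx c = some e → act c = ∑ e', mat c e' e • ket (place c e') :=
    fun c e hc => by simp [hact, hc]
  have supp : ∀ c e, idx c = some e → SuppIn (Set.range (place c)) (act c) := fun c e hc => by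
    rw [act_some c e hc]
    exact SuppIn.sum fun e' _ => (suppIn_ket (Set.mem_range_self e')).smul _
  have hinj : ∀ c, idx c ≠ none → Function.Injective (place c) := fun c hc e e' hee => by
    have a := h1 c e hc
    have b := h1 c e' hc
    rw [hee, b] at a
    exact (Option.some_inj.1 a).symm
  have ortho : Orthonormal ℂ act := by
    rw [orthonormal_iff_ite]
    intro c c'
    rcases hc : idx c with _ | e <;> rcases hc' : idx c' with _ | e'
    · rw [act_none c hc, act_none c' hc']
      exact orthonormal_iff_ite.1 orthonormal_ket c c'
    · have hne : c ≠ c' := fun h => by rw [h, hc'] at hc; exact Option.some_ne_none _ hc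
      rw [if_neg hne, act_none c hc]
      refine (suppIn_ket (Set.mem_singleton c)).inner_eq_zero (supp c' e' hc') ?_
      rw [Set.disjoint_singleton_left]
      rintro ⟨f, rfl⟩
      rw [h1 c' f (by simp [hc'])] at hc
      exact Option.some_ne_none _ hc
    · have hne : c ≠ c' := fun h => by rw [h, hc'] at hc; exact Option.some_ne_none _ hc.symm
      rw [if_neg hne, act_none c' hc']
      refine (supp c e hc).inner_eq_zero (suppIn_ket (Set.mem_singleton c')) ?_
      rw [Set.disjoint_singleton_right]
      rintro ⟨f, rfl⟩
      rw [h1 c f (by simp [hc])] at hc'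
      exact Option.some_ne_none _ hc'
    · have hcn : idx c ≠ none := by simp [hc]
      have hcn' : idx c' ≠ none := by simp [hc']
      by_cases hb : c' ∈ Set.range (place c)
      · obtain ⟨f, rfl⟩ := hb
        have hf : f = e' := by
          rw [h1 c f hcn] at hc'
          exact Option.some_inj.1 hc'
        subst hf
        rw [act_some c e hc, act_some _ f hc', h4 c f hcn]
        simp only [h3 c f _ hcn]
        have hon := orthonormal_ket.comp (place c) (hinj c hcn)
        rw [(show (∑ e', mat c e' e • ket (place c e') : Space V k) =
            ∑ e', mat c e' e • (ket ∘ place c) e' from rfl),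
          (show (∑ e', mat c e' f • ket (place c e') : Space V k) =
            ∑ e', mat c e' f • (ket ∘ place c) e' from rfl),
          hon.inner_sum]
        have hu := Matrix.mem_unitaryGroup_iff'.1 (h5 c hcn)
        have := congrFun (congrFun hu e) f
        simp only [Matrix.mul_apply, Matrix.star_apply, Matrix.one_apply] at this
        have h6 : (c = place c f) ↔ e = f := by
          constructor
          · intro h
            rw [← h] at hc'
            rw [hc'] at hc
            exact (Option.some_inj.1 hc).symm
          · rintro rfl
            exact (h2 c e hc).symm
        simp only [h6]
        rw [← this]
        rfl
      · have hne : c ≠ c' := fun h => hb ⟨e, by rw [h2 c e hc, h]⟩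
        rw [if_neg hne]
        refine (supp c e hc).inner_eq_zero (supp c' e' hc') ?_
        rw [Set.disjoint_left]
        rintro _ ⟨a, rfl⟩ ⟨b, hab⟩
        refine hb ⟨e', ?_⟩
        rw [← h3 c a e' hcn, ← hab, h3 c' b e' hcn', h2 c' e' hc']
  refine exists_unitary act ortho fun c => ?_
  rcases hc : idx c with _ | e
  · rw [← act_none c hc]
    exact Submodule.subset_span ⟨c, rfl⟩
  · have hcn : idx c ≠ none := by simp [hc]
    -- The adjoint of the block matrix inverts it, so each basis state is a finite combination of
    -- images.
    have key : ket c = ∑ f, star (mat c e f) • act (place c f) := by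
      have hu := Matrix.mem_unitaryGroup_iff.1 (h5 c hcn)
      have hact' : ∀ f, act (place c f) = ∑ e', mat c e' f • ket (place c e') := fun f => by
        rw [act_some _ f (h1 c f hcn), h4 c f hcn]
        simp only [h3 c f _ hcn]
      simp only [hact', Finset.smul_sum, smul_smul]
      rw [Finset.sum_comm]
      have : ∀ e', ∑ f, (star (mat c e f) * mat c e' f) • (ket (place c e') : Space V k) =
          (if e' = e then (1 : ℂ) else 0) • ket (place c e') := fun e' => by
        rw [← Finset.sum_smul]
        congr 1
        have := congrFun (congrFun hu e') e
        simp only [Matrix.mul_apply, Matrix.star_apply, Matrix.one_apply] at this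
        rw [← this]
        exact Finset.sum_congr rfl fun f _ => mul_comm _ _
      simp only [this]
      rw [Finset.sum_eq_single e]
      · simp [h2 c e hc]
      · intro f _ hf
        simp [hf]
      · simp
    rw [key]
    exact Submodule.sum_mem _ fun f _ => Submodule.smul_mem _ _ (Submodule.subset_span ⟨_, rfl⟩)

theorem exists_perm_unitary (e : Config V k ≃ Config V k) :
    ∃ T : Space V k ≃ₗᵢ[ℂ] Space V k, ∀ c, T (ket c) = ket (e c) :=
  exists_unitary (fun c => ket (e c)) (orthonormal_ket.comp e e.injective)
    fun c => Submodule.subset_span ⟨e.symm c, by simp⟩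

/-- The unitary that permutes the basis states. -/
def permU (e : Config V k ≃ Config V k) : Space V k ≃ₗᵢ[ℂ] Space V k :=
  (exists_perm_unitary e).choose

theorem permU_ket (e : Config V k ≃ Config V k) (c : Config V k) :
    permU e (ket c) = ket (e c) := (exists_perm_unitary e).choose_spec c

theorem permU_apply (e : Config V k ≃ Config V k) (ψ : Space V k) (c : Config V k) :
    (permU e ψ) c = ψ (e.symm c) := by
  rw [← inner_ket, ← inner_ket, ← (permU e).inner_map_map (ket (e.symm c)), permU_ket,
    Equiv.apply_symm_apply]

open Classical in
/-- Exchange, in every place of the memory, the blank and the content of the pattern `ρ`. -/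
def writeEquiv (ρ : Config V k) : Config V k ≃ Config V k where
  toFun c := ⟨fun i => Equiv.swap (Word.num 0) (ρ.cell i) (c.cell i),
    fun a i => Equiv.swap (Word.num 0) (ρ.arr a i) (c.arr a i)⟩
  invFun c := ⟨fun i => Equiv.swap (Word.num 0) (ρ.cell i) (c.cell i),
    fun a i => Equiv.swap (Word.num 0) (ρ.arr a i) (c.arr a i)⟩
  left_inv c := by simp
  right_inv c := by simp

/-- The unitary that writes the pattern `ρ` into blank places. -/
def write (ρ : Config V k) : Space V k ≃ₗᵢ[ℂ] Space V k := permU (writeEquiv ρ)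

end Kets

/-! ### Elementary operations as unitaries, and programs acting on states. -/

section Gates

variable {V : Type u} {k : ℕ}

theorem Config.ext' {c c' : Config V k} (h1 : ∀ i, c.cell i = c'.cell i)
    (h2 : ∀ a l, c.arr a l = c'.arr a l) : c = c' := by
  cases c; cases c'
  congr
  · exact funext h1
  · exact funext fun a => funext fun l => h2 a l

@[simp] theorem Config.set_cell (c : Config V k) (i j : Fin (k + 1)) (a : Word V) :
    (c.set i a).cell j = if j = i then a else c.cell j := by
  simp [Config.set, Function.update_apply]

@[simp] theorem Config.set_arr (c : Config V k) (i : Fin (k + 1)) (a : Word V) :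
    (c.set i a).arr = c.arr := rfl

@[simp] theorem Config.setArr_cell (c : Config V k) (a : Fin (k + 1)) (l : ℤ) (b : Word V) :
    (c.setArr a l b).cell = c.cell := rfl

@[simp] theorem Config.setArr_arr (c : Config V k) (a a' : Fin (k + 1)) (l l' : ℤ) (b : Word V) :
    (c.setArr a l b).arr a' l' = if a' = a ∧ l' = l then b else c.arr a' l' := by
  unfold Config.setArr
  by_cases h : a' = a
  · subst h
    simp [Function.update_apply]
  · simp [h]

/-- The test does not look at the cells in `S`. -/
def Test.avoids (S : List (Fin (k + 1))) : Test k → Bool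
  | .number i => i ∉ S
  | .isNum i _ => i ∉ S
  | .attached i => i ∉ S
  | .sink i => i ∉ S
  | .same i j => i ∉ S ∧ j ∉ S
  | .less i j => i ∉ S ∧ j ∉ S

/-- The control does not look at the cells in `S`. -/
def Guard.avoids (S : List (Fin (k + 1))) (G : Guard k) : Bool := G.all fun t => t.1.avoids S

variable [Fintype V] [DecidableEq V] {M : Finset V} {b r : V → ℝ}

theorem Guard.holds_iff {S : List (Fin (k + 1))} {G : Guard k} (hG : G.avoids S = true)
    {c c' : Config V k} (h : ∀ i ∉ S, c'.cell i = c.cell i) :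
    Guard.Holds M c' G ↔ Guard.Holds M c G := by
  unfold Guard.Holds
  refine forall₂_congr fun t ht => ?_
  have := List.all_eq_true.1 hG t ht
  rcases t with ⟨t, d⟩
  cases t <;> simp_all [Test.avoids, Test.Holds]

/-- The outcome of the control must survive the operation: only then is the controlled operation a
bijection, with the inverse controlled in the same way. -/
theorem exists_gate_perm {G : Guard k} {o : Op k} (f g : Config V k → Config V k)
    (hf : ∀ c, o.act b r c = ket (f c)) (hfg : ∀ c, f (g c) = c) (hgf : ∀ c, g (f c) = c)
    (hG : ∀ c, Guard.Holds M (f c) G ↔ Guard.Holds M c G) :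
    ∃ T : Space V k ≃ₗᵢ[ℂ] Space V k, ∀ c, T (ket c) = Gate.act M b r c (G, o) := by
  classical
  have hG' : ∀ c, Guard.Holds M (g c) G ↔ Guard.Holds M c G := fun c => by
    rw [← hG (g c), hfg]
  let e : Config V k ≃ Config V k :=
    { toFun := fun c => if Guard.Holds M c G then f c else c
      invFun := fun c => if Guard.Holds M c G then g c else c
      left_inv := fun c => by
        by_cases h : Guard.Holds M c G
        · simp [h, hG, hgf]
        · simp [h]
      right_inv := fun c => by
        by_cases h : Guard.Holds M c G
        · simp [h, hG', hfg]
        · simp [h] }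
  obtain ⟨T, hT⟩ := exists_perm_unitary e
  refine ⟨T, fun c => ?_⟩
  rw [hT]
  unfold Gate.act
  change ket (if Guard.Holds M c G then f c else c) = _
  split_ifs
  · exact (hf c).symm
  · rfl

theorem exists_gate_neg (G : Guard k) :
    ∃ T : Space V k ≃ₗᵢ[ℂ] Space V k, ∀ c, T (ket c) = Gate.act M b r c (G, Op.neg) := by
  classical
  obtain ⟨T, hT⟩ := exists_block_unitary (V := V) (k := k) (ι := Unit)
    (fun c => if Guard.Holds M c G then some () else none) (fun c _ => c) (fun _ => -1)
    (fun c e h => by simpa using h) (fun _ _ _ => rfl) (fun _ _ _ _ => rfl)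
    (fun _ _ _ => rfl) (fun c _ => by simp [Matrix.mem_unitaryGroup_iff])
  refine ⟨T, fun c => ?_⟩
  rw [hT]
  by_cases h : Guard.Holds M c G <;> simp [Gate.act, h, Op.act]

theorem exists_gate_addConst {G : Guard k} {i : Fin (k + 1)} (a : ℤ) (hG : G.avoids [i] = true) :
    ∃ T : Space V k ≃ₗᵢ[ℂ] Space V k, ∀ c, T (ket c) = Gate.act M b r c (G, Op.addConst i a) := by
  let f : ℤ → Config V k → Config V k := fun a c =>
    match c.cell i with
    | .num l => c.set i (Word.num (l + a))
    | .vtx _ => c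
  have hf : ∀ a c, f (-a) (f a c) = c := fun a c => by
    rcases hc : c.cell i with l | x
    · have h1 : f a c = c.set i (Word.num (l + a)) := by simp [f, hc]
      have h2 : (f a c).cell i = Word.num (l + a) := by simp [h1]
      have h3 : f (-a) (f a c) = (f a c).set i (Word.num (l + a + -a)) := by simp only [f] at h2 ⊢; rw [h2]
      rw [h3, h1]
      refine Config.ext' (fun j => ?_) (fun _ _ => rfl)
      by_cases hj : j = i
      · subst hj; simp [hc]
      · simp [hj]
    · simp [f, hc]
  refine exists_gate_perm (f a) (f (-a)) (fun c => ?_) (fun c => ?_) (hf a) (fun c => ?_)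
  · rcases hc : c.cell i with l | x <;> simp [f, Op.act, hc]
  · simpa using hf (-a) c
  · refine Guard.holds_iff hG fun j hj => ?_
    rw [List.mem_singleton] at hj
    rcases hc : c.cell i with l | x <;> simp [f, hc, hj]

open Classical in
theorem exists_gate_exchange {G : Guard k} {i : Fin (k + 1)} (a : ℤ) (hG : G.avoids [i] = true) :
    ∃ T : Space V k ≃ₗᵢ[ℂ] Space V k, ∀ c, T (ket c) = Gate.act M b r c (G, Op.exchange i a) := by
  let f : Config V k → Config V k := fun c =>
    c.set i (Equiv.swap (Word.num a) (Word.vtx none) (c.cell i))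
  have hf : ∀ c, f (f c) = c := fun c => by
    refine Config.ext' (fun j => ?_) (fun _ _ => rfl)
    by_cases hj : j = i
    · subst hj; simp [f]
    · simp [f, hj]
  refine exists_gate_perm f f (fun c => ?_) hf hf (fun c => ?_)
  · simp only [f, Op.act, Equiv.swap_apply_def]
    split_ifs
    · rfl
    · rfl
    · congr 1
      refine Config.ext' (fun j => ?_) (fun _ _ => rfl)
      by_cases hj : j = i
      · subst hj; simp
      · simp [hj]
  · refine Guard.holds_iff hG fun j hj => ?_
    rw [List.mem_singleton] at hj
    simp [f, hj]

open Classical in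
theorem exists_gate_copyCell {G : Guard k} {i j : Fin (k + 1)} (hij : i ≠ j)
    (hG : G.avoids [i] = true) :
    ∃ T : Space V k ≃ₗᵢ[ℂ] Space V k, ∀ c, T (ket c) = Gate.act M b r c (G, Op.copyCell i j) := by
  let f : Config V k → Config V k := fun c =>
    c.set i (Equiv.swap (Word.num 0) (c.cell j) (c.cell i))
  have hf : ∀ c, f (f c) = c := fun c => by
    refine Config.ext' (fun l => ?_) (fun _ _ => rfl)
    by_cases hl : l = i
    · subst hl; simp [f, hij.symm]
    · simp [f, hl]
  refine exists_gate_perm f f (fun c => ?_) hf hf (fun c => ?_)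
  · simp only [f, Op.act, Equiv.swap_apply_def]
    split_ifs
    · rfl
    · rfl
    · congr 1
      refine Config.ext' (fun l => ?_) (fun _ _ => rfl)
      by_cases hl : l = i
      · subst hl; simp
      · simp [hl]
  · refine Guard.holds_iff hG fun l hl => ?_
    rw [List.mem_singleton] at hl
    simp [f, hl]

/-- Invariance of the control is assumed instead of avoidance, since `guardBoth` does inspect the
cells being swapped, but symmetrically. -/
theorem exists_gate_swapCells {G : Guard k} {i j : Fin (k + 1)}
    (hG : ∀ c : Config V k, Guard.Holds M ((c.set i (c.cell j)).set j (c.cell i)) G ↔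
      Guard.Holds M c G) :
    ∃ T : Space V k ≃ₗᵢ[ℂ] Space V k, ∀ c, T (ket c) = Gate.act M b r c (G, Op.swapCells i j) := by
  let f : Config V k → Config V k := fun c => (c.set i (c.cell j)).set j (c.cell i)
  have hf : ∀ c, f (f c) = c := fun c => by
    refine Config.ext' (fun l => ?_) (fun _ _ => rfl)
    simp only [f, Config.set_cell]
    split_ifs <;> simp_all
  exact exists_gate_perm f f (fun c => rfl) hf hf hG

theorem exists_gate_swapCells_of_avoids {G : Guard k} {i j : Fin (k + 1)}
    (hG : G.avoids [i, j] = true) :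
    ∃ T : Space V k ≃ₗᵢ[ℂ] Space V k, ∀ c, T (ket c) = Gate.act M b r c (G, Op.swapCells i j) :=
  exists_gate_swapCells fun c => Guard.holds_iff hG fun l hl => by
    simp only [List.mem_cons, List.not_mem_nil, or_false, not_or] at hl
    simp [hl.1, hl.2]

theorem exists_gate_swapArr {G : Guard k} {i a j : Fin (k + 1)} (hij : i ≠ j)
    (hG : G.avoids [i] = true) :
    ∃ T : Space V k ≃ₗᵢ[ℂ] Space V k, ∀ c, T (ket c) = Gate.act M b r c (G, Op.swapArr i a j) := by
  let f : Config V k → Config V k := fun c =>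
    match c.cell j with
    | .num l => (c.set i (c.arr a l)).setArr a l (c.cell i)
    | .vtx _ => c
  have hf : ∀ c, f (f c) = c := fun c => by
    rcases hc : c.cell j with l | x
    · have h1 : f c = (c.set i (c.arr a l)).setArr a l (c.cell i) := by simp [f, hc]
      have h2 : (f c).cell j = Word.num l := by simp [h1, hij.symm, hc]
      have h3 : f (f c) = ((f c).set i ((f c).arr a l)).setArr a l ((f c).cell i) := by
        simp only [f] at h2 ⊢; rw [h2]
      rw [h3, h1]
      refine Config.ext' (fun m => ?_) (fun a' l' => ?_)
      · by_cases hm : m = i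
        · subst hm; simp
        · simp [hm]
      · simp only [Config.setArr_arr, Config.set_arr, Config.setArr_cell, Config.set_cell, if_true]
        split_ifs with h
        · rw [h.1, h.2]
        · rfl
    · simp [f, hc]
  refine exists_gate_perm f f (fun c => ?_) hf hf (fun c => ?_)
  · rcases hc : c.cell j with l | x <;> simp [f, Op.act, hc]
  · refine Guard.holds_iff hG fun l hl => ?_
    rw [List.mem_singleton] at hl
    rcases hc : c.cell j with l | x <;> simp [f, hc, hl]

/-- The rotation by the angle `θ`. -/
def rotMatrix (θ : ℝ) : Matrix (Fin 2) (Fin 2) ℂ :=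
  !![((Real.cos θ : ℝ) : ℂ), -((Real.sin θ : ℝ) : ℂ); ((Real.sin θ : ℝ) : ℂ), ((Real.cos θ : ℝ) : ℂ)]

theorem rotMatrix_mem (θ : ℝ) : rotMatrix θ ∈ Matrix.unitaryGroup (Fin 2) ℂ := by
  rw [Matrix.mem_unitaryGroup_iff]
  have h : ((Real.cos θ : ℝ) : ℂ) ^ 2 + ((Real.sin θ : ℝ) : ℂ) ^ 2 = 1 := by
    rw [← Complex.ofReal_pow, ← Complex.ofReal_pow, ← Complex.ofReal_add, Real.cos_sq_add_sin_sq]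
    simp
  ext i j
  fin_cases i <;> fin_cases j <;>
    simp [rotMatrix, Matrix.mul_apply, Fin.sum_univ_two, Matrix.star_apply, -Complex.ofReal_cos,
      -Complex.ofReal_sin] <;>
    first | linear_combination h | ring1

open Classical in
theorem exists_rotation {i : Fin (k + 1)} (A : Config V k → Prop) (θ : Config V k → ℝ)
    (hA : ∀ c w, A (c.set i w) ↔ A c) (hθ : ∀ c w, θ (c.set i w) = θ c) :
    ∃ T : Space V k ≃ₗᵢ[ℂ] Space V k, ∀ c, T (ket c) =
      if A c then rotation c i (θ c) else ket c := by
  let idx : Config V k → Option (Fin 2) := fun c =>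
    if A c then if c.cell i = Word.num 0 then some 0 else if c.cell i = Word.num 1 then some 1
      else none else none
  have h10 : (Word.num 1 : Word V) ≠ Word.num 0 := by simp
  have key := exists_block_unitary idx (fun c e => c.set i (Word.num (e : ℕ)))
    (fun c => rotMatrix (θ c))
  specialize key ?_ ?_ ?_ (fun c e _ => by rw [hθ]) (fun c _ => rotMatrix_mem _)
  rotate_left 3
  · obtain ⟨T, hT⟩ := key
    refine ⟨T, fun c => ?_⟩
    rw [hT]
    by_cases hc : A c
    · by_cases h0 : c.cell i = Word.num 0
      · have : c.set i (Word.num 0) = c := by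
          refine Config.ext' (fun j => ?_) (fun _ _ => rfl)
          by_cases hj : j = i
          · subst hj; simp [h0]
          · simp [hj]
        simp [idx, hc, h0, rotation, rotMatrix, Fin.sum_univ_two, this]
      · by_cases h1 : c.cell i = Word.num 1
        · have : c.set i (Word.num 1) = c := by
            refine Config.ext' (fun j => ?_) (fun _ _ => rfl)
            by_cases hj : j = i
            · subst hj; simp [h1]
            · simp [hj]
          simp only [idx, hc, h1, h10, if_true, if_false, rotation, rotMatrix, Fin.sum_univ_two]
          simp [this]
          rw [sub_eq_add_neg, add_comm]
        · simp [idx, hc, h0, h1, rotation]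
    · simp [idx, hc]
  · intro c e h
    have hc : A c := by
      by_contra hc
      exact h (by simp [idx, hc])
    fin_cases e <;> simp [idx, hA, hc]
  · intro c e h
    have hc : A c := by
      by_contra hc
      simp [idx, hc] at h
    refine Config.ext' (fun j => ?_) (fun _ _ => rfl)
    by_cases hj : j = i
    · subst hj
      simp only [idx, hc, if_true] at h
      simp only [Config.set_cell, if_true]
      split_ifs at h with h0 h1
      · rw [h0, ← Option.some_inj.1 h]; rfl
      · rw [h1, ← Option.some_inj.1 h]; rfl
    · simp [hj]
  · intro c e e' _
    refine Config.ext' (fun j => ?_) (fun _ _ => rfl)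
    by_cases hj : j = i
    · subst hj; simp
    · simp [hj]

theorem exists_gate_rotateBy {G : Guard k} {i j : Fin (k + 1)} (hij : i ≠ j) (θ : ℝ → ℝ → ℝ)
    (hG : G.avoids [i] = true) :
    ∃ T : Space V k ≃ₗᵢ[ℂ] Space V k, ∀ c, T (ket c) =
      Gate.act M b r c (G, Op.rotateBy i j θ) := by
  obtain ⟨T, hT⟩ := exists_rotation (V := V) (i := i)
    (fun c => Guard.Holds M c G ∧ ∃ y, c.cell j = Word.vtx (some y))
    (fun c => match c.cell j with
      | .vtx (some y) => θ (b y) (r y)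
      | _ => 0)
    (fun c w => by
      rw [Guard.holds_iff hG (c := c) fun l hl => by simp [List.mem_singleton.not.1 hl]]
      simp [hij.symm])
    (fun c w => by simp [hij.symm])
  refine ⟨T, fun c => ?_⟩
  rw [hT]
  unfold Gate.act
  by_cases h : Guard.Holds M c G
  · rcases hc : c.cell j with l | x
    · simp [h, hc, Op.act]
    · rcases x with _ | y <;> simp [h, hc, Op.act]
  · simp [h]

theorem exists_runs {L : List (Gate k)} (h : ∀ g ∈ L, ∃ T : Space V k ≃ₗᵢ[ℂ] Space V k,
    ∀ c, T (ket c) = Gate.act M b r c g) : ∃ T, Runs M b r L T := by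
  induction L with
  | nil => exact ⟨_, .nil⟩
  | cons g L ih =>
    obtain ⟨T, hT⟩ := h g List.mem_cons_self
    obtain ⟨T', hT'⟩ := ih fun g' hg' => h g' (List.mem_cons_of_mem _ hg')
    exact ⟨_, .cons hT hT'⟩

/-! ### Running programs on superpositions -/

variable (M b r) in
/-- The program `L` takes `ψ` to `φ`. -/
def Evolves (L : List (Gate k)) (ψ φ : Space V k) : Prop :=
  ∀ T, Runs M b r L T → T ψ = φ

namespace Evolves

variable {L L' : List (Gate k)} {ψ ψ' φ φ' χ : Space V k} {g : Gate k} {c c' : Config V k}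

theorem refl : Evolves M b r [] ψ ψ := fun T hT => by cases hT; rfl

theorem ket_cons (hg : Gate.act M b r c g = ψ) (h : Evolves M b r L ψ φ) :
    Evolves M b r (g :: L) (ket c) φ := fun T hT => by
  cases hT with
  | cons hT hL => rw [LinearIsometryEquiv.trans_apply, hT c, hg, h _ hL]

theorem append (h : Evolves M b r L ψ φ) (h' : Evolves M b r L' φ χ) :
    Evolves M b r (L ++ L') ψ χ := by
  induction L generalizing ψ φ with
  | nil =>
    intro T hT
    rw [← h' T hT, ← h _ .nil]
    rfl
  | cons g L ih =>
    intro T hT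
    cases hT with
    | @cons _ _ T₁ T₂ hg hL =>
      refine ih (ψ := T₁ ψ) (φ := φ) (fun T' hT' => ?_) h' T₂ hL
      exact h _ (.cons hg hT')

theorem head_tail (h : Evolves M b r [g] ψ φ) (h' : Evolves M b r L' φ χ) :
    Evolves M b r (g :: L') ψ χ := h.append h'

theorem add (h : Evolves M b r L ψ φ) (h' : Evolves M b r L ψ' φ') :
    Evolves M b r L (ψ + ψ') (φ + φ') := fun T hT => by rw [map_add, h T hT, h' T hT]

theorem smul (a : ℂ) (h : Evolves M b r L ψ φ) : Evolves M b r L (a • ψ) (a • φ) :=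
  fun T hT => by rw [map_smul, h T hT]

theorem sum {ι : Type*} {s : Finset ι} {f f' : ι → Space V k}
    (h : ∀ i ∈ s, Evolves M b r L (f i) (f' i)) :
    Evolves M b r L (∑ i ∈ s, f i) (∑ i ∈ s, f' i) := fun T hT => by
  rw [map_sum]
  exact Finset.sum_congr rfl fun i hi => h i hi T hT

theorem gate (hg : Gate.act M b r c g = ψ) : Evolves M b r [g] (ket c) ψ := ket_cons hg refl

theorem skip (hg : ¬ Guard.Holds M c g.1) (h : Evolves M b r L (ket c) φ) :
    Evolves M b r (g :: L) (ket c) φ := ket_cons (by simp [Gate.act, hg]) h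

end Evolves

end Gates

/-! ### The quantum walk operator -/

section Walk

variable {X : Type u} [Fintype X] [DecidableEq X]

/-- The amplitude `√(w_{xy} / d_x)` of a star state. -/
def starAmp (w : X → X → ℝ) (x y : X) : ℝ := Real.sqrt (w x y / deg w x)

theorem walkMatrix_apply (w : X → X → ℝ) (M : Finset X) (s : X) (e : X × X) (p q : X) :
    walkMatrix w M s e (p, q) =
      (if q ≠ s ∧ q ∉ M ∧ e.1 = q then ((2 * starAmp w q e.2 * starAmp w q p : ℝ) : ℂ) else 0) -
      if e = (q, p) then 1 else 0 := by
  have h1 : ∀ A : Matrix (X × X) (X × X) ℂ,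
      (A * Matrix.of fun p q : X × X => if p = Prod.swap q then (1 : ℂ) else 0) e (p, q) =
      A e (q, p) := fun A => by
    simp [Matrix.mul_apply]
  unfold walkMatrix
  rw [h1, Matrix.sub_apply, Matrix.one_apply, Matrix.smul_apply, Matrix.sum_apply]
  congr 1
  simp only [Matrix.vecMulVec_apply, Pi.star_apply, starState, smul_eq_mul]
  by_cases hq : q ≠ s ∧ q ∉ M
  · rw [Finset.sum_eq_single q]
    · by_cases he : e.1 = q
      · simp [hq, he, starAmp]
        ring
      · simp [he]
    · intro x _ hx
      simp [hx.symm]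
    · intro h
      exact absurd (by simp [hq]) h
  · rw [Finset.sum_eq_zero, mul_zero, if_neg]
    · exact fun h => hq ⟨h.1, h.2.1⟩
    · intro x hx
      have : q ≠ x := by
        rintro rfl
        exact hq (by simpa using hx)
      simp [this]

/-- A reflection times a permutation. Star states of different vertices have disjoint supports, so
normalisation alone makes Q a projection. -/
theorem walkMatrix_mem_unitary {w : X → X → ℝ} {M : Finset X} {s : X}
    (h : ∀ x, x ≠ s → x ∉ M → ∑ y, starAmp w x y ^ 2 = 1) :
    walkMatrix w M s ∈ Matrix.unitaryGroup (X × X) ℂ := by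
  set S := Finset.univ.filter (fun x => x ≠ s ∧ x ∉ M)
  set Q : Matrix (X × X) (X × X) ℂ :=
    ∑ x ∈ S, Matrix.vecMulVec (starState w x) (star (starState w x)) with hQ
  set P : Matrix (X × X) (X × X) ℂ := Matrix.of fun p q => if p = Prod.swap q then 1 else 0 with hP
  have hdot : ∀ x ∈ S, ∀ y, star (starState w x) ⬝ᵥ starState w y = if x = y then 1 else 0 := by
    intro x hx y
    rw [Finset.mem_filter] at hx
    unfold dotProduct starState
    rw [Fintype.sum_prod_type]
    simp only [Pi.star_apply]
    by_cases hxy : x = y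
    · subst hxy
      rw [Finset.sum_eq_single x, if_pos rfl]
      · simp only [if_true]
        have := h x hx.2.1 hx.2.2
        have h2 := congrArg (fun t : ℝ => (t : ℂ)) this
        simp only [Complex.ofReal_sum, Complex.ofReal_one] at h2
        rw [← h2]
        refine Finset.sum_congr rfl fun y _ => ?_
        simp [starAmp, sq]
      · intro z _ hz
        simp [hz]
      · simp
    · rw [if_neg hxy]
      refine Finset.sum_eq_zero fun z _ => Finset.sum_eq_zero fun t _ => ?_
      by_cases hz : z = x
      · simp [hz, hxy]
      · simp [hz]
  have hQQ : Q * Q = Q := by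
    rw [hQ, Finset.sum_mul]
    refine Finset.sum_congr rfl fun x hx => ?_
    rw [Finset.mul_sum, Finset.sum_eq_single x]
    · rw [Matrix.vecMulVec_mul_vecMulVec, hdot x hx, if_pos rfl]
      simp
    · intro y _ hy
      rw [Matrix.vecMulVec_mul_vecMulVec, hdot x hx, if_neg hy.symm]
      simp
    · exact fun h => absurd hx h
  have hQs : star Q = Q := by
    rw [hQ, star_sum]
    refine Finset.sum_congr rfl fun x _ => ?_
    ext p q
    simp [Matrix.star_apply, Matrix.vecMulVec_apply, mul_comm]
  have hPP : P * star P = 1 := by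
    ext p q
    rw [Matrix.mul_apply, Matrix.one_apply]
    simp only [Matrix.star_apply, hP, Matrix.of_apply]
    rw [Finset.sum_eq_single p.swap]
    · by_cases hpq : p = q
      · simp [hpq]
      · have : q ≠ p := fun h => hpq h.symm
        simp [hpq, this]
    · intro t _ ht
      have : p ≠ t.swap := fun h => ht (by rw [h, Prod.swap_swap])
      simp [this]
    · simp
  rw [Matrix.mem_unitaryGroup_iff]
  change ((2 : ℂ) • Q - 1) * P * star (((2 : ℂ) • Q - 1) * P) = 1
  rw [star_mul, mul_assoc, ← mul_assoc P, hPP, one_mul, star_sub, star_one, star_smul, hQs]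
  have : (star (2 : ℂ)) = 2 := by simp
  rw [this, sub_mul, mul_sub, smul_mul_smul_comm, hQQ]
  simp only [mul_one, one_mul]
  rw [show (2 : ℂ) * 2 = 2 + 2 by norm_num, add_smul]
  abel

variable {w : X → X → ℝ} {M : Finset X} {η : ℝ} {u : X}

theorem deg_attach (w : X → X → ℝ) (η : ℝ) (u a : X) :
    deg (attach w η u) (some a) = deg w a + if a = u then η * deg w u else 0 := by
  unfold deg
  rw [Fintype.sum_option]
  simp only [attach, deg]
  exact add_comm _ _

theorem IsNetwork.deg_attach_pos (hN : IsNetwork w M) (hη : 0 ≤ η) {a : X} (ha : a ∉ M) :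
    0 < deg (attach w η u) (some a) := by
  rw [deg_attach]
  have h1 := hN.deg_pos ha
  have h2 := hN.deg_nonneg u
  split_ifs <;> positivity

theorem IsNetwork.attach_nonneg (hN : IsNetwork w M) (hη : 0 ≤ η) (a b : Option X) :
    0 ≤ attach w η u a b := by
  have h := hN.deg_nonneg u
  rcases a with _ | a <;> rcases b with _ | b <;> simp only [attach]
  · exact le_rfl
  · split_ifs <;> positivity
  · split_ifs <;> positivity
  · exact hN.nonneg a b

theorem IsNetwork.attachedWalk_mem_unitary (hN : IsNetwork w M) (hη : 0 ≤ η) :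
    attachedWalk w M η u ∈ Matrix.unitaryGroup (Option X × Option X) ℂ := by
  refine walkMatrix_mem_unitary fun x hx hxM => ?_
  rcases x with _ | a
  · exact absurd rfl hx
  have ha : a ∉ M := by simpa using hxM
  have hd := hN.deg_attach_pos (u := u) hη ha
  have : ∀ y, starAmp (attach w η u) (some a) y ^ 2 =
      attach w η u (some a) y / deg (attach w η u) (some a) := fun y =>
    Real.sq_sqrt (div_nonneg (hN.attach_nonneg hη _ _) hd.le)
  simp only [this]
  rw [← Finset.sum_div]
  exact div_self hd.ne'

/-- The vector on pairs of vertices of the attached graph that is built from a potential `v`, with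
weight `m` on its flow, and with amplitudes `a₁`, `a₂` on the attached edge. -/
def walkVec (w : X → X → ℝ) (η : ℝ) (u : X) (v : X → ℝ) (m a₁ a₂ : ℝ) : Option X × Option X → ℝ
  | (some a, some b) => Real.sqrt (η * deg w u) * Real.sqrt (w a b) *
      ((v a + v b) / 2 + m * (v a - v b))
  | (none, some b) => if b = u then a₁ else 0
  | (some a, none) => if a = u then a₂ else 0
  | (none, none) => 0

/-- The swapped vector is v_x minus m times the flow along each edge at x. The flow part cancels by
conservation: at u the unit source is compensated by the amount m on the attached edge, whose other
part η d_u v_u completes the degree to that of the attached graph. -/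
theorem sum_starAmp_walkVec (hN : IsNetwork w M) (hη : 0 ≤ η) (hu : u ∉ M) {v : X → ℝ}
    (hv : IsPotential w M u v) (m a₂ : ℝ) {x : X} (hx : x ∉ M) :
    ∑ p, starAmp (attach w η u) (some x) p *
      walkVec w η u v (m - 1 / 2) (m + η * deg w u * v u) a₂ (p, some x) =
      Real.sqrt (η * deg w u) * Real.sqrt (deg (attach w η u) (some x)) * v x := by
  have hd := hN.deg_attach_pos (u := u) hη hx
  set D := deg (attach w η u) (some x) with hD
  have hsD : Real.sqrt D ≠ 0 := (Real.sqrt_pos.2 hd).ne'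
  have hsD2 : Real.sqrt D * Real.sqrt D = D := Real.mul_self_sqrt hd.le
  set sd := Real.sqrt (η * deg w u)
  rw [Fintype.sum_option]
  have h1 : ∀ a, starAmp (attach w η u) (some x) (some a) *
      walkVec w η u v (m - 1 / 2) (m + η * deg w u * v u) a₂ (some a, some x) =
      sd / Real.sqrt D * (w x a * v x - m * (w x a * (v x - v a))) := by
    intro a
    unfold starAmp
    simp only [walkVec, attach]
    rw [← hD, Real.sqrt_div (hN.nonneg x a), hN.symm a x]
    have h2 : Real.sqrt (w x a) * Real.sqrt (w x a) = w x a := Real.mul_self_sqrt (hN.nonneg x a)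
    calc _ = sd / Real.sqrt D * (Real.sqrt (w x a) * Real.sqrt (w x a)) *
          ((v a + v x) / 2 + (m - 1 / 2) * (v a - v x)) := by ring
      _ = _ := by rw [h2]; ring
  simp only [h1]
  rw [← Finset.mul_sum, Finset.sum_sub_distrib, ← Finset.sum_mul, ← Finset.mul_sum]
  change _ + sd / Real.sqrt D * (deg w x * v x - m * lap w v x) = _
  have h3 : starAmp (attach w η u) (some x) none *
      walkVec w η u v (m - 1 / 2) (m + η * deg w u * v u) a₂ (none, some x) =
      sd / Real.sqrt D * if x = u then m + η * deg w u * v u else 0 := by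
    unfold starAmp
    simp only [walkVec, attach]
    rw [← hD]
    split_ifs with h
    · rw [Real.sqrt_div (mul_nonneg hη (hN.deg_nonneg u))]
    · simp
  rw [h3, ← mul_add]
  have h4 : (if x = u then m + η * deg w u * v u else 0) + (deg w x * v x - m * lap w v x) =
      D * v x := by
    rw [hD, deg_attach]
    split_ifs with h
    · subst h
      rw [hv.source]
      ring
    · rw [hv.harmonic x h hx]
      ring
  rw [h4]
  field_simp
  rw [sq, hsD2]

/-- After the swap the vector is "v at the first vertex" minus m times the flow. The reflection
fixes the former, a combination of stars, and negates the latter, which is orthogonal to them; v_a +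
m(v_a - v_b) is the symmetric part plus weight m + 1/2 on the flow. One walk step thus adds 1 to the
weight of the flow. -/
theorem attachedWalk_mulVec (hN : IsNetwork w M) (hη : 0 ≤ η) (hu : u ∉ M) {v : X → ℝ}
    (hv : IsPotential w M u v) (m : ℝ) (e : Option X × Option X) :
    ∑ e', attachedWalk w M η u e e' *
      ((walkVec w η u v (m - 1 / 2) (m + η * deg w u * v u) (-(m - 1 - η * deg w u * v u)) e' : ℝ) : ℂ)
      = ((walkVec w η u v (m + 1 / 2) (m - 1 - η * deg w u * v u) (-(m - η * deg w u * v u)) e : ℝ) :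
        ℂ) := by
  set F := walkVec w η u v (m - 1 / 2) (m + η * deg w u * v u) (-(m - 1 - η * deg w u * v u)) with hF
  have h1 : ∀ p q, attachedWalk w M η u e (p, q) * ((F (p, q) : ℝ) : ℂ) =
      (((if q = e.1 then (if q ≠ none ∧ q ∉ M.map Function.Embedding.some then
        2 * starAmp (attach w η u) q e.2 * (starAmp (attach w η u) q p * F (p, q)) else 0) else 0) -
      (if q = e.1 then (if p = e.2 then F (p, q) else 0) else 0) : ℝ) : ℂ) := by
    intro p q
    unfold attachedWalk
    rw [walkMatrix_apply]
    rcases e with ⟨e₁, e₂⟩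
    by_cases hq : q = e₁
    · subst hq
      by_cases hp : p = e₂
      · subst hp
        by_cases hc : q ≠ none ∧ q ∉ M.map Function.Embedding.some
        · simp only [hc, Complex.ofReal_sub, Complex.ofReal_mul, ne_eq, not_false_eq_true, and_self,
            if_true]
          ring
        · have : ¬ (q ≠ none ∧ q ∉ M.map Function.Embedding.some ∧ q = q) :=
            fun h => hc ⟨h.1, h.2.1⟩
          rw [if_neg this]
          simp only [hc, if_true, if_false]
          push_cast
          ring
      · have hp' : ¬ ((q, e₂) = (q, p)) := fun h => hp (Prod.ext_iff.1 h).2.symm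
        by_cases hc : q ≠ none ∧ q ∉ M.map Function.Embedding.some
        · simp only [hc, hp, hp', Complex.ofReal_sub, Complex.ofReal_mul, ne_eq, not_false_eq_true,
            and_self, if_true, if_false, Complex.ofReal_zero]
          ring
        · have : ¬ (q ≠ none ∧ q ∉ M.map Function.Embedding.some ∧ q = q) :=
            fun h => hc ⟨h.1, h.2.1⟩
          rw [if_neg this]
          simp only [hc, hp, hp', if_true, if_false]
          push_cast
          ring
    · have h1 : ¬ (e₁ = q) := fun h => hq h.symm
      have h2 : ¬ ((e₁, e₂) = (q, p)) := fun h => h1 (Prod.ext_iff.1 h).1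
      simp [hq, h1, h2]
  rw [Fintype.sum_prod_type_right]
  simp only [h1]
  simp only [← Complex.ofReal_sum, Finset.sum_sub_distrib]
  congr 1
  have h2 : ∑ q, ∑ p, (if q = e.1 then (if p = e.2 then F (p, q) else 0) else 0) = F (e.2, e.1) := by
    rw [Finset.sum_eq_single e.1]
    · simp
    · intro q _ hq
      simp [hq]
    · simp
  have h3 : ∑ q, ∑ p, (if q = e.1 then (if q ≠ none ∧ q ∉ M.map Function.Embedding.some then
      2 * starAmp (attach w η u) q e.2 * (starAmp (attach w η u) q p * F (p, q)) else 0) else 0) =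
      if e.1 ≠ none ∧ e.1 ∉ M.map Function.Embedding.some then
        2 * starAmp (attach w η u) e.1 e.2 * ∑ p, starAmp (attach w η u) e.1 p * F (p, e.1)
      else 0 := by
    rw [Finset.sum_eq_single e.1]
    · by_cases hc : e.1 ≠ none ∧ e.1 ∉ M.map Function.Embedding.some
      · simp only [if_pos hc, if_true, Finset.mul_sum]
      · simp only [if_neg hc, ite_self, Finset.sum_const_zero]
    · intro q _ hq
      simp [hq]
    · simp
  rw [h2, h3]
  rcases e with ⟨_ | x, e₂⟩
  · simp only [ne_eq, not_true_eq_false, false_and, if_false]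
    rcases e₂ with _ | b
    · simp [hF, walkVec]
    · simp only [hF, walkVec]
      split_ifs <;> ring
  -- In the sink there is no star and the operator is minus the swap; the formula persists because v
  -- vanishes there, so only the flow part is left.
  · by_cases hx : x ∈ M
    · rw [if_neg (by simp [hx])]
      have hxu : x ≠ u := fun h => hu (h ▸ hx)
      rcases e₂ with _ | b
      · simp [hF, walkVec, hxu]
      · simp only [hF, walkVec, hv.zero x hx]
        rw [hN.symm x b]
        ring
    · rw [if_pos (by simp [hx]), hF, sum_starAmp_walkVec hN hη hu hv m _ hx]
      have hd := hN.deg_attach_pos (u := u) hη hx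
      have hsD : Real.sqrt (deg (attach w η u) (some x)) ≠ 0 := (Real.sqrt_pos.2 hd).ne'
      unfold starAmp
      rw [Real.sqrt_div (hN.attach_nonneg hη _ _)]
      rcases e₂ with _ | b
      · simp only [walkVec, attach]
        split_ifs with h
        · subst h
          have h5 : Real.sqrt (η * deg w x) * Real.sqrt (η * deg w x) = η * deg w x :=
            Real.mul_self_sqrt (mul_nonneg hη (hN.deg_nonneg x))
          field_simp
          rw [sq, h5]
          ring
        · simp
      · simp only [walkVec, attach]
        rw [hN.symm x b]
        field_simp
        ring

end Walk

/-! ### The walk call from star preparations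

Cell `1` holds the vertex of the elfs process, cells `2` and `3` the pair of vertices of the walk,
and cell `6` is the qubit that controls the walk. -/

section WalkCall

/-- The walk is controlled on cell `6`. -/
def walkGuard : Guard 7 := [(.isNum 6 1, true)]

/-- The walk is on, for a vertex outside the sink. -/
def guardOn : Guard 7 :=
  [(.number 1, false), (.attached 1, false), (.sink 1, false), (.isNum 6 1, true)]

/-- Moreover, cells `2` and `3` hold two vertices of the attached graph. -/
def guardBoth : Guard 7 := guardOn ++ [(.number 2, false), (.number 3, false)]

/-- Moreover, cell `2` holds a vertex outside the sink. -/
def guardInner : Guard 7 := guardOn ++ [(.number 2, false), (.attached 2, false), (.sink 2, false)]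

/-- Moreover, cell `2` holds the vertex of the elfs process. -/
def guardSame : Guard 7 := guardOn ++ [(.same 2 1, true)]

/-- The angle `2 arctan √η`, with `η` the weight of the attached edge. -/
def attachAngle (b r : ℝ) : ℝ := 2 * Real.arctan (Real.sqrt (b / r))

/-- The program before the inverse star preparation. -/
def walkPre : List (Gate 7) := [(guardInner, .exchange 3 0), (guardBoth, .swapCells 2 3)]

/-- The reflection about the blank, and about the star of the attached vertex. -/
def walkMid : List (Gate 7) :=
  [(guardInner ++ [(.isNum 3 0, true)], .neg), (guardSame, .exchange 3 1),
    (guardSame, .rotateBy 3 1 attachAngle), (guardSame, .exchange 3 1)]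

/-- The program after the star preparation. -/
def walkPost : List (Gate 7) :=
  [(guardBoth, .swapCells 2 3), (guardInner, .exchange 3 0), (guardBoth, .swapCells 2 3),
    (guardBoth, .neg)]

variable {V : Type u}

/-- Put the pair `(p, q)` into the cells of the walk. -/
def Config.pair (c : Config V 7) (p q : Word V) : Config V 7 := (c.set 2 p).set 3 q

theorem Config.pair_cell_one (c : Config V 7) (p q : Word V) :
    (c.pair p q).cell 1 = c.cell 1 := by simp [Config.pair]

theorem Config.pair_cell_two (c : Config V 7) (p q : Word V) :
    (c.pair p q).cell 2 = p := by simp [Config.pair]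

theorem Config.pair_cell_three (c : Config V 7) (p q : Word V) :
    (c.pair p q).cell 3 = q := by simp [Config.pair]

theorem Config.pair_cell_six (c : Config V 7) (p q : Word V) :
    (c.pair p q).cell 6 = c.cell 6 := by simp [Config.pair]

theorem Config.pair_set_two (c : Config V 7) (p q p' : Word V) :
    (c.pair p q).set 2 p' = c.pair p' q := by
  refine Config.ext' (fun i => ?_) (fun _ _ => rfl)
  by_cases h2 : i = 2 <;> by_cases h3 : i = 3 <;> simp_all [Config.pair]

theorem Config.pair_set_three (c : Config V 7) (p q q' : Word V) :
    (c.pair p q).set 3 q' = c.pair p q' := by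
  refine Config.ext' (fun i => ?_) (fun _ _ => rfl)
  by_cases h2 : i = 2 <;> by_cases h3 : i = 3 <;> simp_all [Config.pair]

theorem Config.pair_self (c : Config V 7) : c.pair (c.cell 2) (c.cell 3) = c := by
  refine Config.ext' (fun i => ?_) (fun _ _ => rfl)
  by_cases h2 : i = 2 <;> by_cases h3 : i = 3 <;> simp_all [Config.pair]

theorem Config.pair_pair (c : Config V 7) (p q p' q' : Word V) :
    (c.pair p q).pair p' q' = c.pair p' q' := by
  rw [Config.pair, Config.pair_set_two, Config.pair_set_three]

variable [Fintype V] [DecidableEq V] {M : Finset V} {b r : V → ℝ}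

/-- The walk is on for the vertex `u`. -/
def Config.On (c : Config V 7) (u : V) : Prop := c.cell 1 = Word.vtx (some u) ∧ c.cell 6 = Word.num 1

theorem guardOn_iff {c : Config V 7} : Guard.Holds M c guardOn ↔ ∃ u, u ∉ M ∧ c.On u := by
  unfold Guard.Holds guardOn Config.On
  rcases h1 : c.cell 1 with a | _ | u <;> simp [Test.Holds, h1]

theorem guard_append {k : ℕ} {c : Config V k} {G G' : Guard k} :
    Guard.Holds M c (G ++ G') ↔ Guard.Holds M c G ∧ Guard.Holds M c G' := by
  simp only [Guard.Holds, List.mem_append, or_imp, forall_and]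

section On

variable {c : Config V 7} {u : V}

theorem Config.On.pair (h : c.On u) (p q : Word V) : (c.pair p q).On u := by
  unfold Config.On
  rw [Config.pair_cell_one, Config.pair_cell_six]
  exact h

theorem guardBoth_iff (hu : u ∉ M) (h : c.On u) (p q : Word V) :
    Guard.Holds M (c.pair p q) guardBoth ↔ (∃ x, p = Word.vtx x) ∧ ∃ x, q = Word.vtx x := by
  have h1 := guardOn_iff.2 ⟨u, hu, h.pair p q⟩
  rw [guardBoth, guard_append, and_iff_right h1]
  simp only [Guard.Holds, List.forall_mem_cons, List.not_mem_nil, Test.Holds,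
    Config.pair_cell_two, Config.pair_cell_three]
  cases p <;> cases q <;> simp

theorem guardInner_iff (hu : u ∉ M) (h : c.On u) (p q : Word V) :
    Guard.Holds M (c.pair p q) guardInner ↔ ∃ x, x ∉ M ∧ p = Word.vtx (some x) := by
  have h1 := guardOn_iff.2 ⟨u, hu, h.pair p q⟩
  rw [guardInner, guard_append, and_iff_right h1]
  simp only [Guard.Holds, List.forall_mem_cons, List.not_mem_nil, Test.Holds,
    Config.pair_cell_two]
  rcases p with a | _ | x <;> simp

theorem guardSame_iff (hu : u ∉ M) (h : c.On u) (p q : Word V) :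
    Guard.Holds M (c.pair p q) guardSame ↔ p = Word.vtx (some u) := by
  have h1 := guardOn_iff.2 ⟨u, hu, h.pair p q⟩
  rw [guardSame, guard_append, and_iff_right h1]
  simp [Guard.Holds, Test.Holds, Config.pair_cell_two, Config.pair_cell_one, h.1]

theorem act_both_swap (hu : u ∉ M) (h : c.On u) (p q : Option V) :
    Gate.act M b r (c.pair (.vtx p) (.vtx q)) (guardBoth, .swapCells 2 3) =
      ket (c.pair (.vtx q) (.vtx p)) := by
  rw [Gate.act, if_pos ((guardBoth_iff hu h _ _).2 ⟨⟨_, rfl⟩, ⟨_, rfl⟩⟩)]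
  simp only [Op.act, Config.pair_cell_two, Config.pair_cell_three, Config.pair_set_two,
    Config.pair_set_three]

theorem act_both_neg (hu : u ∉ M) (h : c.On u) (p q : Option V) :
    Gate.act M b r (c.pair (.vtx p) (.vtx q)) (guardBoth, .neg) =
      -ket (c.pair (.vtx p) (.vtx q)) := by
  rw [Gate.act, if_pos ((guardBoth_iff hu h _ _).2 ⟨⟨_, rfl⟩, ⟨_, rfl⟩⟩)]
  rfl

open Classical in
theorem act_inner_exchange (hu : u ∉ M) (h : c.On u) {x : V} (hx : x ∉ M) (q : Word V) :
    Gate.act M b r (c.pair (.vtx (some x)) q) (guardInner, .exchange 3 0) =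
      ket (c.pair (.vtx (some x)) (if q = .num 0 then .vtx none else if q = .vtx none then .num 0
        else q)) := by
  rw [Gate.act, if_pos ((guardInner_iff hu h _ _).2 ⟨x, hx, rfl⟩)]
  simp only [Op.act, Config.pair_cell_three, Config.pair_set_three]
  split_ifs <;> rfl

theorem not_both (hu : u ∉ M) (h : c.On u) {p q : Word V}
    (hpq : ¬((∃ x, p = Word.vtx x) ∧ ∃ x, q = Word.vtx x)) :
    ¬ Guard.Holds M (c.pair p q) guardBoth := fun h' => hpq ((guardBoth_iff hu h _ _).1 h')

theorem not_inner (hu : u ∉ M) (h : c.On u) {p q : Word V}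
    (hp : ∀ x, x ∉ M → p ≠ Word.vtx (some x)) :
    ¬ Guard.Holds M (c.pair p q) guardInner := fun h' => by
  obtain ⟨x, hx, rfl⟩ := (guardInner_iff hu h _ _).1 h'
  exact hp x hx rfl

theorem not_same (hu : u ∉ M) (h : c.On u) {p q : Word V} (hp : p ≠ Word.vtx (some u)) :
    ¬ Guard.Holds M (c.pair p q) guardSame := fun h' => hp ((guardSame_iff hu h _ _).1 h')

theorem walkPre_swap (hu : u ∉ M) (h : c.On u) {p q : Option V}
    (hpq : ∀ x, x ∉ M → p = some x → q ≠ none) :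
    Evolves M b r walkPre (ket (c.pair (.vtx p) (.vtx q))) (ket (c.pair (.vtx q) (.vtx p))) := by
  refine .ket_cons (ψ := ket (c.pair (.vtx p) (.vtx q))) ?_ (.gate (act_both_swap hu h p q))
  by_cases hp : ∃ x, x ∉ M ∧ p = some x
  · obtain ⟨x, hx, rfl⟩ := hp
    rw [act_inner_exchange hu h hx]
    simp [hpq x hx rfl]
  · rw [Gate.act, if_neg]
    exact not_inner hu h fun x hx hp' => hp ⟨x, hx, by simpa using hp'⟩

/-- After the exchange cell `3` is no longer a vertex, so the swap is skipped: the pair (x, σ) is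
parked as (x, blank). Conversely the content (x, blank), which is no pair of the walk, passes as (σ,
x); `walkPost` undoes both. -/
theorem walkPre_none (hu : u ∉ M) (h : c.On u) {x : V} (hx : x ∉ M) :
    Evolves M b r walkPre (ket (c.pair (.vtx (some x)) (.vtx none)))
      (ket (c.pair (.vtx (some x)) (.num 0))) := by
  refine .ket_cons (act_inner_exchange hu h hx _) ?_
  simp only [reduceCtorEq, if_true, if_false]
  exact .skip (not_both hu h (by simp)) .refl

theorem walkPre_blank (hu : u ∉ M) (h : c.On u) {x : V} (hx : x ∉ M) :
    Evolves M b r walkPre (ket (c.pair (.vtx (some x)) (.num 0)))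
      (ket (c.pair (.vtx none) (.vtx (some x)))) := by
  refine .ket_cons (act_inner_exchange hu h hx _) ?_
  simp only [if_true]
  exact .gate (act_both_swap hu h _ _)

theorem walkPre_fix (hu : u ∉ M) (h : c.On u) {p q : Word V}
    (hpq : ¬((∃ x, p = Word.vtx x) ∧ ∃ x, q = Word.vtx x))
    (hx : ∀ x, x ∉ M → p = .vtx (some x) → q ≠ .num 0) :
    Evolves M b r walkPre (ket (c.pair p q)) (ket (c.pair p q)) := by
  refine .ket_cons (ψ := ket (c.pair p q)) ?_ (.skip (not_both hu h hpq) .refl)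
  by_cases hp : ∃ x, x ∉ M ∧ p = .vtx (some x)
  · obtain ⟨x, hxM, rfl⟩ := hp
    rw [act_inner_exchange hu h hxM, if_neg (hx x hxM rfl), if_neg]
    exact fun hq => hpq ⟨⟨_, rfl⟩, ⟨_, hq⟩⟩
  · rw [Gate.act, if_neg]
    exact not_inner hu h fun x hxM hp' => hp ⟨x, hxM, hp'⟩

theorem walkPost_neg (hu : u ∉ M) (h : c.On u) {p q : Option V}
    (hpq : ∀ x, x ∉ M → q = some x → p ≠ none) :
    Evolves M b r walkPost (ket (c.pair (.vtx p) (.vtx q))) (-ket (c.pair (.vtx p) (.vtx q))) := by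
  refine .ket_cons (act_both_swap hu h p q) (.ket_cons (ψ := ket (c.pair (.vtx q) (.vtx p))) ?_
    (.ket_cons (act_both_swap hu h q p) (.gate (act_both_neg hu h p q))))
  by_cases hp : ∃ x, x ∉ M ∧ q = some x
  · obtain ⟨x, hx, rfl⟩ := hp
    rw [act_inner_exchange hu h hx]
    simp [hpq x hx rfl]
  · rw [Gate.act, if_neg]
    exact not_inner hu h fun x hx hp' => hp ⟨x, hx, by simpa using hp'⟩

theorem walkPost_attached (hu : u ∉ M) (h : c.On u) {x : V} (hx : x ∉ M) :
    Evolves M b r walkPost (ket (c.pair (.vtx none) (.vtx (some x))))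
      (ket (c.pair (.vtx (some x)) (.num 0))) := by
  refine .ket_cons (act_both_swap hu h _ _) (.ket_cons (act_inner_exchange hu h hx _) ?_)
  simp only [reduceCtorEq, if_true, if_false]
  exact .skip (not_both hu h (by simp)) (.skip (not_both hu h (by simp)) .refl)

theorem walkPost_blank (hu : u ∉ M) (h : c.On u) {x : V} (hx : x ∉ M) :
    Evolves M b r walkPost (ket (c.pair (.vtx (some x)) (.num 0)))
      (-ket (c.pair (.vtx none) (.vtx (some x)))) := by
  refine .skip (not_both hu h (by simp)) (.ket_cons (act_inner_exchange hu h hx _) ?_)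
  simp only [if_true]
  exact .ket_cons (act_both_swap hu h _ _) (.gate (act_both_neg hu h _ _))

theorem walkPost_fix (hu : u ∉ M) (h : c.On u) {p q : Word V}
    (hpq : ¬((∃ x, p = Word.vtx x) ∧ ∃ x, q = Word.vtx x))
    (hx : ∀ x, x ∉ M → p = .vtx (some x) → q ≠ .num 0) :
    Evolves M b r walkPost (ket (c.pair p q)) (ket (c.pair p q)) := by
  refine .skip (not_both hu h hpq) (.ket_cons (ψ := ket (c.pair p q)) ?_
    (.skip (not_both hu h hpq) (.skip (not_both hu h hpq) .refl)))
  by_cases hp : ∃ x, x ∉ M ∧ p = .vtx (some x)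
  · obtain ⟨x, hxM, rfl⟩ := hp
    rw [act_inner_exchange hu h hxM, if_neg (hx x hxM rfl), if_neg]
    exact fun hq => hpq ⟨⟨_, rfl⟩, ⟨_, hq⟩⟩
  · rw [Gate.act, if_neg]
    exact not_inner hu h fun x hxM hp' => hp ⟨x, hxM, hp'⟩

theorem guardInner_blank_iff (hu : u ∉ M) (h : c.On u) (p q : Word V) :
    Guard.Holds M (c.pair p q) (guardInner ++ [(.isNum 3 0, true)]) ↔
      (∃ x, x ∉ M ∧ p = Word.vtx (some x)) ∧ q = .num 0 := by
  rw [guard_append, guardInner_iff hu h]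
  simp [Guard.Holds, Test.Holds, Config.pair_cell_three]

open Classical in
theorem act_same_exchange (hu : u ∉ M) (h : c.On u) (q : Word V) :
    Gate.act M b r (c.pair (.vtx (some u)) q) (guardSame, .exchange 3 1) =
      ket (c.pair (.vtx (some u)) (if q = .num 1 then .vtx none else if q = .vtx none then .num 1
        else q)) := by
  rw [Gate.act, if_pos ((guardSame_iff hu h _ _).2 rfl)]
  simp only [Op.act, Config.pair_cell_three, Config.pair_set_three]
  split_ifs <;> rfl

theorem act_same_rotate (hu : u ∉ M) (h : c.On u) (q : Word V) :
    Gate.act M b r (c.pair (.vtx (some u)) q) (guardSame, .rotateBy 3 1 attachAngle) =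
      rotation (c.pair (.vtx (some u)) q) 3 (attachAngle (b u) (r u)) := by
  rw [Gate.act, if_pos ((guardSame_iff hu h _ _).2 rfl)]
  simp only [Op.act, Config.pair_cell_one, h.1]

theorem walkMid_fix (hu : u ∉ M) (h : c.On u) {p q : Word V}
    (h1 : ∀ x, x ∉ M → p = .vtx (some x) → q ≠ .num 0)
    (h2 : p = .vtx (some u) → q ≠ .vtx none) :
    Evolves M b r walkMid (ket (c.pair p q)) (ket (c.pair p q)) := by
  refine .skip (fun h' => ?_) ?_
  · obtain ⟨⟨x, hx, rfl⟩, hq⟩ := (guardInner_blank_iff hu h _ _).1 h'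
    exact h1 x hx rfl hq
  by_cases hp : p = .vtx (some u)
  · subst hp
    refine .ket_cons (act_same_exchange hu h _) ?_
    rw [if_neg (h2 rfl)]
    by_cases hq : q = .num 1
    · subst hq
      simp only [if_true]
      refine .ket_cons (act_same_rotate hu h _) ?_
      rw [rotation, Config.pair_cell_three, if_neg (by simp), if_neg (by simp)]
      refine .gate ?_
      rw [act_same_exchange hu h]
      simp
    · rw [if_neg hq]
      refine .ket_cons (act_same_rotate hu h _) ?_
      rw [rotation, Config.pair_cell_three, if_neg (h1 u hu rfl), if_neg hq]
      refine .gate ?_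
      rw [act_same_exchange hu h, if_neg hq, if_neg (h2 rfl)]
  · exact .skip (not_same hu h hp) (.skip (not_same hu h hp) (.skip (not_same hu h hp) .refl))

theorem walkMid_blank (hu : u ∉ M) (h : c.On u) {x : V} (hx : x ∉ M) (hxu : x ≠ u) :
    Evolves M b r walkMid (ket (c.pair (.vtx (some x)) (.num 0)))
      (-ket (c.pair (.vtx (some x)) (.num 0))) := by
  have hs : ∀ q, ¬ Guard.Holds M (c.pair (.vtx (some x)) q) guardSame := fun q =>
    not_same hu h (by simpa using hxu)
  refine .head_tail (φ := (-1 : ℂ) • ket (c.pair (.vtx (some x)) (.num 0))) (.gate ?_) ?_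
  · rw [Gate.act, if_pos ((guardInner_blank_iff hu h _ _).2 ⟨⟨x, hx, rfl⟩, rfl⟩)]
    simp [Op.act]
  · have := Evolves.smul (M := M) (b := b) (r := r) (-1 : ℂ) (.skip (hs (.num 0)) (g := (guardSame, .exchange 3 1))
      (.skip (hs (.num 0)) (g := (guardSame, .rotateBy 3 1 attachAngle)) (.skip (hs (.num 0)) (g := (guardSame, .exchange 3 1)) .refl)))
    simpa using this

/-- Exchanging σ with the number `1` makes blank and σ a qubit. The sign flip of the blank followed
by the rotation by 2 arctan √η is the reflection I - 2|φ⟩⟨φ| with φ = (blank + √η σ)/√(1+η); the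
sign at the end of `walkPost` turns it into 2|φ⟩⟨φ| - I. -/
theorem walkMid_blank_same (hu : u ∉ M) (h : c.On u) :
    Evolves M b r walkMid (ket (c.pair (.vtx (some u)) (.num 0)))
      (-(((Real.cos (attachAngle (b u) (r u)) : ℝ) : ℂ) • ket (c.pair (.vtx (some u)) (.num 0)) +
        ((Real.sin (attachAngle (b u) (r u)) : ℝ) : ℂ) •
          ket (c.pair (.vtx (some u)) (.vtx none)))) := by
  refine .head_tail (φ := (-1 : ℂ) • ket (c.pair (.vtx (some u)) (.num 0))) (.gate ?_) ?_
  · rw [Gate.act, if_pos ((guardInner_blank_iff hu h _ _).2 ⟨⟨u, hu, rfl⟩, rfl⟩)]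
    simp [Op.act]
  · rw [← neg_one_smul ℂ (_ + _)]
    refine Evolves.smul (-1 : ℂ) (.ket_cons (act_same_exchange hu h _) ?_)
    simp only [reduceCtorEq, if_false, Word.num.injEq, zero_ne_one]
    refine .head_tail (.gate (act_same_rotate hu h _)) ?_
    rw [rotation, Config.pair_cell_three, if_pos rfl, Config.pair_set_three]
    refine .add (.smul _ (.gate ?_)) (.smul _ (.gate ?_))
    · rw [act_same_exchange hu h]; simp
    · rw [act_same_exchange hu h]; simp

theorem walkMid_attached_same (hu : u ∉ M) (h : c.On u) :
    Evolves M b r walkMid (ket (c.pair (.vtx (some u)) (.vtx none)))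
      (((Real.cos (attachAngle (b u) (r u)) : ℝ) : ℂ) • ket (c.pair (.vtx (some u)) (.vtx none)) +
        (-((Real.sin (attachAngle (b u) (r u)) : ℝ) : ℂ)) •
          ket (c.pair (.vtx (some u)) (.num 0))) := by
  refine .skip (fun h' => ?_) (.ket_cons (act_same_exchange hu h _) ?_)
  · simpa using ((guardInner_blank_iff hu h _ _).1 h').2
  · simp only [reduceCtorEq, if_false, if_true]
    refine .head_tail (.gate (act_same_rotate hu h _)) ?_
    rw [rotation, Config.pair_cell_three, if_neg (by simp), if_pos rfl, Config.pair_set_three,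
      sub_eq_add_neg, ← neg_smul]
    refine .add (.smul _ (.gate ?_)) (.smul _ (.gate ?_))
    · rw [act_same_exchange hu h]; simp
    · rw [act_same_exchange hu h]; simp

end On

end WalkCall

/-! ### Conjugation by the star preparation, case by case. -/

section WalkCall

variable {V : Type u} [Fintype V] [DecidableEq V] {w : V → V → ℝ} {M : Finset V} {b r : V → ℝ}
  {coin : V → Matrix (Option V) (Option V) ℂ}

theorem exists_coinCall (hcoin : ∀ v, coin v ∈ Matrix.unitaryGroup (Option V) ℂ) :
    ∃ T : Space V 7 ≃ₗᵢ[ℂ] Space V 7, IsCoinCall M coin [] 2 3 T := by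
  let idx : Config V 7 → Option (Option V) := fun c =>
    match c.cell 2, c.cell 3 with
    | .vtx (some _), .num a => if a = 0 then some none else none
    | .vtx (some _), .vtx (some q) => some (some q)
    | _, _ => none
  let mat : Config V 7 → Matrix (Option V) (Option V) ℂ := fun c =>
    match c.cell 2 with
    | .vtx (some v) => coin v
    | _ => 1
  have hidx : ∀ c, idx c ≠ none → ∃ v e, c.cell 2 = .vtx (some v) ∧ c.cell 3 = coinWord e ∧
      idx c = some e := by
    intro c hc
    rcases h2 : c.cell 2 with l | _ | v
    · simp [idx, h2] at hc
    · simp [idx, h2] at hc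
    · rcases h3 : c.cell 3 with l | _ | q
      · by_cases hl : l = 0
        · exact ⟨v, none, rfl, by simp [coinWord, hl], by simp [idx, h2, h3, hl]⟩
        · simp [idx, h2, h3, hl] at hc
      · simp [idx, h2, h3] at hc
      · exact ⟨v, some q, rfl, rfl, by simp [idx, h2, h3]⟩
  obtain ⟨T, hT⟩ := exists_block_unitary idx (fun c e => c.set 3 (coinWord e)) mat
    (fun c e hc => by
      obtain ⟨v, e', h2, -, -⟩ := hidx c hc
      rcases e with _ | q <;> simp [idx, h2, coinWord])
    (fun c e hc => by
      obtain ⟨v, e', h2, h3, h4⟩ := hidx c (by simp [hc])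
      rw [h4, Option.some_inj] at hc
      subst hc
      refine Config.ext' (fun j => ?_) (fun _ _ => rfl)
      by_cases hj : j = 3
      · subst hj; simp [h3]
      · simp [hj])
    (fun c e e' _ => by
      refine Config.ext' (fun j => ?_) (fun _ _ => rfl)
      by_cases hj : j = 3 <;> simp [hj])
    (fun c e _ => by simp [mat])
    (fun c hc => by
      obtain ⟨v, e', h2, -, -⟩ := hidx c hc
      simpa [mat, h2] using hcoin v)
  refine ⟨T, fun c => ?_⟩
  rw [hT, if_pos (by simp [Guard.Holds])]
  rcases h2 : c.cell 2 with l | _ | v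
  · simp [idx, h2]
  · simp [idx, h2]
  · rcases h3 : c.cell 3 with l | _ | q
    · by_cases hl : l = 0 <;> simp [idx, mat, h2, h3, hl]
    · simp [idx, h2, h3]
    · simp [idx, mat, h2, h3]

section CoinCall

variable {TC : Space V 7 ≃ₗᵢ[ℂ] Space V 7} (hTC : IsCoinCall M coin [] 2 3 TC)
include hTC

theorem coinCall_ket (c : Config V 7) (v : V) (e : Option V) :
    TC (ket (c.pair (.vtx (some v)) (coinWord e))) =
      ∑ f, coin v f e • ket (c.pair (.vtx (some v)) (coinWord f)) := by
  rw [hTC, if_pos (by simp [Guard.Holds])]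
  rw [Config.pair_cell_two, Config.pair_cell_three]
  rcases e with _ | q <;> simp [coinWord, Config.pair_set_three]

theorem coinCall_fix (c : Config V 7) {p q : Word V}
    (hpq : ∀ v e, p = .vtx (some v) → q ≠ coinWord e) :
    TC (ket (c.pair p q)) = ket (c.pair p q) := by
  rw [hTC, if_pos (by simp [Guard.Holds])]
  rw [Config.pair_cell_two, Config.pair_cell_three]
  rcases p with l | _ | v
  · rfl
  · rfl
  · rcases q with l | _ | q
    · have : l ≠ 0 := by
        rintro rfl
        exact hpq v none rfl rfl
      simp [this]
    · rfl
    · exact absurd rfl (hpq v (some q) rfl)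

theorem coinCall_symm_fix (c : Config V 7) {p q : Word V}
    (hpq : ∀ v e, p = .vtx (some v) → q ≠ coinWord e) :
    TC.symm (ket (c.pair p q)) = ket (c.pair p q) := by
  rw [LinearIsometryEquiv.symm_apply_eq, coinCall_fix hTC c hpq]

theorem coinCall_symm_ket (hcoin : ∀ v, coin v ∈ Matrix.unitaryGroup (Option V) ℂ)
    (c : Config V 7) (v : V) (e : Option V) :
    TC.symm (ket (c.pair (.vtx (some v)) (coinWord e))) =
      ∑ f, star (coin v e f) • ket (c.pair (.vtx (some v)) (coinWord f)) := by
  rw [LinearIsometryEquiv.symm_apply_eq, map_sum]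
  simp only [map_smul, coinCall_ket hTC, Finset.smul_sum, smul_smul]
  rw [Finset.sum_comm]
  have hu := Matrix.mem_unitaryGroup_iff.1 (hcoin v)
  have : ∀ f, ∑ g, (star (coin v e g) * coin v f g) •
      (ket (c.pair (.vtx (some v)) (coinWord f)) : Space V 7) =
      (if f = e then (1 : ℂ) else 0) • ket (c.pair (.vtx (some v)) (coinWord f)) := fun f => by
    rw [← Finset.sum_smul]
    congr 1
    have := congrFun (congrFun hu f) e
    simp only [Matrix.mul_apply, Matrix.star_apply, Matrix.one_apply] at this
    rw [← this]
    exact Finset.sum_congr rfl fun g _ => mul_comm _ _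
  rw [Finset.sum_eq_single e]
  · rw [this, if_pos rfl, one_smul]
  · intro f _ hf
    rw [this, if_neg hf, zero_smul]
  · simp

/-- If `T` fixes all contents of cell `3`, then conjugation by the star preparation cancels. -/
theorem coinCall_conj (hcoin : ∀ v, coin v ∈ Matrix.unitaryGroup (Option V) ℂ)
    (c : Config V 7) (p q : Word V) {T : Space V 7 ≃ₗᵢ[ℂ] Space V 7}
    (hT : ∀ q, T (ket (c.pair p q)) = ket (c.pair p q)) :
    TC (T (TC.symm (ket (c.pair p q)))) = ket (c.pair p q) := by
  have : T (TC.symm (ket (c.pair p q))) = TC.symm (ket (c.pair p q)) := by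
    by_cases h : ∃ v e, p = .vtx (some v) ∧ q = coinWord e
    · obtain ⟨v, e, rfl, rfl⟩ := h
      rw [coinCall_symm_ket hTC hcoin, map_sum]
      simp only [map_smul, hT]
    · push Not at h
      rw [coinCall_symm_fix hTC c h, hT]
  rw [this, LinearIsometryEquiv.apply_symm_apply]

end CoinCall

theorem cos_two_arctan (t : ℝ) : Real.cos (2 * Real.arctan t) = 2 / (1 + t ^ 2) - 1 := by
  rw [Real.cos_two_mul, Real.cos_sq_arctan]
  ring

theorem sin_two_arctan (t : ℝ) : Real.sin (2 * Real.arctan t) = 2 * t / (1 + t ^ 2) := by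
  rw [Real.sin_two_mul, Real.sin_arctan, Real.cos_arctan]
  have h : 0 < 1 + t ^ 2 := by positivity
  have h2 := Real.mul_self_sqrt h.le
  rw [show 2 * (t / Real.sqrt (1 + t ^ 2)) * (1 / Real.sqrt (1 + t ^ 2)) =
    2 * t / (Real.sqrt (1 + t ^ 2) * Real.sqrt (1 + t ^ 2)) by ring, h2]

theorem sum_attachedWalk (η : ℝ) (u : V) {E : Type*} [AddCommGroup E] [Module ℂ E]
    (ψ : Option V × Option V → E) (p q : Option V) :
    ∑ e, attachedWalk w M η u e (p, q) • ψ e =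
      (if q ≠ none ∧ q ∉ M.map Function.Embedding.some then
        ((2 * starAmp (attach w η u) q p : ℝ) : ℂ) •
          ∑ z, ((starAmp (attach w η u) q z : ℝ) : ℂ) • ψ (q, z) else 0) - ψ (q, p) := by
  unfold attachedWalk
  simp only [walkMatrix_apply, sub_smul, Finset.sum_sub_distrib]
  congr 1
  · rw [Fintype.sum_prod_type, Finset.sum_eq_single q]
    · by_cases hq : q ≠ none ∧ q ∉ M.map Function.Embedding.some
      · rw [if_pos hq, Finset.smul_sum]
        refine Finset.sum_congr rfl fun z _ => ?_
        rw [if_pos ⟨hq.1, hq.2, rfl⟩, smul_smul]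
        congr 1
        push_cast
        ring
      · rw [if_neg hq]
        refine Finset.sum_eq_zero fun z _ => ?_
        rw [if_neg fun h => hq ⟨h.1, h.2.1⟩, zero_smul]
    · intro e _ he
      refine Finset.sum_eq_zero fun z _ => ?_
      rw [if_neg fun h => he h.2.2, zero_smul]
    · simp
  · simp

theorem starAmp_attach_of_ne (η : ℝ) {u x : V} (h : x ≠ u) (z : V) :
    starAmp (attach w η u) (some x) (some z) = starAmp w x z := by
  unfold starAmp
  rw [deg_attach, if_neg h, add_zero]
  rfl

theorem starAmp_attach_none_of_ne (η : ℝ) {u x : V} (h : x ≠ u) :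
    starAmp (attach w η u) (some x) none = 0 := by
  unfold starAmp
  simp [attach, h]

theorem starAmp_attach_self {η : ℝ} (hη : 0 ≤ η) (u z : V) :
    starAmp (attach w η u) (some u) (some z) = starAmp w u z / Real.sqrt (1 + η) := by
  unfold starAmp
  rw [deg_attach, if_pos rfl, ← Real.sqrt_div' _ (by positivity)]
  congr 1
  change w u z / _ = _
  rw [div_div]
  congr 1
  ring

theorem starAmp_attach_none {η : ℝ} (hη : 0 ≤ η) {u : V} (hd : 0 < deg w u) :
    starAmp (attach w η u) (some u) none = Real.sqrt η / Real.sqrt (1 + η) := by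
  unfold starAmp
  rw [deg_attach, if_pos rfl, ← Real.sqrt_div' _ (by positivity)]
  congr 1
  simp only [attach, if_true]
  field_simp

section Decomposition

variable {T₁ T₂ T₃ TC : Space V 7 ≃ₗᵢ[ℂ] Space V 7}
  (h₁ : Runs M b r walkPre T₁) (h₂ : Runs M b r walkMid T₂) (h₃ : Runs M b r walkPost T₃)
  (hTC : IsCoinCall M coin [] 2 3 TC) (hcoin : IsStarPreparation w coin)
include h₁ h₂ h₃ hTC hcoin

/-- The star preparation is called with the empty control, so it acts even when the walk is off;
then nothing happens between it and its inverse, and they cancel. -/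
theorem walk_fix_of_not_on {c : Config V 7} (hc : ¬ Guard.Holds M c guardOn) :
    T₃ (TC (T₂ (TC.symm (T₁ (ket c))))) = ket c := by
  have hpair : ∀ p q, ¬ Guard.Holds M (c.pair p q) guardOn := fun p q h => by
    obtain ⟨u, hu, h1, h6⟩ := guardOn_iff.1 h
    rw [Config.pair_cell_one] at h1
    rw [Config.pair_cell_six] at h6
    exact hc (guardOn_iff.2 ⟨u, hu, h1, h6⟩)
  have hG : ∀ p q G, ¬ Guard.Holds M (c.pair p q) (guardOn ++ G) := fun p q G h =>
    hpair p q (guard_append.1 h).1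
  have e : ket c = ket (c.pair (c.cell 2) (c.cell 3)) := by rw [Config.pair_self]
  have e1 : T₁ (ket c) = ket c := by
    rw [e]
    exact Evolves.skip (hG _ _ _) (.skip (hG _ _ _) .refl) T₁ h₁
  have e2 : ∀ q, T₂ (ket (c.pair (c.cell 2) q)) = ket (c.pair (c.cell 2) q) := fun q =>
    Evolves.skip (fun h => hG _ _ _ (guard_append.1 h).1) (.skip (hG _ _ _) (.skip (hG _ _ _)
      (.skip (hG _ _ _) .refl))) T₂ h₂
  have e3 : T₃ (ket c) = ket c := by
    rw [e]
    exact Evolves.skip (hG _ _ _) (.skip (hG _ _ _) (.skip (hG _ _ _) (.skip (hG _ _ _) .refl))) T₃ h₃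
  rw [e1, e, coinCall_conj hTC (fun v => (hcoin v).1) c _ _ e2, ← e, e3]

variable {c : Config V 7} {u : V} (hu : u ∉ M) (hc : c.On u)
include hu hc

theorem walk_fix_of_number {p q : Word V}
    (hpq : ¬((∃ x, p = Word.vtx x) ∧ ∃ x, q = Word.vtx x)) :
    T₃ (TC (T₂ (TC.symm (T₁ (ket (c.pair p q)))))) = ket (c.pair p q) := by
  by_cases hx : ∃ x, x ∉ M ∧ p = .vtx (some x)
  · obtain ⟨x, hxM, rfl⟩ := hx
    by_cases hq : q = .num 0
    · subst hq
      rw [walkPre_blank hu hc hxM T₁ h₁, coinCall_symm_fix hTC c (by simp),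
        walkMid_fix hu hc (by simp) (by simp) T₂ h₂, coinCall_fix hTC c (by simp),
        walkPost_attached hu hc hxM T₃ h₃]
    · have hq' : ∀ v e, Word.vtx (some x) = .vtx (some v) → q ≠ coinWord e := by
        rintro v (_ | e) - rfl
        · exact hq rfl
        · exact hpq ⟨⟨_, rfl⟩, ⟨_, rfl⟩⟩
      rw [walkPre_fix hu hc hpq (fun _ _ _ => hq) T₁ h₁, coinCall_symm_fix hTC c hq',
        walkMid_fix hu hc (fun _ _ _ => hq) (fun _ h => hpq ⟨⟨_, rfl⟩, ⟨_, h⟩⟩) T₂ h₂,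
        coinCall_fix hTC c hq', walkPost_fix hu hc hpq (fun _ _ _ => hq) T₃ h₃]
  · have hx' : ∀ q : Word V, ∀ x, x ∉ M → p = .vtx (some x) → q ≠ .num 0 := fun q x h h' =>
      absurd ⟨x, h, h'⟩ hx
    rw [walkPre_fix hu hc hpq (hx' q) T₁ h₁, coinCall_conj hTC (fun v => (hcoin v).1) c,
      walkPost_fix hu hc hpq (hx' q) T₃ h₃]
    exact fun q => walkMid_fix hu hc (hx' q) (fun h => absurd ⟨u, hu, h⟩ hx) T₂ h₂

/-- No reflection may occur when the second vertex is σ or in the sink. For the parked pair (x,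
blank) this holds because `coin x none none = 0`: the inverse preparation of the blank has no blank
component, so the middle part does not act. -/
theorem walk_of_sink (hd : ∀ x, x ∉ M → 0 < deg w x) {p q : Option V} (hq : ∀ x, x ∉ M → q ≠ some x) :
    T₃ (TC (T₂ (TC.symm (T₁ (ket (c.pair (.vtx p) (.vtx q))))))) =
      -ket (c.pair (.vtx q) (.vtx p)) := by
  have hq' : ∀ q' : Word V, ∀ x, x ∉ M → Word.vtx q = .vtx (some x) → q' ≠ .num 0 :=
    fun q' x h h' => absurd (by simpa using h') (hq x h)
  have hmid : ∀ q' : Word V, T₂ (ket (c.pair (.vtx q) q')) = ket (c.pair (.vtx q) q') := fun q' =>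
    walkMid_fix hu hc (hq' q') (fun h => absurd (by simpa using h) (hq u hu)) T₂ h₂
  by_cases hp : ∃ x, x ∉ M ∧ p = some x ∧ q = none
  · obtain ⟨x, hxM, rfl, rfl⟩ := hp
    have hd0 : ∀ f, T₂ (ket (c.pair (.vtx (some x)) (.vtx (some f)))) =
        ket (c.pair (.vtx (some x)) (.vtx (some f))) := fun f =>
      walkMid_fix hu hc (by simp) (by simp) T₂ h₂
    have hT : T₂ (TC.symm (ket (c.pair (.vtx (some x)) (.num 0)))) =
        TC.symm (ket (c.pair (.vtx (some x)) (.num 0))) := by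
      have := coinCall_symm_ket hTC (fun v => (hcoin v).1) c x none
      rw [coinWord] at this
      rw [this, map_sum]
      refine Finset.sum_congr rfl fun f _ => ?_
      rw [map_smul]
      rcases f with _ | f
      · have h00 : coin x none none = 0 := ((hcoin x).2 (hd x hxM)).1
        simp [h00]
      · rw [show coinWord (some f) = Word.vtx (some f) from rfl, hd0]
    rw [walkPre_none hu hc hxM T₁ h₁, hT, LinearIsometryEquiv.apply_symm_apply,
      walkPost_blank hu hc hxM T₃ h₃]
  · rw [walkPre_swap hu hc (fun x hx hpx hqn => hp ⟨x, hx, hpx, hqn⟩) T₁ h₁,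
      coinCall_conj hTC (fun v => (hcoin v).1) c _ _ hmid,
      walkPost_neg hu hc (fun x hx hpx hqn => hp ⟨x, hx, hpx, hqn⟩) T₃ h₃]

/-- The blank component after the inverse preparation is the overlap with the star of G, and the
preparation takes the blank back to that star. For x = u the star of the attached graph combines it
with σ, in the proportion 1 : √η; for x ≠ u the two stars agree. -/
theorem walk_of_inner (hd : ∀ x, x ∉ M → 0 < deg w x) (hη : 0 ≤ b u / r u) {p : Option V} {x : V}
    (hx : x ∉ M) :
    T₃ (TC (T₂ (TC.symm (T₁ (ket (c.pair (.vtx p) (.vtx (some x)))))))) =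
      ((2 * starAmp (attach w (b u / r u) u) (some x) p : ℝ) : ℂ) •
        (∑ z, ((starAmp (attach w (b u / r u) u) (some x) z : ℝ) : ℂ) •
          ket (c.pair (.vtx (some x)) (.vtx z))) - ket (c.pair (.vtx (some x)) (.vtx p)) := by
  obtain ⟨h00, h0⟩ := (hcoin x).2 (hd x hx)
  set S : Space V 7 := ∑ z, ((starAmp w x z : ℝ) : ℂ) • ket (c.pair (.vtx (some x)) (.vtx (some z)))
  have hS : TC (ket (c.pair (.vtx (some x)) (.num 0))) = S := by
    have := coinCall_ket hTC c x none
    rw [coinWord, Fintype.sum_option, h00, zero_smul, zero_add] at this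
    rw [this]
    exact Finset.sum_congr rfl fun z _ => by rw [h0]; rfl
  have hpost : ∀ z : Option V, T₃ (ket (c.pair (.vtx (some x)) (.vtx z))) =
      -ket (c.pair (.vtx (some x)) (.vtx z)) := fun z =>
    walkPost_neg hu hc (by simp) T₃ h₃
  have hpostS : T₃ S = -S := by
    simp only [S, map_sum, map_smul, hpost, smul_neg, Finset.sum_neg_distrib]
  have hmidsome : ∀ z, T₂ (ket (c.pair (.vtx (some x)) (.vtx (some z)))) =
      ket (c.pair (.vtx (some x)) (.vtx (some z))) := fun z =>
    walkMid_fix hu hc (by simp) (by simp) T₂ h₂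
  rw [walkPre_swap hu hc (by simp) T₁ h₁, Fintype.sum_option]
  have hsqrt : Real.sqrt (1 + b u / r u) * Real.sqrt (1 + b u / r u) = 1 + b u / r u :=
    Real.mul_self_sqrt (by positivity)
  have hsqrt0 : Real.sqrt (1 + b u / r u) ≠ 0 := (Real.sqrt_pos.2 (by positivity)).ne'
  have hη1 : 1 + b u / r u ≠ 0 := by positivity
  have hcos : Real.cos (attachAngle (b u) (r u)) = 2 / (1 + b u / r u) - 1 := by
    rw [attachAngle, cos_two_arctan, Real.sq_sqrt hη]
  have hsin : Real.sin (attachAngle (b u) (r u)) = 2 * Real.sqrt (b u / r u) / (1 + b u / r u) := by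
    rw [attachAngle, sin_two_arctan, Real.sq_sqrt hη]
  have hsq : Real.sqrt (b u / r u) * Real.sqrt (b u / r u) = b u / r u := Real.mul_self_sqrt hη
  rcases p with _ | a
  · rw [coinCall_symm_fix hTC c (by rintro v (_ | e) - <;> simp [coinWord])]
    by_cases hxu : x = u
    · subst hxu
      have hfix : TC (ket (c.pair (.vtx (some x)) (.vtx none))) =
          ket (c.pair (.vtx (some x)) (.vtx none)) :=
        coinCall_fix hTC c (by rintro v (_ | e) - <;> simp [coinWord])
      rw [walkMid_attached_same hu hc T₂ h₂, map_add, map_smul, map_smul, hfix, hS, map_add,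
        map_smul, map_smul, hpost, hpostS, starAmp_attach_none hη (hd x hx)]
      simp only [starAmp_attach_self hη]
      have e1 : ∑ z, ((starAmp w x z / Real.sqrt (1 + b x / r x) : ℝ) : ℂ) •
          (ket (c.pair (.vtx (some x)) (.vtx (some z))) : Space V 7) =
          (((Real.sqrt (1 + b x / r x))⁻¹ : ℝ) : ℂ) • S := by
        rw [Finset.smul_sum]
        refine Finset.sum_congr rfl fun z _ => ?_
        rw [smul_smul, ← Complex.ofReal_mul]
        congr 2
        ring
      rw [e1, smul_add, smul_smul, smul_smul, ← Complex.ofReal_mul, ← Complex.ofReal_mul, hcos, hsin]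
      have e2 : 2 * (Real.sqrt (b x / r x) / Real.sqrt (1 + b x / r x)) *
          (Real.sqrt (b x / r x) / Real.sqrt (1 + b x / r x)) = 1 - (2 / (1 + b x / r x) - 1) := by
        rw [show 2 * (Real.sqrt (b x / r x) / Real.sqrt (1 + b x / r x)) *
          (Real.sqrt (b x / r x) / Real.sqrt (1 + b x / r x)) =
          2 * (Real.sqrt (b x / r x) * Real.sqrt (b x / r x)) /
            (Real.sqrt (1 + b x / r x) * Real.sqrt (1 + b x / r x)) by ring, hsq, hsqrt]
        field_simp
        ring
      have e3 : 2 * (Real.sqrt (b x / r x) / Real.sqrt (1 + b x / r x)) *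
          (Real.sqrt (1 + b x / r x))⁻¹ = 2 * Real.sqrt (b x / r x) / (1 + b x / r x) := by
        rw [show 2 * (Real.sqrt (b x / r x) / Real.sqrt (1 + b x / r x)) *
          (Real.sqrt (1 + b x / r x))⁻¹ = 2 * Real.sqrt (b x / r x) /
            (Real.sqrt (1 + b x / r x) * Real.sqrt (1 + b x / r x)) by ring, hsqrt]
      rw [e2, e3]
      push_cast
      module
    · rw [walkMid_fix hu hc (by simp) (by simpa using hxu) T₂ h₂,
        coinCall_fix hTC c (by rintro v (_ | e) - <;> simp [coinWord]), hpost,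
        starAmp_attach_none_of_ne _ hxu]
      simp
  · have hsymm := coinCall_symm_ket hTC (fun v => (hcoin v).1) c x (some a)
    rw [Fintype.sum_option, h0] at hsymm
    change TC.symm (ket (c.pair (.vtx (some x)) (.vtx (some a)))) =
      star ((starAmp w x a : ℝ) : ℂ) • ket (c.pair (.vtx (some x)) (.num 0)) +
      ∑ z, star (coin x (some a) (some z)) • ket (c.pair (.vtx (some x)) (.vtx (some z))) at hsymm
    have hstar : star ((starAmp w x a : ℝ) : ℂ) = ((starAmp w x a : ℝ) : ℂ) := by simp
    rw [hstar] at hsymm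
    -- The middle part changes only the blank component, whose coefficient is the star amplitude;
    -- isolating it leaves the remainder to cancel against the preparation.
    have hmid : T₂ (TC.symm (ket (c.pair (.vtx (some x)) (.vtx (some a))))) =
        TC.symm (ket (c.pair (.vtx (some x)) (.vtx (some a)))) +
        ((starAmp w x a : ℝ) : ℂ) • (T₂ (ket (c.pair (.vtx (some x)) (.num 0))) -
          ket (c.pair (.vtx (some x)) (.num 0))) := by
      rw [hsymm, map_add, map_smul, map_sum]
      simp only [map_smul, hmidsome]
      module
    rw [hmid, map_add, LinearIsometryEquiv.apply_symm_apply, map_smul, map_sub, hS, map_add,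
      map_smul, map_sub, hpost, hpostS]
    by_cases hxu : x = u
    · subst hxu
      have hfix : TC (ket (c.pair (.vtx (some x)) (.vtx none))) =
          ket (c.pair (.vtx (some x)) (.vtx none)) :=
        coinCall_fix hTC c (by rintro v (_ | e) - <;> simp [coinWord])
      rw [walkMid_blank_same hu hc T₂ h₂, map_neg, map_add, map_smul, map_smul, hfix, hS, map_neg,
        map_add, map_smul, map_smul, hpost, hpostS, starAmp_attach_none hη (hd x hx)]
      simp only [starAmp_attach_self hη]
      have e1 : ∑ z, ((starAmp w x z / Real.sqrt (1 + b x / r x) : ℝ) : ℂ) •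
          (ket (c.pair (.vtx (some x)) (.vtx (some z))) : Space V 7) =
          (((Real.sqrt (1 + b x / r x))⁻¹ : ℝ) : ℂ) • S := by
        rw [Finset.smul_sum]
        refine Finset.sum_congr rfl fun z _ => ?_
        rw [smul_smul, ← Complex.ofReal_mul]
        congr 2
        ring
      rw [e1, smul_add, smul_smul, smul_smul, ← Complex.ofReal_mul, ← Complex.ofReal_mul, hcos, hsin]
      have e2 : 2 * (starAmp w x a / Real.sqrt (1 + b x / r x)) *
          (Real.sqrt (b x / r x) / Real.sqrt (1 + b x / r x)) =
          starAmp w x a * (2 * Real.sqrt (b x / r x) / (1 + b x / r x)) := by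
        rw [show 2 * (starAmp w x a / Real.sqrt (1 + b x / r x)) *
          (Real.sqrt (b x / r x) / Real.sqrt (1 + b x / r x)) = starAmp w x a *
          (2 * Real.sqrt (b x / r x) / (Real.sqrt (1 + b x / r x) * Real.sqrt (1 + b x / r x)))
          by ring, hsqrt]
      have e3 : 2 * (starAmp w x a / Real.sqrt (1 + b x / r x)) *
          (Real.sqrt (1 + b x / r x))⁻¹ = starAmp w x a * (2 / (1 + b x / r x)) := by
        rw [show 2 * (starAmp w x a / Real.sqrt (1 + b x / r x)) *
          (Real.sqrt (1 + b x / r x))⁻¹ = starAmp w x a *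
          (2 / (Real.sqrt (1 + b x / r x) * Real.sqrt (1 + b x / r x))) by ring, hsqrt]
      rw [e2, e3]
      push_cast
      module
    · rw [walkMid_blank hu hc hx hxu T₂ h₂, map_neg, hS, map_neg, hpostS,
        starAmp_attach_none_of_ne _ hxu]
      simp only [starAmp_attach_of_ne _ hxu]
      change _ = ((2 * starAmp w x a : ℝ) : ℂ) • (((0 : ℝ) : ℂ) • _ + S) - _
      push_cast
      module

end Decomposition

end WalkCall

/-! ### Existence, uniqueness and factorization of the walk call. -/

section WalkCall

variable {V : Type u} [Fintype V] [DecidableEq V] {w : V → V → ℝ} {M : Finset V} {b r : V → ℝ}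
  {coin : V → Matrix (Option V) (Option V) ℂ}

theorem holds_walkGuard {c : Config V 7} : Guard.Holds M c walkGuard ↔ c.cell 6 = Word.num 1 := by
  simp [Guard.Holds, walkGuard, Test.Holds]

theorem walkCall_act {c : Config V 7} {u : V} (hu : u ∉ M) (hc : c.On u) {T : Space V 7 ≃ₗᵢ[ℂ] Space V 7}
    (hT : IsWalkCall w M b r walkGuard 1 2 3 T) (p q : Option V) :
    T (ket (c.pair (.vtx p) (.vtx q))) =
      ∑ e, attachedWalk w M (b u / r u) u e (p, q) • ket (c.pair (.vtx e.1) (.vtx e.2)) := by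
  rw [hT, if_pos (holds_walkGuard.2 (by rw [Config.pair_cell_six]; exact hc.2))]
  rw [Config.pair_cell_one, hc.1, Config.pair_cell_two, Config.pair_cell_three]
  simp only [hu, not_false_eq_true, if_true]
  refine Finset.sum_congr rfl fun e _ => ?_
  rw [← Config.pair, Config.pair_pair]

theorem exists_walkCall (hN : IsNetwork w M) (hη : ∀ u, u ∉ M → 0 ≤ b u / r u) :
    ∃ T : Space V 7 ≃ₗᵢ[ℂ] Space V 7, IsWalkCall w M b r walkGuard 1 2 3 T := by
  classical
  let idx : Config V 7 → Option (Option V × Option V) := fun c =>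
    if c.cell 6 = Word.num 1 then
      match c.cell 1, c.cell 2, c.cell 3 with
      | .vtx (some u), .vtx p, .vtx q => if u ∉ M then some (p, q) else none
      | _, _, _ => none
    else none
  let mat : Config V 7 → Matrix (Option V × Option V) (Option V × Option V) ℂ := fun c =>
    match c.cell 1 with
    | .vtx (some u) => attachedWalk w M (b u / r u) u
    | _ => 1
  have hidx : ∀ c, idx c ≠ none → ∃ u p q, u ∉ M ∧ c.On u ∧ c.cell 2 = .vtx p ∧
      c.cell 3 = .vtx q ∧ idx c = some (p, q) := by
    intro c hc
    by_cases h6 : c.cell 6 = Word.num 1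
    · rcases h1 : c.cell 1 with l | _ | u
      · simp [idx, h1] at hc
      · simp [idx, h1] at hc
      · rcases h2 : c.cell 2 with l | p
        · simp [idx, h1, h2] at hc
        rcases h3 : c.cell 3 with l | q
        · simp [idx, h1, h2, h3] at hc
        by_cases hu : u ∈ M
        · simp [idx, h1, h2, h3, hu] at hc
        · exact ⟨u, p, q, hu, ⟨h1, h6⟩, rfl, rfl, by simp [idx, h1, h2, h3, hu, h6]⟩
    · simp [idx, h6] at hc
  obtain ⟨T, hT⟩ := exists_block_unitary idx (fun c e => c.pair (.vtx e.1) (.vtx e.2)) mat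
    (fun c e hc => by
      obtain ⟨u, p, q, hu, ⟨h1, h6⟩, h2, h3, h4⟩ := hidx c hc
      simp [idx, Config.pair_cell_one, Config.pair_cell_two, Config.pair_cell_three,
        Config.pair_cell_six, h1, h6, hu])
    (fun c e hc => by
      obtain ⟨u, p, q, hu, -, h2, h3, h4⟩ := hidx c (by simp [hc])
      rw [h4, Option.some_inj] at hc
      subst hc
      rw [← h2, ← h3, Config.pair_self])
    (fun c e e' _ => Config.pair_pair _ _ _ _ _)
    (fun c e _ => by simp [mat, Config.pair_cell_one])
    (fun c hc => by
      obtain ⟨u, p, q, hu, ⟨h1, h6⟩, -⟩ := hidx c hc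
      simpa [mat, h1] using hN.attachedWalk_mem_unitary (hη u hu))
  refine ⟨T, fun c => ?_⟩
  rw [hT]
  by_cases h6 : c.cell 6 = Word.num 1
  · rw [if_pos (holds_walkGuard.2 h6)]
    rcases h1 : c.cell 1 with l | _ | u
    · simp [idx, h1]
    · simp [idx, h1]
    · rcases h2 : c.cell 2 with l | p
      · simp [idx, h1, h2]
      rcases h3 : c.cell 3 with l | q
      · simp [idx, h1, h2, h3]
      by_cases hu : u ∈ M
      · simp [idx, h1, h2, h3, hu]
      · simp [idx, h1, h2, h3, hu, h6, mat, Config.pair]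
  · rw [if_neg fun h => h6 (holds_walkGuard.1 h)]
    simp [idx, h6]

theorem IsWalkCall.unique {k : ℕ} {G : Guard k} {y x z : Fin (k + 1)}
    {T T' : Space V k ≃ₗᵢ[ℂ] Space V k} (h : IsWalkCall w M b r G y x z T)
    (h' : IsWalkCall w M b r G y x z T') : T = T' :=
  eq_of_ket fun c => by rw [h c, h' c]

theorem isWalkCall_of_coin {T₁ T₂ T₃ TC : Space V 7 ≃ₗᵢ[ℂ] Space V 7}
    (hd : ∀ x, x ∉ M → 0 < deg w x) (hη : ∀ u, u ∉ M → 0 ≤ b u / r u)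
    (h₁ : Runs M b r walkPre T₁) (h₂ : Runs M b r walkMid T₂) (h₃ : Runs M b r walkPost T₃)
    (hTC : IsCoinCall M coin [] 2 3 TC) (hcoin : IsStarPreparation w coin) :
    IsWalkCall w M b r walkGuard 1 2 3 ((((T₁.trans TC.symm).trans T₂).trans TC).trans T₃) := by
  intro c
  change T₃ (TC (T₂ (TC.symm (T₁ (ket c))))) = _
  by_cases hc : Guard.Holds M c guardOn
  · obtain ⟨u, hu, hon⟩ := guardOn_iff.1 hc
    rw [if_pos (holds_walkGuard.2 hon.2), hon.1]
    have hself := Config.pair_self c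
    by_cases hpq : (∃ x, c.cell 2 = Word.vtx x) ∧ ∃ x, c.cell 3 = Word.vtx x
    · obtain ⟨⟨p, hp⟩, q, hq⟩ := hpq
      rw [hp, hq] at hself ⊢
      simp only [hu, not_false_eq_true, if_true]
      change _ = ∑ e : Option V × Option V, attachedWalk w M (b u / r u) u e (p, q) •
        (ket (c.pair (.vtx e.1) (.vtx e.2)) : Space V 7)
      rw [sum_attachedWalk (η := b u / r u) (u := u)
        (ψ := fun e : Option V × Option V => (ket (c.pair (.vtx e.1) (.vtx e.2)) : Space V 7))]
      rw [← hself]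
      simp only [Config.pair_pair]
      by_cases hqM : ∃ x, x ∉ M ∧ q = some x
      · obtain ⟨x, hx, rfl⟩ := hqM
        rw [walk_of_inner h₁ h₂ h₃ hTC hcoin hu hon hd (hη u hu) hx, if_pos (by simpa using hx)]
      · push Not at hqM
        rw [walk_of_sink h₁ h₂ h₃ hTC hcoin hu hon hd hqM, if_neg, zero_sub]
        rintro ⟨h1, h2⟩
        obtain ⟨x, rfl⟩ := Option.ne_none_iff_exists'.1 h1
        exact hqM x (by simpa using h2) rfl
    · have := walk_fix_of_number h₁ h₂ h₃ hTC hcoin hu hon hpq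
      rw [hself] at this
      rw [this]
      rcases h2 : c.cell 2 with l | p
      · rfl
      · rcases h3 : c.cell 3 with l | q
        · rfl
        · exact absurd ⟨⟨p, h2⟩, q, h3⟩ hpq
  · rw [walk_fix_of_not_on h₁ h₂ h₃ hTC hcoin hc]
    split_ifs with h6
    · rcases h1 : c.cell 1 with l | _ | u
      · rfl
      · rfl
      · rcases h2 : c.cell 2 with l | p
        · rfl
        · rcases h3 : c.cell 3 with l | q
          · rfl
          · have : u ∈ M := by
              by_contra hu
              exact hc (guardOn_iff.2 ⟨u, hu, h1, holds_walkGuard.1 h6⟩)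
            simp [this]
    · rfl

theorem holds_guardBoth_swap (c : Config V 7) :
    Guard.Holds M ((c.set 2 (c.cell 3)).set 3 (c.cell 2)) guardBoth ↔ Guard.Holds M c guardBoth := by
  simp only [guardBoth, guardOn, Guard.Holds, List.cons_append, List.nil_append, List.forall_mem_cons,
    Test.Holds, Config.set_cell]
  simp
  tauto

theorem exists_runs_walkPre : ∃ T : Space V 7 ≃ₗᵢ[ℂ] Space V 7, Runs M b r walkPre T := by
  refine exists_runs fun g hg => ?_
  simp only [walkPre, List.mem_cons, List.not_mem_nil, or_false] at hg
  rcases hg with rfl | rfl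
  · exact exists_gate_exchange _ (by decide)
  · exact exists_gate_swapCells holds_guardBoth_swap

theorem exists_runs_walkMid : ∃ T : Space V 7 ≃ₗᵢ[ℂ] Space V 7, Runs M b r walkMid T := by
  refine exists_runs fun g hg => ?_
  simp only [walkMid, List.mem_cons, List.not_mem_nil, or_false] at hg
  rcases hg with rfl | rfl | rfl | rfl
  · exact exists_gate_neg _
  · exact exists_gate_exchange _ (by decide)
  · exact exists_gate_rotateBy (by decide) _ (by decide)
  · exact exists_gate_exchange _ (by decide)

theorem exists_runs_walkPost : ∃ T : Space V 7 ≃ₗᵢ[ℂ] Space V 7, Runs M b r walkPost T := by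
  refine exists_runs fun g hg => ?_
  simp only [walkPost, List.mem_cons, List.not_mem_nil, or_false] at hg
  rcases hg with rfl | rfl | rfl | rfl
  · exact exists_gate_swapCells holds_guardBoth_swap
  · exact exists_gate_exchange _ (by decide)
  · exact exists_gate_swapCells holds_guardBoth_swap
  · exact exists_gate_neg _

/-- The walk call is a product of elementary operations, one star preparation, and one inverse of
it. -/
theorem IsWalkCall.exists_factorization {TW : Space V 7 ≃ₗᵢ[ℂ] Space V 7}
    (hTW : IsWalkCall w M b r walkGuard 1 2 3 TW)
    (hd : ∀ x, x ∉ M → 0 < deg w x) (hη : ∀ u, u ∉ M → 0 ≤ b u / r u)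
    (hcoin : IsStarPreparation w coin) :
    ∃ T₁ T₂ T₃ TC : Space V 7 ≃ₗᵢ[ℂ] Space V 7, Runs M b r walkPre T₁ ∧ Runs M b r walkMid T₂ ∧
      Runs M b r walkPost T₃ ∧ IsCoinCall M coin [] 2 3 TC ∧
      TW = (((T₁.trans TC.symm).trans T₂).trans TC).trans T₃ := by
  obtain ⟨T₁, h₁⟩ := exists_runs_walkPre (V := V) (M := M) (b := b) (r := r)
  obtain ⟨T₂, h₂⟩ := exists_runs_walkMid (V := V) (M := M) (b := b) (r := r)
  obtain ⟨T₃, h₃⟩ := exists_runs_walkPost (V := V) (M := M) (b := b) (r := r)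
  obtain ⟨TC, hTC⟩ := exists_coinCall (M := M) fun v => (hcoin v).1
  exact ⟨T₁, T₂, T₃, TC, h₁, h₂, h₃, hTC,
    hTW.unique (isWalkCall_of_coin hd hη h₁ h₂ h₃ hTC hcoin)⟩

end WalkCall

/-! ### The program of the transducer

Cell `0` is the flag, cell `1` the current vertex of the elfs process, cells `2` and `3` hold the
pair of vertices of the walk, cell `4` counts the failed attempts to move, cell `5` counts the moves,
cell `6` controls the walk, and cell `7` marks a successful move. Array `0` records the vertices,
array `1` the other endpoints of the sampled edges, array `2` the numbers of failed attempts. -/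

section Program

/-- The angle that feeds the walk. -/
def feedAngle (b _r : ℝ) : ℝ := 2 * Real.arctan (Real.sqrt (Real.sqrt b))

/-- The angle that separates the flow from the potential. -/
def flowAngle (b : ℝ) : ℝ :=
  Real.arccos ((Real.sqrt b - 1 / 2) / (Real.sqrt b + 1 / 2))

/-- Move the first vertex into place, and make the memory private. -/
def load : List (Gate 7) :=
  [([(.isNum 0 0, true)], .swapArr 1 0 5),
    ([(.isNum 5 0, true), (.isNum 4 0, true), (.isNum 6 0, true)], .addConst 0 1)]

/-- Feed the walk through the attached edge. -/
def feed : List (Gate 7) :=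
  [([(.isNum 6 0, true)], .exchange 2 0), ([(.isNum 6 0, true)], .copyCell 3 1),
    ([(.attached 2, true)], .rotateBy 6 1 feedAngle),
    ([(.isNum 6 0, true)], .addConst 4 1), ([(.isNum 6 0, true)], .copyCell 3 1),
    ([(.isNum 6 0, true)], .exchange 2 0)]

/-- The walk is at an edge of the graph. -/
def guardEdge : Guard 7 := [(.isNum 6 1, true), (.attached 2, false), (.attached 3, false)]

/-- The walk has not been marked. -/
def guardWalk : Guard 7 := [(.isNum 6 1, true), (.isNum 7 0, true)]

/-- Mark a part of the flow. -/
def mark : List (Gate 7) :=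
  [(guardEdge, .rotateBy 7 1 fun b _ => (flowAngle b + Real.pi) / 2),
    (guardWalk, .swapCells 2 3), (guardWalk, .neg),
    (guardEdge, .rotateBy 7 1 fun b _ => (flowAngle b - Real.pi) / 2)]

/-- Move along the marked edge. -/
def advance : List (Gate 7) :=
  [([(.isNum 7 1, true)], .swapArr 1 0 5), ([(.isNum 7 1, true)], .swapArr 3 1 5),
    ([(.isNum 7 1, true)], .swapArr 4 2 5), ([(.isNum 7 1, true)], .addConst 5 1),
    ([(.isNum 7 1, true)], .addConst 6 (-1)), ([(.isNum 7 1, true)], .swapCells 1 2)]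

/-- Unmark, and return the memory from the private to the public space when in the sink. -/
def finish : List (Gate 7) :=
  [([(.isNum 6 0, true), (.isNum 4 0, true)], .addConst 7 (-1)),
    ([(.isNum 6 0, true), (.isNum 4 0, true), (.sink 1, true)], .addConst 0 (-1)),
    ([(.isNum 0 0, true)], .swapArr 1 0 5)]

variable {V : Type u}

/-- The memory with given arrays and cells. -/
def mem (A : Fin 8 → ℤ → Word V) (f u x z j t q r : Word V) : Config V 7 :=
  ⟨![f, u, x, z, j, t, q, r], A⟩

variable (A : Fin 8 → ℤ → Word V) (f u x z j t q r a : Word V)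

@[simp] theorem mem_cell_zero : (mem A f u x z j t q r).cell 0 = f := rfl
@[simp] theorem mem_cell_one : (mem A f u x z j t q r).cell 1 = u := rfl
@[simp] theorem mem_cell_two : (mem A f u x z j t q r).cell 2 = x := rfl
@[simp] theorem mem_cell_three : (mem A f u x z j t q r).cell 3 = z := rfl
@[simp] theorem mem_cell_four : (mem A f u x z j t q r).cell 4 = j := rfl
@[simp] theorem mem_cell_five : (mem A f u x z j t q r).cell 5 = t := rfl
@[simp] theorem mem_cell_six : (mem A f u x z j t q r).cell 6 = q := rfl
@[simp] theorem mem_cell_seven : (mem A f u x z j t q r).cell 7 = r := rfl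
@[simp] theorem mem_arr : (mem A f u x z j t q r).arr = A := rfl

theorem Config.ext_cells {c c' : Config V 7} (hA : c.arr = c'.arr) (h : ∀ i, c.cell i = c'.cell i) :
    c = c' := Config.ext' h fun _ _ => by rw [hA]

@[simp] theorem mem_set_zero : (mem A f u x z j t q r).set 0 a = mem A a u x z j t q r :=
  Config.ext_cells rfl fun i => by fin_cases i <;> rfl
@[simp] theorem mem_set_one : (mem A f u x z j t q r).set 1 a = mem A f a x z j t q r :=
  Config.ext_cells rfl fun i => by fin_cases i <;> rfl
@[simp] theorem mem_set_two : (mem A f u x z j t q r).set 2 a = mem A f u a z j t q r :=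
  Config.ext_cells rfl fun i => by fin_cases i <;> rfl
@[simp] theorem mem_set_three : (mem A f u x z j t q r).set 3 a = mem A f u x a j t q r :=
  Config.ext_cells rfl fun i => by fin_cases i <;> rfl
@[simp] theorem mem_set_four : (mem A f u x z j t q r).set 4 a = mem A f u x z a t q r :=
  Config.ext_cells rfl fun i => by fin_cases i <;> rfl
@[simp] theorem mem_set_five : (mem A f u x z j t q r).set 5 a = mem A f u x z j a q r :=
  Config.ext_cells rfl fun i => by fin_cases i <;> rfl
@[simp] theorem mem_set_six : (mem A f u x z j t q r).set 6 a = mem A f u x z j t a r :=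
  Config.ext_cells rfl fun i => by fin_cases i <;> rfl
@[simp] theorem mem_set_seven : (mem A f u x z j t q r).set 7 a = mem A f u x z j t q a :=
  Config.ext_cells rfl fun i => by fin_cases i <;> rfl

/-- Overwrite an entry of the arrays. -/
def setEntry (A : Fin 8 → ℤ → Word V) (i : Fin 8) (l : ℤ) (a : Word V) : Fin 8 → ℤ → Word V :=
  Function.update A i (Function.update (A i) l a)

@[simp] theorem setEntry_apply (A : Fin 8 → ℤ → Word V) (i i' : Fin 8) (l l' : ℤ) (a : Word V) :
    setEntry A i l a i' l' = if i' = i ∧ l' = l then a else A i' l' := by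
  unfold setEntry
  by_cases h : i' = i
  · subst h
    simp [Function.update_apply]
  · simp [h]

@[simp] theorem mem_setArr (i : Fin 8) (l : ℤ) :
    (mem A f u x z j t q r).setArr i l a = mem (setEntry A i l a) f u x z j t q r := rfl

@[simp] theorem mem_pair (p p' : Word V) :
    (mem A f u x z j t q r).pair p p' = mem A f u p p' j t q r := by simp [Config.pair]

end Program

/-! ### The program of the transducer on basis states. -/

section Evolution

variable {V : Type u} [Fintype V] [DecidableEq V] {M : Finset V} {b r : V → ℝ}

/-- The elfs process is at `u`, after `t` moves and `j` failed attempts to move from `u`. -/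
def atVertex (A : Fin 8 → ℤ → Word V) (u : V) (t j : ℕ) : Config V 7 :=
  mem A (.num 1) (.vtx (some u)) (.num 0) (.num 0) (.num j) (.num t) (.num 0) (.num 0)

/-- The walk from `u` is at the pair `e`, and `ρ` tells whether it has been marked. -/
def inWalk (A : Fin 8 → ℤ → Word V) (u : V) (t j : ℕ) (ρ : ℤ) (e : Option V × Option V) :
    Config V 7 :=
  mem A (.num 1) (.vtx (some u)) (.vtx e.1) (.vtx e.2) (.num j) (.num t) (.num 1) (.num ρ)

variable (A : Fin 8 → ℤ → Word V) {u : V} (t j : ℕ)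

/-- The part of the feeding that restores the cells of the walk. -/
theorem feed_tail (x : Word V) (hx : x = .vtx none) :
    Evolves M b r (feed.drop 3) (ket (mem A (.num 1) (.vtx (some u)) x (.vtx (some u))
      (.num j) (.num t) (.num 0) (.num 0))) (ket (atVertex A u t (j + 1))) := by
  subst hx
  refine Evolves.ket_cons (by simp [Gate.act, Guard.Holds, Test.Holds, Op.act]; rfl)
    (.ket_cons (by simp [Gate.act, Guard.Holds, Test.Holds, Op.act]; rfl)
    (.gate (by simp [Gate.act, Guard.Holds, Test.Holds, Op.act, atVertex])))

theorem feed_tail_inWalk (e : Option V × Option V) :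
    Evolves M b r (feed.drop 3) (ket (inWalk A u t j 0 e)) (ket (inWalk A u t j 0 e)) :=
  Evolves.skip (by simp [Guard.Holds, Test.Holds, inWalk])
    (.skip (by simp [Guard.Holds, Test.Holds, inWalk])
    (.skip (by simp [Guard.Holds, Test.Holds, inWalk]) .refl))

/-- With the walk off, cells `2` and `3` are prepared as (σ, u), the only pair in the walk vector
that starts at σ, so the rotation of cell `6` couples waiting at u to exactly that pair. If the walk
stays off, the preparation is undone and the counter increases; the amplitude returning from the
walk is counted likewise. -/
theorem feed_atVertex : Evolves M b r feed (ket (atVertex A u t j))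
    (((Real.cos (feedAngle (b u) (r u)) : ℝ) : ℂ) • ket (atVertex A u t (j + 1)) +
      ((Real.sin (feedAngle (b u) (r u)) : ℝ) : ℂ) • ket (inWalk A u t j 0 (none, some u))) := by
  refine Evolves.ket_cons (by simp [Gate.act, Guard.Holds, Test.Holds, Op.act, atVertex]; rfl)
    (.ket_cons (by simp [Gate.act, Guard.Holds, Test.Holds, Op.act]; rfl)
    (.ket_cons (by simp [Gate.act, Guard.Holds, Test.Holds, Op.act, rotation,
      -Complex.ofReal_cos, -Complex.ofReal_sin, -Complex.coe_smul]; rfl) ?_))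
  exact ((feed_tail A t j _ rfl).smul _).add ((feed_tail_inWalk A t j (none, some u)).smul _)

theorem feed_inWalk_attached : Evolves M b r feed (ket (inWalk A u t j 0 (none, some u)))
    (((Real.cos (feedAngle (b u) (r u)) : ℝ) : ℂ) • ket (inWalk A u t j 0 (none, some u)) -
      ((Real.sin (feedAngle (b u) (r u)) : ℝ) : ℂ) • ket (atVertex A u t (j + 1))) := by
  refine Evolves.skip (by simp [Guard.Holds, Test.Holds, inWalk])
    (.skip (by simp [Guard.Holds, Test.Holds, inWalk])
    (.ket_cons (by simp [Gate.act, Guard.Holds, Test.Holds, Op.act, rotation, inWalk,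
      -Complex.ofReal_cos, -Complex.ofReal_sin, -Complex.coe_smul]; rfl) ?_))
  rw [sub_eq_add_neg, sub_eq_add_neg, ← neg_smul, ← neg_smul]
  exact ((feed_tail_inWalk A t j (none, some u)).smul _).add ((feed_tail A t j _ rfl).smul _)

theorem feed_inWalk {p : V} (q : Option V) : Evolves M b r feed (ket (inWalk A u t j 0 (some p, q)))
    (ket (inWalk A u t j 0 (some p, q))) :=
  Evolves.skip (by simp [Guard.Holds, Test.Holds, inWalk])
    (.skip (by simp [Guard.Holds, Test.Holds, inWalk])
    (.skip (by simp [Guard.Holds, Test.Holds, inWalk]) (feed_tail_inWalk A t j _)))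

theorem mark_atVertex : Evolves M b r mark (ket (atVertex A u t j)) (ket (atVertex A u t j)) :=
  Evolves.skip (by simp [Guard.Holds, Test.Holds, atVertex, guardEdge])
    (.skip (by simp [Guard.Holds, Test.Holds, atVertex, guardWalk])
    (.skip (by simp [Guard.Holds, Test.Holds, atVertex, guardWalk])
    (.skip (by simp [Guard.Holds, Test.Holds, atVertex, guardEdge]) .refl)))

/-- The rotations spare the attached edge, so only minus the swap acts. It exchanges the two
amplitudes there with a sign, which is the form needed to restore the catalyst. -/
theorem mark_attached {p q : Option V} (hpq : p = none ∨ q = none) :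
    Evolves M b r mark (ket (inWalk A u t j 0 (p, q))) (-ket (inWalk A u t j 0 (q, p))) := by
  refine Evolves.skip (by rcases hpq with rfl | rfl <;> simp [Guard.Holds, Test.Holds, inWalk, guardEdge])
    (.ket_cons (by simp [Gate.act, Guard.Holds, Test.Holds, Op.act, inWalk, guardWalk]; rfl)
    (.ket_cons (by simp [Gate.act, Guard.Holds, Test.Holds, Op.act, guardWalk]; rfl) ?_))
  rw [← neg_one_smul ℂ, ← neg_one_smul ℂ (ket (inWalk A u t j 0 (q, p)))]
  refine (Evolves.skip ?_ .refl).smul _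
  rcases hpq with rfl | rfl <;> simp [Guard.Holds, Test.Holds, guardEdge]

theorem rotate_edge (θ : ℝ → ℝ → ℝ) (p q : V) :
    Gate.act M b r (inWalk A u t j 0 (some p, some q)) (guardEdge, .rotateBy 7 1 θ) =
      ((Real.cos (θ (b u) (r u)) : ℝ) : ℂ) • ket (inWalk A u t j 0 (some p, some q)) +
      ((Real.sin (θ (b u) (r u)) : ℝ) : ℂ) • ket (inWalk A u t j 1 (some p, some q)) := by
  simp [Gate.act, Guard.Holds, Test.Holds, Op.act, inWalk, guardEdge, rotation,
    -Complex.ofReal_cos, -Complex.ofReal_sin, -Complex.coe_smul]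

theorem rotate_edge_marked (θ : ℝ → ℝ → ℝ) (p q : V) :
    Gate.act M b r (inWalk A u t j 1 (some p, some q)) (guardEdge, .rotateBy 7 1 θ) =
      ((Real.cos (θ (b u) (r u)) : ℝ) : ℂ) • ket (inWalk A u t j 1 (some p, some q)) -
      ((Real.sin (θ (b u) (r u)) : ℝ) : ℂ) • ket (inWalk A u t j 0 (some p, some q)) := by
  simp [Gate.act, Guard.Holds, Test.Holds, Op.act, inWalk, guardEdge, rotation,
    -Complex.ofReal_cos, -Complex.ofReal_sin, -Complex.coe_smul]

/-- Two half rotations around minus the swap of the unmarked branch. On the symmetric combination of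
(p, q) and (q, p) the net effect is trivial; the antisymmetric one is rotated by the full angle φ =
`flowAngle (b u)` into the marked branch. -/
theorem mark_edge (p q : V) : Evolves M b r mark (ket (inWalk A u t j 0 (some p, some q)))
    (((Real.cos ((flowAngle (b u) + Real.pi) / 2) : ℝ) : ℂ) • -(
        ((Real.cos ((flowAngle (b u) - Real.pi) / 2) : ℝ) : ℂ) •
          ket (inWalk A u t j 0 (some q, some p)) +
        ((Real.sin ((flowAngle (b u) - Real.pi) / 2) : ℝ) : ℂ) •
          ket (inWalk A u t j 1 (some q, some p))) +
      ((Real.sin ((flowAngle (b u) + Real.pi) / 2) : ℝ) : ℂ) • (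
        ((Real.cos ((flowAngle (b u) - Real.pi) / 2) : ℝ) : ℂ) •
          ket (inWalk A u t j 1 (some p, some q)) -
        ((Real.sin ((flowAngle (b u) - Real.pi) / 2) : ℝ) : ℂ) •
          ket (inWalk A u t j 0 (some p, some q)))) := by
  refine Evolves.ket_cons (rotate_edge A t j _ p q) (Evolves.add (.smul _ ?_) (.smul _ ?_))
  · refine .ket_cons (by simp [Gate.act, Guard.Holds, Test.Holds, Op.act, inWalk, guardWalk]; rfl)
      (.ket_cons (by simp [Gate.act, Guard.Holds, Test.Holds, Op.act, guardWalk]; rfl) ?_)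
    rw [← neg_one_smul ℂ, ← neg_one_smul ℂ (_ + _)]
    exact (Evolves.gate (rotate_edge A t j _ q p)).smul _
  · refine .skip (by simp [Guard.Holds, Test.Holds, inWalk, guardWalk])
      (.skip (by simp [Guard.Holds, Test.Holds, inWalk, guardWalk])
      (.gate (rotate_edge_marked A t j _ p q)))

theorem advance_fix {c : Config V 7} (hc : c.cell 7 = .num 0) :
    Evolves M b r advance (ket c) (ket c) := by
  have : ¬ Guard.Holds M c [(.isNum 7 1, true)] := by simp [Guard.Holds, Test.Holds, hc]
  exact .skip this (.skip this (.skip this (.skip this (.skip this (.skip this .refl)))))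

theorem finish_atVertex : Evolves M b r finish (ket (atVertex A u t (j + 1)))
    (ket (atVertex A u t (j + 1))) := by
  have : ((j : ℤ) + 1) ≠ 0 := by positivity
  exact .skip (by simp [Guard.Holds, Test.Holds, atVertex, this])
    (.skip (by simp [Guard.Holds, Test.Holds, atVertex, this])
    (.skip (by simp [Guard.Holds, Test.Holds, atVertex]) .refl))

theorem finish_inWalk (e : Option V × Option V) : Evolves M b r finish (ket (inWalk A u t j 0 e))
    (ket (inWalk A u t j 0 e)) :=
  .skip (by simp [Guard.Holds, Test.Holds, inWalk])
    (.skip (by simp [Guard.Holds, Test.Holds, inWalk])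
    (.skip (by simp [Guard.Holds, Test.Holds, inWalk]) .refl))

/-- Record a move from `u`. -/
def recordMove (A : Fin 8 → ℤ → Word V) (u q : V) (t j : ℕ) : Fin 8 → ℤ → Word V :=
  setEntry (setEntry (setEntry A 0 t (.vtx (some u))) 1 t (.vtx (some q))) 2 t (.num j)

/-- The process has ended at `p`, after `t` moves. -/
def atSink (A : Fin 8 → ℤ → Word V) (p : V) (t : ℕ) : Config V 7 :=
  mem (setEntry A 0 t (.vtx (some p))) (.num 0) (.num 0) (.num 0) (.num 0) (.num 0) (.num t)
    (.num 0) (.num 0)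

/-- The process has just arrived at `p`, after `t` moves. -/
def arrived (M : Finset V) (A : Fin 8 → ℤ → Word V) (p : V) (t : ℕ) : Config V 7 :=
  if p ∈ M then atSink A p t else atVertex A p t 0

/-- The array entries at position t are blank, so swapping them in stores u, q and j and clears the
cells at the same time. -/
theorem advance_inWalk (hA : ∀ a, A a t = .num 0) (p q : V) :
    Evolves M b r advance (ket (inWalk A u t j 1 (some p, some q)))
      (ket (mem (recordMove A u q t j) (.num 1) (.vtx (some p)) (.num 0) (.num 0) (.num 0)
        (.num (t + 1)) (.num 0) (.num 1))) := by
  refine .ket_cons (by simp [Gate.act, Guard.Holds, Test.Holds, Op.act, inWalk]; rfl)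
    (.ket_cons (by simp [Gate.act, Guard.Holds, Test.Holds, Op.act]; rfl)
    (.ket_cons (by simp [Gate.act, Guard.Holds, Test.Holds, Op.act]; rfl)
    (.ket_cons (by simp [Gate.act, Guard.Holds, Test.Holds, Op.act]; rfl)
    (.ket_cons (by simp [Gate.act, Guard.Holds, Test.Holds, Op.act]; rfl)
    (.gate (by simp [Gate.act, Guard.Holds, Test.Holds, Op.act, hA, recordMove]))))))

/-- The mark can be erased because a fresh arrival is recognisable without it: the walk is off and
the counter is 0, while after a failed attempt the counter is positive. -/
theorem finish_arrived (hA : A 0 (t + 1) = .num 0) (p : V) :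
    Evolves M b r finish (ket (mem A (.num 1) (.vtx (some p)) (.num 0) (.num 0) (.num 0)
        (.num (t + 1)) (.num 0) (.num 1))) (ket (arrived M A p (t + 1))) := by
  by_cases hp : p ∈ M
  · refine .ket_cons (by simp [Gate.act, Guard.Holds, Test.Holds, Op.act]; rfl)
      (.ket_cons (by simp [Gate.act, Guard.Holds, Test.Holds, Op.act, hp]; rfl)
      (.gate (by simp [Gate.act, Guard.Holds, Test.Holds, Op.act, arrived, hp, atSink, hA])))
  · exact .ket_cons (by simp [Gate.act, Guard.Holds, Test.Holds, Op.act]; rfl)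
      (.skip (by simp [Guard.Holds, Test.Holds, hp])
      (.ket_cons (by simp [Gate.act, Guard.Holds, Test.Holds, arrived, hp, atVertex]) .refl))

theorem load_init (hA : A 0 0 = .num 0) :
    Evolves M b r load (ket (mem (setEntry A 0 0 (.vtx (some u))) (.num 0) (.num 0) (.num 0) (.num 0)
      (.num 0) (.num 0) (.num 0) (.num 0))) (ket (atVertex A u 0 0)) := by
  have : setEntry (setEntry A 0 0 (Word.vtx (some u))) 0 0 (.num 0) = A := by
    funext a l
    simp only [setEntry_apply]
    split_ifs with h
    · rw [h.1, h.2, hA]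
    · rfl
  exact .ket_cons (by simp [Gate.act, Guard.Holds, Test.Holds, Op.act]; rfl)
    (.gate (by simp [Gate.act, Guard.Holds, Test.Holds, Op.act, atVertex, this]))

/-- Loading recognises the start by zero moves, zero failed attempts and the walk off. The catalyst
must avoid these states, which is why it omits the start itself. -/
theorem load_fix {c : Config V 7} (h0 : c.cell 0 = .num 1)
    (h : ¬(c.cell 5 = .num 0 ∧ c.cell 4 = .num 0 ∧ c.cell 6 = .num 0)) :
    Evolves M b r load (ket c) (ket c) :=
  .skip (by simp [Guard.Holds, Test.Holds, h0]) (.skip (by simpa [Guard.Holds, Test.Holds] using h)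
    .refl)

theorem exists_runs_load_feed :
    ∃ T : Space V 7 ≃ₗᵢ[ℂ] Space V 7, Runs M b r (load ++ feed) T := by
  refine exists_runs fun g hg => ?_
  simp only [load, feed, List.cons_append, List.nil_append, List.mem_cons, List.not_mem_nil,
    or_false] at hg
  rcases hg with rfl | rfl | rfl | rfl | rfl | rfl | rfl | rfl
  · exact exists_gate_swapArr (by decide) (by decide)
  · exact exists_gate_addConst _ (by decide)
  · exact exists_gate_exchange _ (by decide)
  · exact exists_gate_copyCell (by decide) (by decide)
  · exact exists_gate_rotateBy (by decide) _ (by decide)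
  · exact exists_gate_addConst _ (by decide)
  · exact exists_gate_copyCell (by decide) (by decide)
  · exact exists_gate_exchange _ (by decide)

theorem exists_runs_mark_advance_finish :
    ∃ T : Space V 7 ≃ₗᵢ[ℂ] Space V 7, Runs M b r (mark ++ (advance ++ finish)) T := by
  refine exists_runs fun g hg => ?_
  simp only [mark, advance, finish, List.cons_append, List.nil_append, List.mem_cons,
    List.not_mem_nil, or_false] at hg
  rcases hg with rfl | rfl | rfl | rfl | rfl | rfl | rfl | rfl | rfl | rfl | rfl | rfl | rfl
  · exact exists_gate_rotateBy (by decide) _ (by decide)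
  · exact exists_gate_swapCells_of_avoids (by decide)
  · exact exists_gate_neg _
  · exact exists_gate_rotateBy (by decide) _ (by decide)
  · exact exists_gate_swapArr (by decide) (by decide)
  · exact exists_gate_swapArr (by decide) (by decide)
  · exact exists_gate_swapArr (by decide) (by decide)
  · exact exists_gate_addConst _ (by decide)
  · exact exists_gate_addConst _ (by decide)
  · exact exists_gate_swapCells_of_avoids (by decide)
  · exact exists_gate_addConst _ (by decide)
  · exact exists_gate_addConst _ (by decide)
  · exact exists_gate_swapArr (by decide) (by decide)

end Evolution

/-! ### One step of the transducer -/

section Step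

variable {V : Type u} [Fintype V] [DecidableEq V] {w : V → V → ℝ} {M : Finset V} {b r : V → ℝ}

theorem cos_feedAngle {b : ℝ} (r : ℝ) :
    Real.cos (feedAngle b r) = 2 / (1 + Real.sqrt b) - 1 := by
  rw [feedAngle, cos_two_arctan, Real.sq_sqrt (Real.sqrt_nonneg _)]

theorem sin_feedAngle {b : ℝ} (r : ℝ) :
    Real.sin (feedAngle b r) = 2 * Real.sqrt (Real.sqrt b) / (1 + Real.sqrt b) := by
  rw [feedAngle, sin_two_arctan, Real.sq_sqrt (Real.sqrt_nonneg _)]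

theorem cos_flowAngle (b : ℝ) :
    (Real.sqrt b + 1 / 2) * Real.cos (flowAngle b) = Real.sqrt b - 1 / 2 := by
  have h := Real.sqrt_nonneg b
  rw [flowAngle, Real.cos_arccos]
  · field_simp
  · rw [le_div_iff₀ (by positivity)]
    linarith
  · rw [div_le_iff₀ (by positivity)]
    linarith

/-- From (m + 1/2)² - (m - 1/2)² = 2m with m = √b: the weight that marking takes from the flow
reappears as amplitude √(2m). -/
theorem sin_flowAngle (b : ℝ) :
    (Real.sqrt b + 1 / 2) * Real.sin (flowAngle b) = Real.sqrt (2 * Real.sqrt b) := by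
  have h := Real.sqrt_nonneg b
  rw [flowAngle, Real.sin_arccos]
  have h1 : 0 < Real.sqrt b + 1 / 2 := by positivity
  rw [← Real.sqrt_sq h1.le, ← Real.sqrt_mul (sq_nonneg _), Real.sqrt_sq h1.le]
  congr 1
  field_simp
  ring

/-- The amplitude that the potential `v`, with weight `m` on its flow, gives to a pair of
vertices. -/
def edgeAmp (w : V → V → ℝ) (η : ℝ) (u : V) (v : V → ℝ) (m : ℝ) (p q : V) : ℝ :=
  Real.sqrt (η * deg w u) * Real.sqrt (w p q) * ((v p + v q) / 2 + m * (v p - v q))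

/-- The amplitude of a marked pair of vertices. -/
def flowAmp (w : V → V → ℝ) (η : ℝ) (u : V) (v : V → ℝ) (b : ℝ) (p q : V) : ℝ :=
  Real.sqrt (2 * Real.sqrt b) * (Real.sqrt (η * deg w u) * Real.sqrt (w p q) * (v p - v q))

theorem sum_walkVec {E : Type*} [AddCommGroup E] [Module ℂ E] (η : ℝ) (u : V) (v : V → ℝ)
    (m a₁ a₂ : ℝ) (ψ : Option V × Option V → E) :
    ∑ e, ((walkVec w η u v m a₁ a₂ e : ℝ) : ℂ) • ψ e =
      (a₁ : ℂ) • ψ (none, some u) + (a₂ : ℂ) • ψ (some u, none) +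
        ∑ p, ∑ q, ((edgeAmp w η u v m p q : ℝ) : ℂ) • ψ (some p, some q) := by
  rw [Fintype.sum_prod_type, Fintype.sum_option]
  simp only [Fintype.sum_option]
  have h1 : ∀ p, ((walkVec w η u v m a₁ a₂ (none, some p) : ℝ) : ℂ) • ψ (none, some p) =
      if p = u then (a₁ : ℂ) • ψ (none, some u) else 0 := fun p => by
    by_cases h : p = u
    · subst h; simp [walkVec]
    · simp [walkVec, h]
  have h2 : ∀ p, ((walkVec w η u v m a₁ a₂ (some p, none) : ℝ) : ℂ) • ψ (some p, none) =
      if p = u then (a₂ : ℂ) • ψ (some u, none) else 0 := fun p => by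
    by_cases h : p = u
    · subst h; simp [walkVec]
    · simp [walkVec, h]
  have h3 : ((walkVec w η u v m a₁ a₂ (none, none) : ℝ) : ℂ) = 0 := by simp [walkVec]
  simp only [h1, h2, h3, Finset.sum_add_distrib, Finset.sum_ite_eq', Finset.mem_univ, if_true,
    zero_smul, zero_add]
  rw [add_assoc]
  rfl

variable (w b r) in
/-- The state of the walk from `u` that catalyses the transduction. -/
def catWalk (A : Fin 8 → ℤ → Word V) (u : V) (t j : ℕ) (v : V → ℝ) : Space V 7 :=
  ∑ e, ((walkVec w (b u / r u) u v (Real.sqrt (b u) - 1 / 2)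
    (Real.sqrt (b u) - b u / r u * deg w u * v u)
    (-(Real.sqrt (b u) - 1 - b u / r u * deg w u * v u)) e : ℝ) : ℂ) • ket (inWalk A u t j 0 e)

variable (A : Fin 8 → ℤ → Word V) {u : V} (t j : ℕ)

/-- The potential part of the walk vector is symmetric and stays, the flow part is antisymmetric and
is rotated by φ, where (m + 1/2) cos φ = m - 1/2. This undoes the increment of the walk step and
marks √(2m) times the flow. -/
theorem mark_sum (η : ℝ) (hN : IsNetwork w M) (v : V → ℝ) (a₁ a₂ : ℝ)
    {T : Space V 7 ≃ₗᵢ[ℂ] Space V 7} (hT : Runs M b r mark T) :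
    T (∑ e, ((walkVec w η u v (Real.sqrt (b u) + 1 / 2) a₁ a₂ e : ℝ) : ℂ) •
      ket (inWalk A u t j 0 e)) =
    ∑ e, ((walkVec w η u v (Real.sqrt (b u) - 1 / 2) (-a₂) (-a₁) e : ℝ) : ℂ) •
      ket (inWalk A u t j 0 e) +
    ∑ p, ∑ q, ((flowAmp w η u v (b u) p q : ℝ) : ℂ) • ket (inWalk A u t j 1 (some p, some q)) := by
  rw [sum_walkVec, sum_walkVec]
  have e1 := mark_attached A t j (u := u) (M := M) (b := b) (r := r) (p := none) (q := some u)
    (.inl rfl) T hT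
  have e2 := mark_attached A t j (u := u) (M := M) (b := b) (r := r) (p := some u) (q := none)
    (.inr rfl) T hT
  set s := Real.sin (flowAngle (b u) / 2)
  set c := Real.cos (flowAngle (b u) / 2)
  set W : ℤ → V → V → Space V 7 := fun ρ p q => ket (inWalk A u t j ρ (some p, some q)) with hW
  have hcc : c ^ 2 + s ^ 2 = 1 := Real.cos_sq_add_sin_sq _
  have hcos : Real.cos (flowAngle (b u)) = c ^ 2 - s ^ 2 := by
    rw [← mul_div_cancel₀ (flowAngle (b u)) (two_ne_zero' ℝ), Real.cos_two_mul']
  have hsin : Real.sin (flowAngle (b u)) = 2 * s * c := by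
    rw [← mul_div_cancel₀ (flowAngle (b u)) (two_ne_zero' ℝ), Real.sin_two_mul]
  have hc := cos_flowAngle (b u)
  have hs := sin_flowAngle (b u)
  rw [hcos] at hc
  rw [hsin] at hs
  have c1 : Real.cos ((flowAngle (b u) + Real.pi) / 2) = -s := by
    rw [add_div, Real.cos_add_pi_div_two]
  have s1 : Real.sin ((flowAngle (b u) + Real.pi) / 2) = c := by
    rw [add_div, Real.sin_add_pi_div_two]
  have c2 : Real.cos ((flowAngle (b u) - Real.pi) / 2) = s := by
    rw [sub_div, Real.cos_sub_pi_div_two]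
  have s2 : Real.sin ((flowAngle (b u) - Real.pi) / 2) = -c := by
    rw [sub_div, Real.sin_sub_pi_div_two]
  have e3 : ∀ p q, T (W 0 p q) = ((c ^ 2 : ℝ) : ℂ) • W 0 p q + ((s * c : ℝ) : ℂ) • W 1 p q +
      (((s ^ 2 : ℝ) : ℂ) • W 0 q p + ((-(s * c) : ℝ) : ℂ) • W 1 q p) := fun p q => by
    have := mark_edge A t j (u := u) (M := M) (b := b) (r := r) p q T hT
    rw [c1, s1, c2, s2] at this
    change T (ket (inWalk A u t j 0 (some p, some q))) = _
    rw [this]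
    simp only [hW]
    push_cast
    module
  have e4 : T (∑ p, ∑ q, ((edgeAmp w η u v (Real.sqrt (b u) + 1 / 2) p q : ℝ) : ℂ) • W 0 p q) =
      ∑ p, ∑ q, ((edgeAmp w η u v (Real.sqrt (b u) - 1 / 2) p q : ℝ) : ℂ) • W 0 p q +
      ∑ p, ∑ q, ((flowAmp w η u v (b u) p q : ℝ) : ℂ) • W 1 p q := by
    simp only [map_sum, map_smul, e3]
    set x := edgeAmp w η u v (Real.sqrt (b u) + 1 / 2)
    -- Renaming p and q in the swapped terms collects the coefficient of each basis state, so that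
    -- the comparison is made pair by pair.
    have : ∑ p, ∑ q, ((x p q : ℝ) : ℂ) • (((c ^ 2 : ℝ) : ℂ) • W 0 p q +
          ((s * c : ℝ) : ℂ) • W 1 p q +
        (((s ^ 2 : ℝ) : ℂ) • W 0 q p + ((-(s * c) : ℝ) : ℂ) • W 1 q p)) =
      ∑ p, ∑ q, (((x p q : ℝ) : ℂ) • (((c ^ 2 : ℝ) : ℂ) • W 0 p q + ((s * c : ℝ) : ℂ) • W 1 p q) +
        ((x q p : ℝ) : ℂ) • (((s ^ 2 : ℝ) : ℂ) • W 0 p q + ((-(s * c) : ℝ) : ℂ) • W 1 p q)) := by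
      simp only [smul_add _ (_ + _) (_ + _), Finset.sum_add_distrib]
      congr 1
      exact Finset.sum_comm
    rw [this]
    simp only [← Finset.sum_add_distrib]
    refine Finset.sum_congr rfl fun p _ => Finset.sum_congr rfl fun q _ => ?_
    have f1 : edgeAmp w η u v (Real.sqrt (b u) - 1 / 2) p q = x p q * c ^ 2 + x q p * s ^ 2 := by
      simp only [x, edgeAmp, hN.symm q p]
      rw [← hc]
      linear_combination (- Real.sqrt (η * deg w u) * Real.sqrt (w p q) * ((v p + v q) / 2)) * hcc
    have f2 : flowAmp w η u v (b u) p q = x p q * (s * c) - x q p * (s * c) := by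
      simp only [x, edgeAmp, flowAmp, hN.symm q p]
      rw [← hs]
      ring
    rw [f1, f2]
    push_cast
    module
  rw [map_add, map_add, map_smul, map_smul, e1, e2, e4]
  push_cast
  module

/-- The walk step needs amplitude m + q on the pair (σ, u), but leaves m - q. The numbers α and ε
solve the two equations saying that the rotation takes (1, α(m - q)) to (ε, α(m + q)); these are
`f1` and `f2`. -/
theorem feed_sum (hb : 0 ≤ b u) {v : V → ℝ} (hq : 0 < b u / r u * deg w u * v u)
    {α ε : ℝ} (hα : α = Real.sqrt (Real.sqrt (b u)) / (b u / r u * deg w u * v u + b u))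
    (hε : ε = (b u / r u * deg w u * v u - b u) / (b u / r u * deg w u * v u + b u))
    {T : Space V 7 ≃ₗᵢ[ℂ] Space V 7} (hT : Runs M b r feed T) :
    T (ket (atVertex A u t j) + (α : ℂ) • catWalk w b r A u t j v) =
      (ε : ℂ) • ket (atVertex A u t (j + 1)) +
      (α : ℂ) • ∑ e, ((walkVec w (b u / r u) u v (Real.sqrt (b u) - 1 / 2)
        (Real.sqrt (b u) + b u / r u * deg w u * v u)
        (-(Real.sqrt (b u) - 1 - b u / r u * deg w u * v u)) e : ℝ) : ℂ) •
          ket (inWalk A u t j 0 e) := by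
  have e1 := feed_atVertex A t j (u := u) (M := M) (b := b) (r := r) T hT
  have e2 := feed_inWalk_attached A t j (u := u) (M := M) (b := b) (r := r) T hT
  have e3 := fun p q => feed_inWalk A t j (u := u) (M := M) (b := b) (r := r) (p := p) q T hT
  rw [catWalk, sum_walkVec, sum_walkVec]
  simp only [map_add, map_smul, map_sum, e1, e2, e3]
  rw [cos_feedAngle, sin_feedAngle]
  have hm2 : Real.sqrt (b u) * Real.sqrt (b u) = b u := Real.mul_self_sqrt hb
  have hm := Real.sqrt_nonneg (b u)
  set q := b u / r u * deg w u * v u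
  set m := Real.sqrt (b u)
  have ht : Real.sqrt m * Real.sqrt m = m := Real.mul_self_sqrt hm
  set τ := Real.sqrt m
  rw [← hm2] at hα hε
  have hd : q + m * m ≠ 0 := by positivity
  have hd1 : 1 + m ≠ 0 := by positivity
  have f1 : ε = (2 / (1 + m) - 1) - α * (m - q) * (2 * τ / (1 + m)) := by
    rw [hα, hε]
    field_simp
    linear_combination 2 * (m - q) * ht
  have f2 : α * (m + q) = 2 * τ / (1 + m) + α * (m - q) * (2 / (1 + m) - 1) := by
    rw [hα]
    field_simp
    ring
  have g1 : (ε : ℂ) = (((2 / (1 + m) - 1) - α * (m - q) * (2 * τ / (1 + m)) : ℝ) : ℂ) := by rw [← f1]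
  have g2 : (α : ℂ) * ((m + q : ℝ) : ℂ) =
      ((2 * τ / (1 + m) + α * (m - q) * (2 / (1 + m) - 1) : ℝ) : ℂ) := by
    rw [← f2]; push_cast; ring
  rw [smul_add (α : ℂ) (_ + _), smul_add (α : ℂ) (_ + _), smul_add (α : ℂ) (_ • _),
    smul_add (α : ℂ) (_ • _), smul_smul (α : ℂ) ((m + q : ℝ) : ℂ), g1, g2]
  push_cast
  module

theorem walk_sum (hN : IsNetwork w M) (hη : 0 ≤ b u / r u) (hu : u ∉ M) {v : V → ℝ}
    (hv : IsPotential w M u v) (m : ℝ) {T : Space V 7 ≃ₗᵢ[ℂ] Space V 7}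
    (hT : IsWalkCall w M b r walkGuard 1 2 3 T) :
    T (∑ e, ((walkVec w (b u / r u) u v (m - 1 / 2) (m + b u / r u * deg w u * v u)
        (-(m - 1 - b u / r u * deg w u * v u)) e : ℝ) : ℂ) • ket (inWalk A u t j 0 e)) =
      ∑ e, ((walkVec w (b u / r u) u v (m + 1 / 2) (m - 1 - b u / r u * deg w u * v u)
        (-(m - b u / r u * deg w u * v u)) e : ℝ) : ℂ) • ket (inWalk A u t j 0 e) := by
  have e1 : ∀ e : Option V × Option V, T (ket (inWalk A u t j 0 e)) =
      ∑ e', attachedWalk w M (b u / r u) u e' e • ket (inWalk A u t j 0 e') := fun e => by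
    have := walkCall_act hu (c := inWalk A u t j 0 e) ⟨rfl, rfl⟩ hT e.1 e.2
    simpa only [inWalk, mem_pair] using this
  simp only [map_sum, map_smul, e1, Finset.smul_sum, smul_smul]
  rw [Finset.sum_comm]
  refine Finset.sum_congr rfl fun e _ => ?_
  rw [← attachedWalk_mulVec hN hη hu hv m e, Finset.sum_smul]
  exact Finset.sum_congr rfl fun e' _ => by rw [mul_comm]

/-- One step of the transducer, on basis states of the rest of the memory. -/
theorem step_ket (hN : IsNetwork w M) (hη : 0 ≤ b u / r u) (hu : u ∉ M) (hb : 0 ≤ b u)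
    {v : V → ℝ} (hv : IsPotential w M u v) (hq : 0 < b u / r u * deg w u * v u)
    {α ε : ℝ} (hα : α = Real.sqrt (Real.sqrt (b u)) / (b u / r u * deg w u * v u + b u))
    (hε : ε = (b u / r u * deg w u * v u - b u) / (b u / r u * deg w u * v u + b u))
    {TF TW TB : Space V 7 ≃ₗᵢ[ℂ] Space V 7} (hTF : Runs M b r feed TF)
    (hTW : IsWalkCall w M b r walkGuard 1 2 3 TW) (hTB : Runs M b r (mark ++ (advance ++ finish)) TB)
    (hA : ∀ a, ∀ l : ℕ, t ≤ l → A a l = .num 0) :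
    TB (TW (TF (ket (atVertex A u t j) + (α : ℂ) • catWalk w b r A u t j v))) =
      (α : ℂ) • catWalk w b r A u t j v + (ε : ℂ) • ket (atVertex A u t (j + 1)) +
      ∑ p, ∑ q, ((α * flowAmp w (b u / r u) u v (b u) p q : ℝ) : ℂ) •
        ket (arrived M (recordMove A u q t j) p (t + 1)) := by
  rw [feed_sum A t j hb hq hα hε hTF, map_add, map_smul, map_smul,
    walk_sum A t j hN hη hu hv _ hTW]
  have e1 : TW (ket (atVertex A u t (j + 1))) = ket (atVertex A u t (j + 1)) := by
    rw [hTW, if_neg fun h => by simpa [atVertex] using holds_walkGuard.1 h]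
  rw [e1]
  have hAF : ∀ {c : Config V 7}, c.cell 7 = .num 0 →
      Evolves M b r finish (ket c) (ket c) → Evolves M b r (advance ++ finish) (ket c) (ket c) :=
    fun h h' => (advance_fix h).append h'
  have e2 : TB (ket (atVertex A u t (j + 1))) = ket (atVertex A u t (j + 1)) :=
    ((mark_atVertex A t (j + 1)).append (hAF rfl (finish_atVertex A t j))) TB hTB
  have e3 : ∀ p q, Evolves M b r (advance ++ finish) (ket (inWalk A u t j 1 (some p, some q)))
      (ket (arrived M (recordMove A u q t j) p (t + 1))) := fun p q =>
    (advance_inWalk A t j (fun a => hA a t le_rfl) p q).append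
      (finish_arrived _ t (by simpa [recordMove] using hA 0 (t + 1) (Nat.le_succ t)) p)
  have e4 : Evolves M b r (advance ++ finish) (catWalk w b r A u t j v) (catWalk w b r A u t j v) :=
    Evolves.sum fun e _ => (hAF rfl (finish_inWalk A t j e)).smul _
  have e5 : Evolves M b r mark (∑ e, ((walkVec w (b u / r u) u v (Real.sqrt (b u) + 1 / 2)
      (Real.sqrt (b u) - 1 - b u / r u * deg w u * v u)
      (-(Real.sqrt (b u) - b u / r u * deg w u * v u)) e : ℝ) : ℂ) • ket (inWalk A u t j 0 e))
      (catWalk w b r A u t j v + ∑ p, ∑ q, ((flowAmp w (b u / r u) u v (b u) p q : ℝ) : ℂ) •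
        ket (inWalk A u t j 1 (some p, some q))) := fun T hT => by
    rw [mark_sum A t j (b u / r u) hN v _ _ hT, neg_neg, catWalk]
  have e6 : Evolves M b r (advance ++ finish)
      (∑ p, ∑ q, ((flowAmp w (b u / r u) u v (b u) p q : ℝ) : ℂ) •
        ket (inWalk A u t j 1 (some p, some q)))
      (∑ p, ∑ q, ((flowAmp w (b u / r u) u v (b u) p q : ℝ) : ℂ) •
        ket (arrived M (recordMove A u q t j) p (t + 1))) :=
    Evolves.sum fun p _ => Evolves.sum fun q _ => (e3 p q).smul _
  rw [map_add, map_smul, map_smul, e2, e5.append (e4.add e6) TB hTB, smul_add]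
  simp only [Finset.smul_sum, smul_smul, ← Complex.ofReal_mul]
  abel

end Step

/-! ### One step of the transducer on superpositions -/

section Superposition

variable {V : Type u} {k : ℕ}

theorem write_ket (ρ c : Config V k) : write ρ (ket c) = ket (writeEquiv ρ c) := permU_ket _ _

theorem SuppIn.write {D D' : Set (Config V k)} {ψ : Space V k} (h : SuppIn D ψ) {ρ : Config V k}
    (hD : ∀ c ∈ D, writeEquiv ρ c ∈ D') : SuppIn D' (Elfs.write ρ ψ) := fun c hc => by
  rw [Elfs.write, permU_apply]
  refine h _ fun h' => hc ?_
  simpa using hD _ h'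

theorem writeEquiv_cell {ρ c : Config V k} {i : Fin (k + 1)} (h : c.cell i = .num 0) :
    (writeEquiv ρ c).cell i = ρ.cell i := by
  simp [writeEquiv, h]

theorem writeEquiv_arr {ρ c : Config V k} {a : Fin (k + 1)} {l : ℤ} (h : c.arr a l = .num 0) :
    (writeEquiv ρ c).arr a l = ρ.arr a l := by
  simp [writeEquiv, h]

theorem writeEquiv_arr_of_blank {ρ c : Config V k} {a : Fin (k + 1)} {l : ℤ}
    (h : ρ.arr a l = .num 0) : (writeEquiv ρ c).arr a l = c.arr a l := by
  simp [writeEquiv, h]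

/-- Blank arrays. -/
def blankArr : Fin 8 → ℤ → Word V := fun _ _ => .num 0

/-- The cells are blank, and so are the arrays from position `t` on. -/
def Blank (V : Type u) (t : ℕ) : Set (Config V 7) :=
  {c | (∀ i, c.cell i = .num 0) ∧ ∀ a, ∀ l : ℕ, t ≤ l → c.arr a l = .num 0}

variable [Fintype V] [DecidableEq V] {w : V → V → ℝ} {M : Finset V} {b r : V → ℝ}

/-- The pattern of a recorded move. -/
def recordPattern (u q : V) (t j : ℕ) : Config V 7 := ⟨fun _ => .num 0, recordMove blankArr u q t j⟩

/-- In each place at least one of the pattern and the memory is blank, so exchanging contents simply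
merges the two. -/
theorem writeEquiv_eq {ρ c : Config V 7} (hc : ∀ i, c.cell i = .num 0) {A : Fin 8 → ℤ → Word V}
    (hA : ∀ a l, (ρ.arr a l = .num 0 ∧ A a l = c.arr a l) ∨
      (c.arr a l = .num 0 ∧ A a l = ρ.arr a l)) :
    writeEquiv ρ c = ⟨ρ.cell, A⟩ := by
  refine Config.ext' (fun i => writeEquiv_cell (hc i)) fun a l => ?_
  change _ = A a l
  rcases hA a l with ⟨h, h'⟩ | ⟨h, h'⟩
  · rw [writeEquiv_arr_of_blank h, h']
  · rw [writeEquiv_arr h, h']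

theorem writeEquiv_atVertex {c : Config V 7} (hc : ∀ i, c.cell i = .num 0) (u : V) (t j : ℕ) :
    writeEquiv (atVertex blankArr u t j) c = atVertex c.arr u t j :=
  writeEquiv_eq hc fun _ _ => .inl ⟨rfl, rfl⟩

theorem writeEquiv_inWalk {c : Config V 7} (hc : ∀ i, c.cell i = .num 0) (u : V) (t j : ℕ) (ρ : ℤ)
    (e : Option V × Option V) :
    writeEquiv (inWalk blankArr u t j ρ e) c = inWalk c.arr u t j ρ e :=
  writeEquiv_eq hc fun _ _ => .inl ⟨rfl, rfl⟩

theorem writeEquiv_atSink {c : Config V 7} {t : ℕ} (hc : c ∈ Blank V t) (p : V) :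
    writeEquiv (atSink blankArr p t) c = atSink c.arr p t := by
  refine writeEquiv_eq hc.1 fun a l => ?_
  simp only [atSink, mem_arr, setEntry_apply, blankArr]
  split_ifs with h
  · rw [h.2]
    exact .inr ⟨hc.2 a t le_rfl, rfl⟩
  · exact .inl ⟨rfl, rfl⟩

theorem writeEquiv_arrived {c : Config V 7} {t : ℕ} (hc : c ∈ Blank V t) (p : V) :
    writeEquiv (arrived M blankArr p t) c = arrived M c.arr p t := by
  unfold arrived
  split_ifs
  · exact writeEquiv_atSink hc p
  · exact writeEquiv_atVertex hc.1 p t 0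

theorem writeEquiv_recordPattern {c : Config V 7} {t : ℕ} (hc : c ∈ Blank V t) (u q : V) (j : ℕ) :
    writeEquiv (recordPattern u q t j) c = ⟨fun _ => .num 0, recordMove c.arr u q t j⟩ := by
  refine Config.ext' (fun i => writeEquiv_cell (hc.1 i)) fun a l => ?_
  by_cases hl : l = t
  · subst hl
    rw [writeEquiv_arr (hc.2 a t le_rfl)]
    simp only [recordPattern, recordMove, setEntry_apply, blankArr, hc.2 a t le_rfl]
  · rw [writeEquiv_arr_of_blank]
    · simp [recordMove, hl]
    · simp [recordPattern, recordMove, hl, blankArr]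

theorem record_mem_blank {c : Config V 7} {t : ℕ} (hc : c ∈ Blank V t) (u q : V) (j : ℕ) :
    (⟨fun _ => .num 0, recordMove c.arr u q t j⟩ : Config V 7) ∈ Blank V (t + 1) := by
  refine ⟨fun _ => rfl, fun a l hl => ?_⟩
  have : (l : ℤ) ≠ t := by omega
  simp [recordMove, this, hc.2 a l (by omega)]

variable (w b r) in
/-- The amplitude of the walk in the catalyst. -/
def catAmp (u : V) (v : V → ℝ) : Option V × Option V → ℝ :=
  walkVec w (b u / r u) u v (Real.sqrt (b u) - 1 / 2) (Real.sqrt (b u) - b u / r u * deg w u * v u)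
    (-(Real.sqrt (b u) - 1 - b u / r u * deg w u * v u))

/-- `write` as a continuous linear map. -/
def writeL (ρ : Config V k) : Space V k →L[ℂ] Space V k :=
  ((write ρ).toContinuousLinearEquiv : Space V k →L[ℂ] Space V k)

theorem writeL_apply (ρ : Config V k) (ψ : Space V k) : writeL ρ ψ = write ρ ψ := rfl

variable {u : V} (t j : ℕ)

/-- The vector γ superposes many earlier records. The patterns written here do not depend on those
records, so both sides are continuous linear in γ, and `step_ket` compares them on each basis state.
-/
theorem step_superposition (hN : IsNetwork w M) (hη : 0 ≤ b u / r u) (hu : u ∉ M) (hb : 0 ≤ b u)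
    {v : V → ℝ} (hv : IsPotential w M u v) (hq : 0 < b u / r u * deg w u * v u)
    {α ε : ℝ} (hα : α = Real.sqrt (Real.sqrt (b u)) / (b u / r u * deg w u * v u + b u))
    (hε : ε = (b u / r u * deg w u * v u - b u) / (b u / r u * deg w u * v u + b u))
    {TF TW TB : Space V 7 ≃ₗᵢ[ℂ] Space V 7} (hTF : Runs M b r feed TF)
    (hTW : IsWalkCall w M b r walkGuard 1 2 3 TW) (hTB : Runs M b r (mark ++ (advance ++ finish)) TB)
    {γ : Space V 7} (hγ : SuppIn (Blank V t) γ) :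
    TB (TW (TF (write (atVertex blankArr u t j) γ +
      (α : ℂ) • ∑ e, ((catAmp w b r u v e : ℝ) : ℂ) • write (inWalk blankArr u t j 0 e) γ))) =
      (α : ℂ) • ∑ e, ((catAmp w b r u v e : ℝ) : ℂ) • write (inWalk blankArr u t j 0 e) γ +
      (ε : ℂ) • write (atVertex blankArr u t (j + 1)) γ +
      ∑ p, ∑ q, ((α * flowAmp w (b u / r u) u v (b u) p q : ℝ) : ℂ) •
        write (arrived M blankArr p (t + 1)) (write (recordPattern u q t j) γ) := by
  let K : Space V 7 →L[ℂ] Space V 7 :=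
    (α : ℂ) • ∑ e, ((catAmp w b r u v e : ℝ) : ℂ) • writeL (inWalk blankArr u t j 0 e)
  let S : Space V 7 →L[ℂ] Space V 7 :=
    (((TF.trans TW).trans TB).toContinuousLinearEquiv : Space V 7 →L[ℂ] Space V 7)
  have key := hγ.map_eq (S := S.comp (writeL (atVertex blankArr u t j) + K))
    (T := K + (ε : ℂ) • writeL (atVertex blankArr u t (j + 1)) +
      ∑ p, ∑ q, ((α * flowAmp w (b u / r u) u v (b u) p q : ℝ) : ℂ) •
        (writeL (arrived M blankArr p (t + 1))).comp (writeL (recordPattern u q t j)))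
    (fun c hc => by
      have hK : K (ket c) = (α : ℂ) • catWalk w b r c.arr u t j v := by
        simp only [K, _root_.smul_apply, _root_.sum_apply, writeL_apply,
          write_ket, writeEquiv_inWalk hc.1]
        rfl
      have := step_ket c.arr t j hN hη hu hb hv hq hα hε hTF hTW hTB hc.2
      simp only [_root_.add_apply, ContinuousLinearMap.comp_apply,
        _root_.smul_apply, _root_.sum_apply, writeL_apply, write_ket,
        writeEquiv_atVertex hc.1, writeEquiv_recordPattern hc,
        writeEquiv_arrived (record_mem_blank hc _ _ _), hK]
      exact this)
  simp only [K, _root_.add_apply, ContinuousLinearMap.comp_apply,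
    _root_.smul_apply, _root_.sum_apply, writeL_apply] at key
  exact key

end Superposition

/-! ### Geometric series of failed attempts. -/

section Series

variable {E : Type*} [NormedAddCommGroup E] [NormedSpace ℂ E] [CompleteSpace E]

theorem summable_geometric_smul {ε : ℝ} (hε : |ε| < 1) {x : ℕ → E} {B : ℝ} (hx : ∀ j, ‖x j‖ ≤ B) :
    Summable fun j => ((ε : ℂ) ^ j) • x j := by
  refine Summable.of_norm_bounded (g := fun j => |ε| ^ j * B)
    ((summable_geometric_of_lt_one (abs_nonneg _) hε).mul_right B) fun j => ?_
  rw [norm_smul, norm_pow, Complex.norm_real, Real.norm_eq_abs]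
  exact mul_le_mul_of_nonneg_left (hx j) (by positivity)

theorem norm_geometric_smul_le {ε : ℝ} (hε : |ε| < 1) {x : ℕ → E} {B : ℝ} (hx : ∀ j, ‖x j‖ ≤ B) :
    ‖∑' j, ((ε : ℂ) ^ j) • x j‖ ≤ (1 - |ε|)⁻¹ * B := by
  refine tsum_of_norm_bounded ((hasSum_geometric_of_lt_one (abs_nonneg _) hε).mul_right B)
    fun j => ?_
  rw [norm_smul, norm_pow, Complex.norm_real, Real.norm_eq_abs]
  exact mul_le_mul_of_nonneg_left (hx j) (by positivity)

/-- If a map trades each `I j` for `ε • I (j + 1)` and some output `N j`, with catalyst `W j`, then it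
trades `I 0` for the total output, with the total catalyst. -/
theorem map_geometric {ε : ℝ} (hε : |ε| < 1) {I W N : ℕ → E} {B B' : ℝ} (hI : ∀ j, ‖I j‖ ≤ B)
    (hW : ∀ j, ‖W j‖ ≤ B') (S : E →L[ℂ] E)
    (hS : ∀ j, S (I j + W j) = W j + (ε : ℂ) • I (j + 1) + N j) {n : E}
    (hn : HasSum (fun j => ((ε : ℂ) ^ j) • N j) n) :
    S (I 0 + ∑' j, ((ε : ℂ) ^ j) • ((ε : ℂ) • I (j + 1) + W j)) =
      ∑' j, ((ε : ℂ) ^ j) • ((ε : ℂ) • I (j + 1) + W j) + n := by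
  have h1 := summable_geometric_smul hε hI
  have h2 := (summable_geometric_smul hε hW).hasSum
  have h3 : Summable fun j => ((ε : ℂ) ^ (j + 1)) • I (j + 1) := (summable_nat_add_iff 1).2 h1
  have h4 : HasSum (fun j => ((ε : ℂ) ^ j) • ((ε : ℂ) • I (j + 1) + W j))
      (∑' j, ((ε : ℂ) ^ (j + 1)) • I (j + 1) + ∑' j, ((ε : ℂ) ^ j) • W j) := by
    convert h3.hasSum.add h2 using 2 with j
    rw [smul_add, smul_smul, pow_succ]
  -- The remainder ε • I (j+1) of attempt j, with weight ε^j, is the input of attempt j + 1, with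
  -- weight ε^(j+1); only I 0 is supplied from outside.
  have h5 : HasSum (fun j => ((ε : ℂ) ^ j) • (I j + W j))
      (I 0 + ∑' j, ((ε : ℂ) ^ (j + 1)) • I (j + 1) + ∑' j, ((ε : ℂ) ^ j) • W j) := by
    have h6 := h1.hasSum
    rw [h1.tsum_eq_zero_add, pow_zero, one_smul] at h6
    simpa only [smul_add] using h6.add h2
  rw [h4.tsum_eq, ← add_assoc]
  refine (h5.mapL S).unique ?_
  convert h4.add hn using 2 with j
  rw [map_smul, hS, ← smul_add]
  congr 1
  abel

end Series

/-! ### Estimates for the amplitudes of one step -/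

section Estimates

variable {V : Type u} [Fintype V] [DecidableEq V]

/-- The numbers `b` bound the escape times, and the numbers `r` are the products of effective
resistances and degrees up to a factor `κ`. -/
structure IsEstimate (κ : ℝ) (w : V → V → ℝ) (M : Finset V) (b r : V → ℝ) : Prop where
  one_le : 1 ≤ κ
  escape_le : ∀ u, u ∉ M → escapeTime w M u ≤ ENNReal.ofReal (b u)
  le : ∀ u, u ∉ M → effRes w M u * deg w u / κ ≤ r u
  ge : ∀ u, u ∉ M → r u ≤ κ * (effRes w M u * deg w u)

/-- The product of the weight of the attached edge and the effective resistance. -/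
def ratio (w : V → V → ℝ) (M : Finset V) (b r : V → ℝ) (u : V) : ℝ :=
  b u / r u * deg w u * potential w M u u

/-- The amplitude of a failed attempt to move. -/
def failAmp (w : V → V → ℝ) (M : Finset V) (b r : V → ℝ) (u : V) : ℝ :=
  (ratio w M b r u - b u) / (ratio w M b r u + b u)

/-- The amplitude of the walk in the catalyst. -/
def catScale (w : V → V → ℝ) (M : Finset V) (b r : V → ℝ) (u : V) : ℝ :=
  Real.sqrt (Real.sqrt (b u)) / (ratio w M b r u + b u)

/-- The amplitude of a move from `u` to `p` through the edge `(p, q)`. -/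
def moveAmp (w : V → V → ℝ) (M : Finset V) (b r : V → ℝ) (u p q : V) : ℝ :=
  catScale w M b r u * flowAmp w (b u / r u) u (potential w M u) (b u) p q

namespace IsEstimate

variable {κ : ℝ} {w : V → V → ℝ} {M : Finset V} {b r : V → ℝ} (h : IsEstimate κ w M b r)
  (hN : IsNetwork w M) {u : V} (hu : u ∉ M)
include h hN hu

theorem escape_le' : escape w M u ≤ b u := by
  have h1 := h.escape_le u hu
  rw [hN.escapeTime_eq_escape hu] at h1
  have h2 := hN.one_le_escape hu
  by_contra! hlt
  rcases lt_or_ge 0 (b u) with hb | hb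
  · rw [ENNReal.ofReal_le_ofReal_iff hb.le] at h1
    linarith
  · rw [ENNReal.ofReal_of_nonpos hb] at h1
    have := ENNReal.ofReal_pos.2 (show 0 < escape w M u by linarith)
    exact absurd h1 (not_le.2 this)

theorem one_le_bound : 1 ≤ b u := (hN.one_le_escape hu).trans (h.escape_le' hN hu)

/-- The weight b/r of the attached edge is chosen so that q = b·(R d)/r, which would equal b for an
exact estimate r = R d. -/
theorem le_ratio : b u / κ ≤ ratio w M b r u ∧ ratio w M b r u ≤ κ * b u ∧ 0 < r u := by
  have hv := hN.isPotential hu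
  have h1 := hv.one_le hN
  have h2 := h.le u hu
  have h3 := h.ge u hu
  rw [hv.effRes_eq hN hu] at h2 h3
  have hκ : 0 < κ := lt_of_lt_of_le one_pos h.one_le
  have hb : 0 < b u := lt_of_lt_of_le one_pos (h.one_le_bound hN hu)
  have hr : 0 < r u := lt_of_lt_of_le (div_pos (by linarith) hκ) h2
  have e : ratio w M b r u = b u * (potential w M u u * deg w u) / r u := by
    unfold ratio
    ring
  refine ⟨?_, ?_, hr⟩
  · rw [e, div_le_div_iff₀ hκ hr]
    nlinarith
  · rw [e, div_le_iff₀ hr]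
    rw [div_le_iff₀ hκ] at h2
    nlinarith

theorem ratio_pos : 0 < ratio w M b r u :=
  lt_of_lt_of_le (div_pos (lt_of_lt_of_le one_pos (h.one_le_bound hN hu))
    (lt_of_lt_of_le one_pos h.one_le)) (h.le_ratio hN hu).1

theorem weight_nonneg : 0 ≤ b u / r u :=
  div_nonneg (zero_le_one.trans (h.one_le_bound hN hu)) (h.le_ratio hN hu).2.2.le

/-- With t = q/b in [1/κ, κ] the amplitude is (t - 1)/(t + 1), increasing in t, with extreme values
±(κ-1)/(κ+1). -/
theorem abs_failAmp_le : |failAmp w M b r u| ≤ (κ - 1) / (κ + 1) := by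
  have hb := h.one_le_bound hN hu
  obtain ⟨h1, h2, -⟩ := h.le_ratio hN hu
  have hq := h.ratio_pos hN hu
  have hκ := h.one_le
  rw [div_le_iff₀ (by positivity)] at h1
  unfold failAmp
  rw [abs_div, abs_of_pos (a := ratio w M b r u + b u) (by positivity),
    div_le_div_iff₀ (by positivity) (by positivity), ← abs_of_pos (a := κ + 1) (by positivity),
    ← abs_mul, abs_le]
  constructor <;> nlinarith

theorem abs_failAmp_lt : |failAmp w M b r u| < 1 := by
  refine lt_of_le_of_lt (h.abs_failAmp_le hN hu) ?_
  have hκ := h.one_le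
  rw [div_lt_one (by positivity)]
  linarith

theorem inv_one_sub_le : (1 - |failAmp w M b r u|)⁻¹ ≤ (κ + 1) / 2 := by
  have hκ := h.one_le
  have h1 := h.abs_failAmp_le hN hu
  rw [le_div_iff₀ (by positivity)] at h1
  rw [inv_le_comm₀ (by linarith [h.abs_failAmp_lt hN hu]) (by positivity), inv_div,
    div_le_iff₀ (by positivity)]
  linarith

/-- The marked flow is scaled so that all moves together carry 4qb/(q + b)² = 1 - ε², which matches
unitarity of one step. -/
theorem sum_sq_moveAmp (p : V) :
    ∑ q, moveAmp w M b r u p q ^ 2 = (1 - failAmp w M b r u ^ 2) * elfStep w M u p := by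
  have hv := hN.isPotential hu
  have hR := hv.pos hN
  have hb := h.one_le_bound hN hu
  have hq := h.ratio_pos hN hu
  have hη := h.weight_nonneg hN hu
  have hm := Real.sqrt_nonneg (b u)
  have e1 : Real.sqrt (b u) ^ 2 = b u := Real.sq_sqrt (by linarith)
  have key : ∀ q, moveAmp w M b r u p q ^ 2 = 2 * b u * (b u / r u * deg w u) /
      (ratio w M b r u + b u) ^ 2 * (w p q * (potential w M u p - potential w M u q) ^ 2) := by
    intro q
    have hw := hN.nonneg p q
    have hd := hN.deg_nonneg u
    unfold moveAmp flowAmp catScale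
    rw [mul_pow, div_pow, mul_pow, mul_pow, mul_pow, Real.sq_sqrt hm, Real.sq_sqrt hw,
      Real.sq_sqrt (mul_nonneg hη hd), Real.sq_sqrt (by positivity)]
    rw [show (2 * b u * (b u / r u * deg w u) : ℝ) =
      2 * Real.sqrt (b u) ^ 2 * (b u / r u * deg w u) by rw [e1]]
    ring
  simp only [key]
  rw [← Finset.mul_sum, hv.elfStep_eq hN hu]
  have e2 : b u / r u * deg w u = ratio w M b r u / potential w M u u := by
    rw [eq_div_iff hR.ne']
    rfl
  have hs : ratio w M b r u + b u ≠ 0 := by positivity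
  rw [e2]
  unfold failAmp
  field_simp
  ring

/-- The potential part costs η d_u ∑ d_x v_x² = q·ET_u ≤ q b, up to a constant, and the flow part m²
q = b q: this is where the bound on the escape time enters quantitatively. Scaling by α² = √b/(q +
b)² leaves a multiple of √b. -/
theorem sum_sq_catAmp :
    catScale w M b r u ^ 2 * ∑ e, catAmp w b r u (potential w M u) e ^ 2 ≤ 3 * Real.sqrt (b u) := by
  have hv := hN.isPotential hu
  have hR := hv.pos hN
  have hb := h.one_le_bound hN hu
  have hq := h.ratio_pos hN hu
  have hη := h.weight_nonneg hN hu
  have hd := hN.deg_nonneg u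
  have hm : 1 ≤ Real.sqrt (b u) := Real.one_le_sqrt.2 hb
  have e1 : Real.sqrt (b u) ^ 2 = b u := Real.sq_sqrt (by linarith)
  set v := potential w M u
  set m := Real.sqrt (b u) with hm_def
  set q := ratio w M b r u with hq_def
  have hqv : b u / r u * deg w u * v u = q := rfl
  have e2 : ∑ e, catAmp w b r u v e ^ 2 = (m - q) ^ 2 + (m - 1 - q) ^ 2 +
      ∑ x, ∑ y, edgeAmp w (b u / r u) u v (m - 1 / 2) x y ^ 2 := by
    have := sum_walkVec (w := w) (b u / r u) u v (m - 1 / 2) (m - b u / r u * deg w u * v u)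
      (-(m - 1 - b u / r u * deg w u * v u)) (fun e => ((catAmp w b r u v e : ℝ) : ℂ))
    simp only [catAmp, ← hm_def, hqv, smul_eq_mul] at this ⊢
    have h2 : ∀ x y, walkVec w (b u / r u) u v (m - 1 / 2) (m - q) (-(m - 1 - q)) (some x, some y) =
      edgeAmp w (b u / r u) u v (m - 1 / 2) x y := fun x y => rfl
    simp only [h2] at this
    simp only [walkVec, if_true] at this
    have h3 : ∑ e, walkVec w (b u / r u) u v (m - 1 / 2) (m - q) (-(m - 1 - q)) e *
        walkVec w (b u / r u) u v (m - 1 / 2) (m - q) (-(m - 1 - q)) e =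
        (m - q) * (m - q) + -(m - 1 - q) * -(m - 1 - q) +
        ∑ x, ∑ y, edgeAmp w (b u / r u) u v (m - 1 / 2) x y *
          edgeAmp w (b u / r u) u v (m - 1 / 2) x y := by
      exact_mod_cast this
    simp only [sq]
    rw [h3]
    ring
  have e3 : ∑ x, ∑ y, w x y * (v x ^ 2 + v y ^ 2) = 2 * ∑ x, deg w x * v x ^ 2 := by
    have : ∑ x, ∑ y, w x y * v y ^ 2 = ∑ x, ∑ y, w x y * v x ^ 2 := by
      rw [Finset.sum_comm]
      exact Finset.sum_congr rfl fun x _ => Finset.sum_congr rfl fun y _ => by rw [hN.symm]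
    simp only [mul_add, Finset.sum_add_distrib]
    rw [this]
    unfold deg
    simp only [Finset.sum_mul]
    ring
  have e4 : ∑ x, ∑ y, w x y * (v x - v y) ^ 2 = 2 * v u := by
    have := hN.sum_mul_lap v v
    rw [hv.sum_mul_lap hv.zero] at this
    rw [← this]
    exact Finset.sum_congr rfl fun x _ => Finset.sum_congr rfl fun y _ => by ring
  have e5 : ∑ x, deg w x * v x ^ 2 ≤ b u * v u := by
    have := h.escape_le' hN hu
    unfold escape at this
    rwa [div_le_iff₀ hR] at this
  -- The 6 is 2 from the degree sum, which counts every edge twice, plus 2·2 from the flow, whose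
  -- square sum over ordered pairs is 2v_u.
  have e6 : ∑ x, ∑ y, edgeAmp w (b u / r u) u v (m - 1 / 2) x y ^ 2 ≤ 6 * b u * q := by
    have h1 : ∀ x y, edgeAmp w (b u / r u) u v (m - 1 / 2) x y ^ 2 ≤ b u / r u * deg w u *
        (w x y * (v x ^ 2 + v y ^ 2) + 2 * b u * (w x y * (v x - v y) ^ 2)) := by
      intro x y
      have hw := hN.nonneg x y
      unfold edgeAmp
      rw [mul_pow, mul_pow, Real.sq_sqrt hw, Real.sq_sqrt (mul_nonneg hη hd), mul_assoc]
      refine mul_le_mul_of_nonneg_left ?_ (mul_nonneg hη hd)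
      have h2 : ((v x + v y) / 2 + (m - 1 / 2) * (v x - v y)) ^ 2 ≤
          v x ^ 2 + v y ^ 2 + 2 * b u * (v x - v y) ^ 2 := by
        have h3 : (m - 1 / 2) ^ 2 ≤ b u := by nlinarith
        have h4 := mul_le_mul_of_nonneg_right h3 (sq_nonneg (v x - v y))
        have h5 : ((v x + v y) / 2) ^ 2 * 2 ≤ v x ^ 2 + v y ^ 2 := by nlinarith [sq_nonneg (v x - v y)]
        have h6 := sq_nonneg ((v x + v y) / 2 - (m - 1 / 2) * (v x - v y))
        nlinarith
      calc _ ≤ w x y * (v x ^ 2 + v y ^ 2 + 2 * b u * (v x - v y) ^ 2) :=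
            mul_le_mul_of_nonneg_left h2 hw
        _ = _ := by ring
    refine (Finset.sum_le_sum fun x _ => Finset.sum_le_sum fun y _ => h1 x y).trans ?_
    simp only [← Finset.mul_sum, Finset.sum_add_distrib]
    rw [e3, e4]
    calc b u / r u * deg w u * (2 * ∑ x, deg w x * v x ^ 2 + 2 * b u * (2 * v u))
        ≤ b u / r u * deg w u * (2 * (b u * v u) + 2 * b u * (2 * v u)) :=
          mul_le_mul_of_nonneg_left (by linarith) (mul_nonneg hη hd)
      _ = 6 * b u * (b u / r u * deg w u * v u) := by ring
      _ = _ := by rw [hqv]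
  have e7 : catScale w M b r u ^ 2 = m / (q + b u) ^ 2 := by
    unfold catScale
    rw [div_pow, Real.sq_sqrt (by linarith)]
  -- As 1 ≤ m and m² = b, each attached amplitude has square at most b + q², and b ≤ b² absorbs the
  -- rest.
  have e8 : ∑ e, catAmp w b r u v e ^ 2 ≤ 3 * (q + b u) ^ 2 := by
    rw [e2]
    nlinarith
  rw [e7, div_mul_eq_mul_div, div_le_iff₀ (by positivity)]
  nlinarith

end IsEstimate

end Estimates

/-! ### Histories of the elfs process -/

section History

variable {V : Type u}

/-- The cells are blank, and the arrays record the history of a path, without its last vertex. -/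
def Past {n : ℕ} (f : Fin (n + 1) → V) : Set (Config V 7) :=
  {c | (∀ i, c.cell i = .num 0) ∧ (∀ i : Fin n, c.arr 0 (i : ℕ) = .vtx (some (f i.castSucc))) ∧
    ∀ a, ∀ l : ℤ, l < 0 ∨ (n : ℤ) ≤ l → c.arr a l = .num 0}

/-- The process is at the end of a path. -/
def AtEnd {n : ℕ} (f : Fin (n + 1) → V) : Set (Config V 7) :=
  {c | c.cell 0 = .num 1 ∧ c.cell 5 = .num n ∧ c.cell 1 = .vtx (some (f (Fin.last n))) ∧
    ∀ i : Fin n, c.arr 0 (i : ℕ) = .vtx (some (f i.castSucc))}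

/-- The process has ended, and the path is recorded. -/
def Ended {n : ℕ} (f : Fin (n + 1) → V) : Set (Config V 7) :=
  {c | c.cell 0 = .num 0 ∧ c.cell 5 = .num n ∧ c.arr 0 = record ⟨n, f⟩}

theorem past_subset_blank {n : ℕ} (f : Fin (n + 1) → V) : Past f ⊆ Blank V n := fun _ hc =>
  ⟨hc.1, fun a l hl => hc.2.2 a l (.inr (by exact_mod_cast hl))⟩

theorem path_ext {n n' : ℕ} {f : Fin (n + 1) → V} {f' : Fin (n' + 1) → V} (hn : n = n')
    (h : ∀ (i : Fin (n + 1)) (i' : Fin (n' + 1)), (i : ℕ) = i' → f i = f' i') :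
    (⟨n, f⟩ : Path V) = ⟨n', f'⟩ := by
  subst hn
  rw [show f = f' from funext fun i => h i i rfl]

/-- The memory determines the path: cell `5` its length, array `0` all vertices but the last, cell
`1` the last one. This is the source of orthogonality between the contributions of different paths.
-/
theorem disjoint_atEnd {p p' : Path V} (h : p ≠ p') : Disjoint (AtEnd p.2) (AtEnd p'.2) := by
  obtain ⟨n, f⟩ := p
  obtain ⟨n', f'⟩ := p'
  refine Set.disjoint_left.2 fun c hc hc' => h ?_
  obtain ⟨-, h1, h2, h3⟩ := hc
  obtain ⟨-, h1', h2', h3'⟩ := hc'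
  rw [h1] at h1'
  have hn : n = n' := by simpa using h1'
  subst hn
  refine path_ext rfl fun i i' hi => ?_
  obtain rfl := Fin.ext hi
  refine Fin.lastCases ?_ (fun i => ?_) i
  · have := h2.symm.trans h2'
    simpa using this
  · have := (h3 i).symm.trans (h3' i)
    simpa using this

theorem record_apply {n : ℕ} (f : Fin (n + 1) → V) (i : Fin (n + 1)) :
    record ⟨n, f⟩ (i : ℕ) = .vtx (some (f i)) := by
  unfold record
  rw [dif_pos ⟨by positivity, by simpa using i.2⟩]
  simp

theorem disjoint_ended {p p' : Path V} (h : p ≠ p') : Disjoint (Ended p.2) (Ended p'.2) := by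
  obtain ⟨n, f⟩ := p
  obtain ⟨n', f'⟩ := p'
  refine Set.disjoint_left.2 fun c hc hc' => h ?_
  obtain ⟨-, h1, h2⟩ := hc
  obtain ⟨-, h1', h2'⟩ := hc'
  rw [h1] at h1'
  have hn : n = n' := by simpa using h1'
  subst hn
  refine path_ext rfl fun i i' hi => ?_
  obtain rfl := Fin.ext hi
  have := congrFun (h2.symm.trans h2') (i : ℕ)
  rw [record_apply, record_apply] at this
  simpa using this

variable [Fintype V] [DecidableEq V] {w : V → V → ℝ} {M : Finset V} {b r : V → ℝ}
  {n : ℕ} {f : Fin (n + 1) → V} {γ : Space V 7}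

theorem suppIn_atVertex (hγ : SuppIn (Past f) γ) (j : ℕ) :
    SuppIn (AtEnd f) (write (atVertex blankArr (f (Fin.last n)) n j) γ) :=
  hγ.write fun c hc => by
    rw [writeEquiv_atVertex hc.1]
    exact ⟨rfl, rfl, rfl, hc.2.1⟩

theorem suppIn_inWalk (hγ : SuppIn (Past f) γ) (j : ℕ) (e : Option V × Option V) :
    SuppIn (AtEnd f) (write (inWalk blankArr (f (Fin.last n)) n j 0 e) γ) :=
  hγ.write fun c hc => by
    rw [writeEquiv_inWalk hc.1]
    exact ⟨rfl, rfl, rfl, hc.2.1⟩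

theorem suppIn_atSink (hγ : SuppIn (Past f) γ) :
    SuppIn (Ended f) (write (atSink blankArr (f (Fin.last n)) n) γ) :=
  hγ.write fun c hc => by
    rw [writeEquiv_atSink (past_subset_blank f hc)]
    refine ⟨rfl, rfl, funext fun l => ?_⟩
    simp only [atSink, mem_arr, setEntry_apply, true_and]
    split_ifs with h
    · rw [h]
      exact (record_apply f (Fin.last n)).symm
    · unfold record
      split_ifs with h'
      · obtain ⟨l, rfl⟩ := Int.eq_ofNat_of_zero_le h'.1
        have hl : l < n := by
          have : l < n + 1 := by simpa using h'.2
          have : l ≠ n := by simpa using h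
          omega
        rw [hc.2.1 ⟨l, hl⟩]
        rfl
      · refine hc.2.2 0 l ?_
        rcases lt_or_ge l 0 with hl | hl
        · exact .inl hl
        · right
          have := fun h2 => h' ⟨hl, h2⟩
          change ¬ l.toNat < n + 1 at this
          omega

variable (w M b r) in
/-- Record a move from `u` to `p`, the `n`-th one, in superposition over the edges and over the
numbers of failed attempts. -/
def moveVec (u p : V) (n : ℕ) (γ : Space V 7) : Space V 7 :=
  if u ∈ M then 0 else ∑ q, ((moveAmp w M b r u p q : ℝ) : ℂ) •
    ∑' j : ℕ, ((failAmp w M b r u : ℝ) : ℂ) ^ j • write (recordPattern u q n j) γ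

variable (w M b r) in
/-- The superposition of the histories of a path from `s`. -/
def hist (s : V) : (n : ℕ) → (Fin (n + 1) → V) → Space V 7
  | 0, f => if f 0 = s then ket ⟨fun _ => .num 0, blankArr⟩ else 0
  | n + 1, f => moveVec w M b r (f (Fin.last n).castSucc) (f (Fin.last (n + 1))) n
      (hist s n (Fin.init f))

theorem suppIn_moveVec {f : Fin (n + 2) → V} (hγ : SuppIn (Past (Fin.init f)) γ) :
    SuppIn (Past f) (moveVec w M b r (f (Fin.last n).castSucc) (f (Fin.last (n + 1))) n γ) := by
  unfold moveVec
  split_ifs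
  · exact suppIn_zero
  refine SuppIn.sum fun q _ => SuppIn.smul (SuppIn.tsum fun j => SuppIn.smul ?_ _) _
  refine hγ.write fun c hc => ?_
  rw [writeEquiv_recordPattern (past_subset_blank _ hc)]
  refine ⟨fun _ => rfl, fun i => ?_, fun a l hl => ?_⟩
  · refine Fin.lastCases ?_ (fun i => ?_) i
    · simp [recordMove]
    · have : ((i : ℕ) : ℤ) ≠ n := by
        have := i.2
        omega
      have h2 := hc.2.1 i
      simp only [recordMove, setEntry_apply]
      simp only [Fin.init] at h2
      simpa [this] using h2
  · have h1 : l ≠ n := by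
      rintro rfl
      push_cast at hl
      omega
    have h2 := hc.2.2 a l (by push_cast at hl; omega)
    simpa [recordMove, h1] using h2

theorem suppIn_hist (s : V) : ∀ (n : ℕ) (f : Fin (n + 1) → V), SuppIn (Past f) (hist w M b r s n f)
  | 0, f => by
    unfold hist
    split_ifs
    · exact suppIn_ket ⟨fun _ => rfl, fun i => i.elim0, fun _ _ _ => rfl⟩
    · exact suppIn_zero
  | n + 1, f => suppIn_moveVec (suppIn_hist s n (Fin.init f))

theorem suppIn_record (hγ : SuppIn (Blank V n) γ) (u q : V) (j : ℕ) :
    SuppIn {c : Config V 7 | c.arr 1 n = .vtx (some q) ∧ c.arr 2 n = .num j}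
      (write (recordPattern u q n j) γ) :=
  hγ.write fun c hc => by
    rw [writeEquiv_recordPattern hc]
    simp [recordMove]

variable {κ : ℝ} (h : IsEstimate κ w M b r) (hN : IsNetwork w M) {u : V} (hu : u ∉ M)
include h hN hu

theorem hasSum_record (q : V) (γ : Space V 7) :
    HasSum (fun j : ℕ => ((failAmp w M b r u : ℝ) : ℂ) ^ j • write (recordPattern u q n j) γ)
      (∑' j : ℕ, ((failAmp w M b r u : ℝ) : ℂ) ^ j • write (recordPattern u q n j) γ) :=
  (summable_geometric_smul (h.abs_failAmp_lt hN hu)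
    (fun j => ((write (recordPattern u q n j)).norm_map γ).le)).hasSum

/-- The recorded counters and edge endpoints make all terms orthogonal. The failures contribute ∑
ε^(2j) = 1/(1 - ε²), which cancels the probability 1 - ε² of a move, so exactly the elfs transition
probability is left. -/
theorem norm_sq_moveVec (hγ : SuppIn (Blank V n) γ) (p : V) :
    ‖moveVec w M b r u p n γ‖ ^ 2 = elfStep w M u p * ‖γ‖ ^ 2 := by
  set ε := failAmp w M b r u with hε_def
  have hε := h.abs_failAmp_lt hN hu
  have hε2 : ε ^ 2 < 1 := by rwa [sq_lt_one_iff_abs_lt_one]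
  set G : V → Space V 7 := fun q => ∑' j : ℕ, (ε : ℂ) ^ j • write (recordPattern u q n j) γ with hG
  have hGsum : ∀ q, HasSum (fun j : ℕ => (ε : ℂ) ^ j • write (recordPattern u q n j) γ) (G q) :=
    fun q => hasSum_record h hN hu q γ
  have hGn : ∀ q, ‖G q‖ ^ 2 = (1 - ε ^ 2)⁻¹ * ‖γ‖ ^ 2 := fun q => by
    have h1 := hasSum_norm_sq_of_orthogonal (fun j j' hj => by
      refine SuppIn.inner_eq_zero ((suppIn_record hγ u q j).smul _)
        ((suppIn_record hγ u q j').smul _) (Set.disjoint_left.2 fun c hc hc' => hj ?_)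
      have := hc.2.symm.trans hc'.2
      simpa using this) (hGsum q)
    have h2 : ∀ j : ℕ, ‖(ε : ℂ) ^ j • write (recordPattern u q n j) γ‖ ^ 2 =
        (ε ^ 2) ^ j * ‖γ‖ ^ 2 := fun j => by
      rw [norm_smul, norm_pow, Complex.norm_real, LinearIsometryEquiv.norm_map, mul_pow,
        Real.norm_eq_abs, ← pow_mul, mul_comm j 2, pow_mul, sq_abs]
    simp only [h2] at h1
    exact h1.unique ((hasSum_geometric_of_lt_one (sq_nonneg ε) hε2).mul_right (‖γ‖ ^ 2))
  have hGs : ∀ q, SuppIn {c : Config V 7 | c.arr 1 n = .vtx (some q)} (G q) := fun q =>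
    SuppIn.tsum fun j => ((suppIn_record hγ u q j).mono fun c hc => hc.1).smul _
  have h2 := hasSum_norm_sq_of_orthogonal (x := fun q => ((moveAmp w M b r u p q : ℝ) : ℂ) • G q)
    (fun q q' hq => by
      refine SuppIn.inner_eq_zero ((hGs q).smul _) ((hGs q').smul _)
        (Set.disjoint_left.2 fun c hc hc' => hq ?_)
      have := hc.symm.trans hc'
      simpa using this) (hasSum_fintype _)
  have h3 : moveVec w M b r u p n γ = ∑ q, ((moveAmp w M b r u p q : ℝ) : ℂ) • G q := by
    unfold moveVec
    rw [if_neg hu]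
  rw [h3, ← h2.tsum_eq, tsum_fintype]
  have h4 : ∀ q, ‖((moveAmp w M b r u p q : ℝ) : ℂ) • G q‖ ^ 2 =
      moveAmp w M b r u p q ^ 2 * ((1 - ε ^ 2)⁻¹ * ‖γ‖ ^ 2) := fun q => by
    rw [norm_smul, mul_pow, hGn, Complex.norm_real, Real.norm_eq_abs, sq_abs]
  simp only [h4]
  rw [← Finset.sum_mul, h.sum_sq_moveAmp hN hu p, ← hε_def]
  have : 1 - ε ^ 2 ≠ 0 := by linarith
  field_simp

end History

/-! ### Appending a vertex to a path. -/

section Extension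

variable {X : Type u}

/-- The last vertex of a path. -/
def Path.last (p : Path X) : X := p.2 (Fin.last p.1)

/-- Append a vertex to a path. -/
def Path.snoc (p : Path X) (a : X) : Path X := ⟨p.1 + 1, Fin.snoc (α := fun _ => X) p.2 a⟩

theorem Path.snoc_injective :
    Function.Injective (fun x : Path X × X => Path.snoc x.1 x.2) := by
  rintro ⟨⟨n, f⟩, a⟩ ⟨⟨n', f'⟩, a'⟩ h
  simp only [Path.snoc] at h
  obtain ⟨h1, h2⟩ := Sigma.mk.inj h
  obtain rfl : n = n' := by simpa using h1
  have h3 := eq_of_heq h2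
  have h4 : f = f' := by simpa using congrArg (fun g : Fin (n + 2) → X => Fin.init g) h3
  have h5 : a = a' := by simpa using congrFun h3 (Fin.last (n + 1))
  rw [h4, h5]

theorem Path.mem_range_snoc {p : Path X} (hp : p.1 ≠ 0) :
    p ∈ Set.range (fun x : Path X × X => Path.snoc x.1 x.2) := by
  obtain ⟨_ | n, f⟩ := p
  · exact absurd rfl hp
  · exact ⟨(⟨n, Fin.init f⟩, f (Fin.last (n + 1))), by simp [Path.snoc]⟩

/-- Every path of positive length is a shorter path with one more vertex, in a unique way; this
regroups the arrivals by the path they came from. -/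
theorem hasSum_snoc [Fintype X] {E : Type*} [NormedAddCommGroup E] {F : Path X → E} {S : E}
    (hF : HasSum (fun p => if p.1 = 0 then 0 else F p) S) :
    HasSum (fun p : Path X => ∑ a, F (p.snoc a)) S := by
  have h1 : HasSum (fun x : Path X × X => F (x.1.snoc x.2)) S := by
    rw [← Path.snoc_injective.hasSum_iff] at hF
    · exact hF
    · intro p hp
      rw [if_pos]
      by_contra h
      exact hp (Path.mem_range_snoc h)
  exact h1.prod_fiberwise fun p => hasSum_fintype _

variable [Fintype X] [DecidableEq X]

theorem stepWt_zero (P : X → X → ℝ) (M : Finset X) (s : X) (f : Fin 1 → X) :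
    stepWt P M s ⟨0, f⟩ = if f 0 = s then 1 else 0 := by
  simp [stepWt]

theorem stepWt_succ (P : X → X → ℝ) (M : Finset X) (s : X) {n : ℕ} (f : Fin (n + 2) → X) :
    stepWt P M s ⟨n + 1, f⟩ = if f (Fin.last n).castSucc ∈ M then 0 else
      P (f (Fin.last n).castSucc) (f (Fin.last (n + 1))) * stepWt P M s ⟨n, Fin.init f⟩ := by
  unfold stepWt
  simp only [Fin.forall_fin_succ' (n := n), Fin.prod_univ_castSucc (n := n)]
  by_cases h : f (Fin.last n).castSucc ∈ M
  · simp [h]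
  · simp only [h, not_false_eq_true, and_true, if_false, mul_ite, mul_zero]
    have : (Fin.init f 0 = s ∧ ∀ i : Fin n, Fin.init f i.castSucc ∉ M) ↔
        (f 0 = s ∧ ∀ i : Fin n, f i.castSucc.castSucc ∉ M) := Iff.rfl
    by_cases h1 : f 0 = s ∧ ∀ i : Fin n, f i.castSucc.castSucc ∉ M
    · rw [if_pos h1, if_pos (this.2 h1), mul_comm]
      rfl
    · rw [if_neg h1, if_neg (mt this.1 h1)]

end Extension

/-! ### State vectors of a path, and one move from its end. -/

section Totals

variable {V : Type u} [Fintype V] [DecidableEq V] {w : V → V → ℝ} {M : Finset V} {b r : V → ℝ}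
  {κ : ℝ} {s : V}

variable (w M b r s) in
/-- The histories of a path from `s`. -/
def pathVec (p : Path V) : Space V 7 := hist w M b r s p.1 p.2

theorem suppIn_pathVec (p : Path V) : SuppIn (Past p.2) (pathVec w M b r s p) := suppIn_hist s _ _

theorem blank_pathVec (p : Path V) : SuppIn (Blank V p.1) (pathVec w M b r s p) :=
  (suppIn_pathVec p).mono (past_subset_blank _)

theorem pathVec_snoc (p : Path V) (a : V) :
    pathVec w M b r s (p.snoc a) = moveVec w M b r p.last a p.1 (pathVec w M b r s p) := by
  obtain ⟨n, f⟩ := p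
  simp [pathVec, Path.snoc, hist, Path.last]

/-- Each move multiplies the squared norm by its transition probability, so the garbage never spoils
the path amplitudes. -/
theorem norm_sq_pathVec (h : IsEstimate κ w M b r) (hN : IsNetwork w M) (p : Path V) :
    ‖pathVec w M b r s p‖ ^ 2 = stepWt (elfStep w M) M s p := by
  obtain ⟨n, f⟩ := p
  induction n with
  | zero =>
    rw [stepWt_zero]
    unfold pathVec hist
    split_ifs
    · rw [norm_ket, one_pow]
    · simp
  | succ n ih =>
    rw [stepWt_succ, ← ih (Fin.init f)]
    change ‖moveVec w M b r (f (Fin.last n).castSucc) (f (Fin.last (n + 1))) n _‖ ^ 2 = _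
    split_ifs with hu
    · simp [moveVec, hu]
    · exact norm_sq_moveVec h hN hu (blank_pathVec ⟨n, Fin.init f⟩) _

variable (w M b r s) in
/-- The process is at the end of the path `p`, outside the sink. -/
def liveVec (p : Path V) : Space V 7 :=
  if p.last ∈ M then 0 else write (atVertex blankArr p.last p.1 0) (pathVec w M b r s p)

variable (w M b r s) in
/-- The process has ended, with the path `p`. -/
def endVec (p : Path V) : Space V 7 :=
  if p.last ∈ M then write (atSink blankArr p.last p.1) (pathVec w M b r s p) else 0

variable (w M b r s) in
/-- The catalyst for the next move after the path `p`, and `j` failed attempts. -/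
def walkVecAt (p : Path V) (j : ℕ) : Space V 7 :=
  ((catScale w M b r p.last : ℝ) : ℂ) • ∑ e,
    ((catAmp w b r p.last (potential w M p.last) e : ℝ) : ℂ) •
      write (inWalk blankArr p.last p.1 j 0 e) (pathVec w M b r s p)

variable (w M b r s) in
/-- The catalyst for the next move after the path `p`. -/
def moveCat (p : Path V) : Space V 7 :=
  if p.last ∈ M then 0 else ∑' j : ℕ, ((failAmp w M b r p.last : ℝ) : ℂ) ^ j •
    (((failAmp w M b r p.last : ℝ) : ℂ) •
      write (atVertex blankArr p.last p.1 (j + 1)) (pathVec w M b r s p) +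
      walkVecAt w M b r s p j)

theorem arrived_eq (p : Path V) :
    write (arrived M blankArr p.last p.1) (pathVec w M b r s p) =
      liveVec w M b r s p + endVec w M b r s p := by
  unfold arrived liveVec endVec
  split_ifs <;> simp

section Bounds

variable (h : IsEstimate κ w M b r) (hN : IsNetwork w M)
include h hN

theorem norm_walkVecAt_le (p : Path V) (hp : p.last ∉ M) (j : ℕ) :
    ‖walkVecAt w M b r s p j‖ ≤
      2 * Real.sqrt (Real.sqrt (b p.last)) * ‖pathVec w M b r s p‖ := by
  have h1 := hasSum_norm_sq_of_orthogonal (x := fun e : Option V × Option V =>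
    ((catAmp w b r p.last (potential w M p.last) e : ℝ) : ℂ) •
      write (inWalk blankArr p.last p.1 j 0 e) (pathVec w M b r s p))
    (fun e e' he => by
      have hs : ∀ e : Option V × Option V, SuppIn {c : Config V 7 | c.cell 2 = .vtx e.1 ∧
          c.cell 3 = .vtx e.2} (write (inWalk blankArr p.last p.1 j 0 e) (pathVec w M b r s p)) :=
        fun e => (suppIn_pathVec p).write fun c hc => by
          rw [writeEquiv_inWalk hc.1]
          exact ⟨rfl, rfl⟩
      refine SuppIn.inner_eq_zero ((hs e).smul _) ((hs e').smul _)
        (Set.disjoint_left.2 fun c hc hc' => he ?_)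
      have h1 := hc.1.symm.trans hc'.1
      have h2 := hc.2.symm.trans hc'.2
      exact Prod.ext (by simpa using h1) (by simpa using h2)) (hasSum_fintype _)
  have h2 : ‖walkVecAt w M b r s p j‖ ^ 2 = catScale w M b r p.last ^ 2 *
      (∑ e, catAmp w b r p.last (potential w M p.last) e ^ 2) * ‖pathVec w M b r s p‖ ^ 2 := by
    unfold walkVecAt
    rw [norm_smul, mul_pow, ← h1.tsum_eq, tsum_fintype, Complex.norm_real, Real.norm_eq_abs, sq_abs,
      mul_assoc, Finset.sum_mul]
    congr 1
    refine Finset.sum_congr rfl fun e _ => ?_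
    rw [norm_smul, mul_pow, Complex.norm_real, Real.norm_eq_abs, sq_abs,
      LinearIsometryEquiv.norm_map]
  have h3 := mul_le_mul_of_nonneg_right (h.sum_sq_catAmp hN hp) (sq_nonneg ‖pathVec w M b r s p‖)
  have h4 : 0 ≤ Real.sqrt (b p.last) := Real.sqrt_nonneg _
  refine abs_le_of_sq_le_sq' ?_ (by positivity) |>.2
  rw [h2, mul_pow, mul_pow, Real.sq_sqrt h4]
  nlinarith [mul_nonneg h4 (sq_nonneg ‖pathVec w M b r s p‖)]

theorem norm_moveCat_le (p : Path V) (hp : p.last ∉ M) :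
    ‖moveCat w M b r s p‖ ≤
      3 * ((κ + 1) / 2) * Real.sqrt (Real.sqrt (b p.last)) * ‖pathVec w M b r s p‖ := by
  have hε := h.abs_failAmp_lt hN hp
  have hm : 1 ≤ Real.sqrt (Real.sqrt (b p.last)) :=
    Real.one_le_sqrt.2 (Real.one_le_sqrt.2 (h.one_le_bound hN hp))
  have hγ := norm_nonneg (pathVec w M b r s p)
  unfold moveCat
  rw [if_neg hp]
  refine (norm_geometric_smul_le hε (B := 3 * Real.sqrt (Real.sqrt (b p.last)) *
    ‖pathVec w M b r s p‖) fun j => ?_).trans ?_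
  · refine (norm_add_le _ _).trans ?_
    rw [norm_smul, Complex.norm_real, LinearIsometryEquiv.norm_map, Real.norm_eq_abs]
    have h1 := norm_walkVecAt_le h hN (s := s) p hp j
    have h2 := mul_le_mul_of_nonneg_right (hε.le.trans hm) hγ
    linarith
  · have h1 := mul_le_mul_of_nonneg_right (h.inv_one_sub_le hN hp)
      (show 0 ≤ 3 * Real.sqrt (Real.sqrt (b p.last)) * ‖pathVec w M b r s p‖ by positivity)
    refine h1.trans (le_of_eq ?_)
    ring

/-- `map_geometric` over the attempts at the end of p: all failures are absorbed in the catalyst,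
and what comes out are the extensions of p by one vertex, running or ended. -/
theorem step_path {TF TW TB : Space V 7 ≃ₗᵢ[ℂ] Space V 7} (hTF : Runs M b r feed TF)
    (hTW : IsWalkCall w M b r walkGuard 1 2 3 TW)
    (hTB : Runs M b r (mark ++ (advance ++ finish)) TB) (p : Path V) :
    TB (TW (TF (liveVec w M b r s p + moveCat w M b r s p))) = moveCat w M b r s p +
      ∑ a, (liveVec w M b r s (p.snoc a) + endVec w M b r s (p.snoc a)) := by
  have hlast : ∀ a, (p.snoc a).last = a := fun a => by simp [Path.last, Path.snoc]
  have harr : ∀ a, liveVec w M b r s (p.snoc a) + endVec w M b r s (p.snoc a) =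
      write (arrived M blankArr a (p.1 + 1)) (moveVec w M b r p.last a p.1 (pathVec w M b r s p)) :=
    fun a => by
      rw [← arrived_eq, hlast, pathVec_snoc]
      rfl
  simp only [harr]
  by_cases hp : p.last ∈ M
  · simp [liveVec, moveCat, moveVec, hp]
  have hε := h.abs_failAmp_lt hN hp
  have hb := h.one_le_bound hN hp
  have key := map_geometric hε
    (I := fun j => write (atVertex blankArr p.last p.1 j) (pathVec w M b r s p))
    (W := walkVecAt w M b r s p)
    (N := fun j => ∑ a, ∑ q, ((moveAmp w M b r p.last a q : ℝ) : ℂ) •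
        write (arrived M blankArr a (p.1 + 1))
          (write (recordPattern p.last q p.1 j) (pathVec w M b r s p)))
    (n := ∑ a, write (arrived M blankArr a (p.1 + 1))
      (moveVec w M b r p.last a p.1 (pathVec w M b r s p)))
    (fun j => ((write _).norm_map _).le) (norm_walkVecAt_le h hN p hp)
    (((TF.trans TW).trans TB).toContinuousLinearEquiv : Space V 7 →L[ℂ] Space V 7)
    (fun j => step_superposition p.1 j hN (h.weight_nonneg hN hp) hp (by linarith)
      (hN.isPotential hp) (h.ratio_pos hN hp) rfl rfl hTF hTW hTB (blank_pathVec p))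
    (by
      simp only [Finset.smul_sum]
      refine hasSum_sum fun a _ => ?_
      have h1 : moveVec w M b r p.last a p.1 (pathVec w M b r s p) =
          ∑ q, ((moveAmp w M b r p.last a q : ℝ) : ℂ) • ∑' j : ℕ,
            ((failAmp w M b r p.last : ℝ) : ℂ) ^ j •
              write (recordPattern p.last q p.1 j) (pathVec w M b r s p) := by
        unfold moveVec
        rw [if_neg hp]
      have h2 := (hasSum_sum fun q (_ : q ∈ Finset.univ) =>
        (hasSum_record (n := p.1) h hN hp q (pathVec w M b r s p)).const_smul
          ((moveAmp w M b r p.last a q : ℝ) : ℂ)).mapL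
            (writeL (arrived M blankArr a (p.1 + 1)))
      rw [h1]
      convert h2 using 2 with j
      · simp only [map_sum, map_smul, writeL_apply]
        exact Finset.sum_congr rfl fun q _ => smul_comm _ _ _
      · rfl)
  unfold liveVec moveCat
  rw [if_neg hp, if_neg hp]
  exact key

end Bounds

end Totals

section Runs

variable {V : Type u} [Fintype V] [DecidableEq V] {k : ℕ} {M : Finset V} {b r : V → ℝ}

theorem Runs.split {L L' : List (Gate k)} {T : Space V k ≃ₗᵢ[ℂ] Space V k}
    (h : Runs M b r (L ++ L') T) : ∃ T₁ T₂, Runs M b r L T₁ ∧ Runs M b r L' T₂ ∧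
      T = T₁.trans T₂ := by
  induction L generalizing T with
  | nil => exact ⟨_, _, .nil, h, rfl⟩
  | cons g L ih =>
    cases h with
    | cons hg hL =>
      obtain ⟨T₁, T₂, h1, h2, rfl⟩ := ih hL
      exact ⟨_, _, .cons hg h1, h2, rfl⟩

end Runs

/-! ### Summing over all paths: supports, convergence, norm of the catalyst, transduction. -/

section Totals

variable {V : Type u} [Fintype V] [DecidableEq V] {w : V → V → ℝ} {M : Finset V} {b r : V → ℝ}
  {κ : ℝ} {s : V}

theorem suppIn_liveVec (p : Path V) : SuppIn (AtEnd p.2) (liveVec w M b r s p) := by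
  unfold liveVec
  split_ifs
  · exact suppIn_zero
  · exact suppIn_atVertex (suppIn_pathVec p) 0

theorem suppIn_endVec (p : Path V) : SuppIn (Ended p.2) (endVec w M b r s p) := by
  unfold endVec
  split_ifs
  · exact suppIn_atSink (suppIn_pathVec p)
  · exact suppIn_zero

theorem suppIn_moveCat (p : Path V) : SuppIn (AtEnd p.2) (moveCat w M b r s p) := by
  unfold moveCat
  split_ifs
  · exact suppIn_zero
  · exact SuppIn.tsum fun j => (((suppIn_atVertex (suppIn_pathVec p) (j + 1)).smul _).add
      ((SuppIn.sum fun e _ => (suppIn_inWalk (suppIn_pathVec p) j e).smul _).smul _)).smul _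

/-- The states on which loading has no effect. -/
def Loaded (V : Type u) : Set (Config V 7) :=
  {c | c.cell 0 = .num 1 ∧ ¬(c.cell 5 = .num 0 ∧ c.cell 4 = .num 0 ∧ c.cell 6 = .num 0)}

theorem loaded_moveCat (p : Path V) : SuppIn (Loaded V) (moveCat w M b r s p) := by
  unfold moveCat
  split_ifs
  · exact suppIn_zero
  refine SuppIn.tsum fun j => ((SuppIn.smul ?_ _).add
      ((SuppIn.sum fun e _ => SuppIn.smul ?_ _).smul _)).smul _
  · refine (suppIn_pathVec p).write fun c hc => ?_
    rw [writeEquiv_atVertex hc.1]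
    have : ((j : ℤ) + 1) ≠ 0 := by positivity
    simp [Loaded, atVertex, this]
  · refine (suppIn_pathVec p).write fun c hc => ?_
    rw [writeEquiv_inWalk hc.1]
    simp [Loaded, inWalk]

variable (w M b r s) in
/-- The process has moved, and is outside the sink. -/
def movedVec (p : Path V) : Space V 7 := if p.1 = 0 then 0 else liveVec w M b r s p

theorem suppIn_movedVec (p : Path V) : SuppIn (AtEnd p.2) (movedVec w M b r s p) := by
  unfold movedVec
  split_ifs
  · exact suppIn_zero
  · exact suppIn_liveVec p

theorem loaded_movedVec (p : Path V) : SuppIn (Loaded V) (movedVec w M b r s p) := by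
  unfold movedVec
  split_ifs with hp
  · exact suppIn_zero
  · refine (suppIn_liveVec p).mono fun c hc => ⟨hc.1, fun h => hp ?_⟩
    have := hc.2.1.symm.trans h.1
    simpa using this

theorem load_loaded {T : Space V 7 ≃ₗᵢ[ℂ] Space V 7} (hT : Runs M b r load T) {ψ : Space V 7}
    (hψ : SuppIn (Loaded V) ψ) : T ψ = ψ :=
  hψ.map_eq (S := (T.toContinuousLinearEquiv : Space V 7 →L[ℂ] Space V 7))
    (T := ContinuousLinearMap.id ℂ _) fun _ hc => load_fix hc.1 hc.2 T hT

variable (w M b s) in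
/-- The weight of a path that has not ended. -/
def runningCost (p : Path V) : ℝ :=
  if p.last ∈ M then 0 else stepWt (elfStep w M) M s p * Real.sqrt (b p.last)

section Bounds

variable (h : IsEstimate κ w M b r) (hN : IsNetwork w M)
include h hN

theorem runningCost_nonneg (p : Path V) : 0 ≤ runningCost w M b s p := by
  unfold runningCost
  rw [← norm_sq_pathVec (s := s) h hN]
  split_ifs <;> positivity

theorem tsum_runningCost_le :
    ∑' p, ENNReal.ofReal (runningCost w M b s p) ≤ elfCost w M s b := by
  refine le_trans (le_of_eq ?_) (hN.elf_absorbing.running_le_expect (c := fun u => Real.sqrt (b u))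
    (fun _ _ => Real.sqrt_nonneg _) s)
  unfold pathSum runningCost
  refine tsum_congr fun p => ?_
  change _ = _ * (if p.last ∈ M then 0 else ENNReal.ofReal (Real.sqrt (b p.last)))
  split_ifs
  · simp
  · rw [← norm_sq_pathVec (s := s) h hN, ENNReal.ofReal_mul (sq_nonneg _)]

theorem elfCost_ne_top : elfCost w M s b ≠ ∞ := by
  obtain ⟨u, -, -, -, hE⟩ := hN.elf_absorbing.exists_cost (c := fun u => Real.sqrt (b u))
    (fun _ _ => Real.sqrt_nonneg _)
  unfold elfCost
  rw [hE s]
  exact ENNReal.ofReal_ne_top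

theorem summable_runningCost : Summable (runningCost w M b s) := by
  have h1 := ENNReal.summable_toReal
    (ne_top_of_le_ne_top (elfCost_ne_top (s := s) h hN) (tsum_runningCost_le h hN))
  refine h1.congr fun p => ENNReal.toReal_ofReal (runningCost_nonneg h hN p)

/-- Escape times are at least 1, hence so is √b, and the running states are dominated by the same
cost as the walk vectors. -/
theorem norm_liveVec_le (p : Path V) :
    ‖liveVec w M b r s p‖ ≤ 1 * Real.sqrt (runningCost w M b s p) := by
  rw [one_mul]
  refine Real.le_sqrt_of_sq_le ?_
  unfold liveVec runningCost
  split_ifs with hp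
  · simp
  · rw [LinearIsometryEquiv.norm_map, norm_sq_pathVec h hN]
    refine le_mul_of_one_le_right ?_ (Real.one_le_sqrt.2 (h.one_le_bound hN hp))
    rw [← norm_sq_pathVec (s := s) h hN]
    positivity

theorem norm_moveCat_le_sqrt (p : Path V) :
    ‖moveCat w M b r s p‖ ≤ 3 * ((κ + 1) / 2) * Real.sqrt (runningCost w M b s p) := by
  by_cases hp : p.last ∈ M
  · simp [moveCat, runningCost, hp]
  · refine (norm_moveCat_le h hN p hp).trans (le_of_eq ?_)
    unfold runningCost
    rw [if_neg hp, ← norm_sq_pathVec (s := s) h hN, Real.sqrt_mul (sq_nonneg _),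
      Real.sqrt_sq (norm_nonneg _)]
    ring

/-- Only the squared norms are controlled, by the finite expected cost, so summability rests on the
orthogonality of different paths. -/
theorem summable_of_atEnd {x : Path V → Space V 7} (hx : ∀ p, SuppIn (AtEnd p.2) (x p)) {B : ℝ}
    (hB : ∀ p, ‖x p‖ ≤ B * Real.sqrt (runningCost w M b s p)) : Summable x := by
  refine summable_of_orthogonal (fun p p' hp => (hx p).inner_eq_zero (hx p') (disjoint_atEnd hp))
    (Summable.of_nonneg_of_le (fun _ => sq_nonneg _) (fun p => ?_)
      ((summable_runningCost (s := s) h hN).mul_left (B ^ 2)))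
  have := pow_le_pow_left₀ (norm_nonneg _) (hB p) 2
  rwa [mul_pow, Real.sq_sqrt (runningCost_nonneg h hN p)] at this

theorem summable_moveCat : Summable (moveCat w M b r s) :=
  summable_of_atEnd h hN suppIn_moveCat (norm_moveCat_le_sqrt h hN)

theorem norm_movedVec_le (p : Path V) :
    ‖movedVec w M b r s p‖ ≤ 1 * Real.sqrt (runningCost w M b s p) := by
  unfold movedVec
  split_ifs
  · simp
  · exact norm_liveVec_le h hN p

theorem summable_movedVec : Summable (movedVec w M b r s) :=
  summable_of_atEnd h hN suppIn_movedVec (norm_movedVec_le h hN)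

theorem norm_sq_endVec (p : Path V) :
    ‖endVec w M b r s p‖ ^ 2 = pathProb (elfStep w M) M s p := by
  rw [pathProb_eq]
  change _ = if p.last ∈ M then _ else _
  unfold endVec
  split_ifs
  · rw [LinearIsometryEquiv.norm_map, norm_sq_pathVec h hN]
  · simp

theorem summable_endVec : Summable (endVec w M b r s) := by
  refine summable_of_orthogonal (fun p p' hp => (suppIn_endVec p).inner_eq_zero (suppIn_endVec p')
    (disjoint_ended hp)) ?_
  have h1 := hN.elf_absorbing.expect_one s
  unfold expect at h1
  simp only [mul_one] at h1
  refine (ENNReal.summable_toReal (h1.trans_ne ENNReal.one_ne_top)).congr fun p => ?_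
  rw [norm_sq_endVec h hN]
  exact ENNReal.toReal_ofReal (by rw [← norm_sq_endVec h hN]; positivity)

/-- The transduction complexity. -/
theorem norm_sq_catalyst_le :
    ENNReal.ofReal (‖∑' p, moveCat w M b r s p + ∑' p, movedVec w M b r s p‖ ^ 2) ≤
      ENNReal.ofReal ((3 * ((κ + 1) / 2) + 1) ^ 2) * elfCost w M s b := by
  set B := 3 * ((κ + 1) / 2) + 1
  have h1 := (summable_moveCat (s := s) h hN).hasSum.add (summable_movedVec (s := s) h hN).hasSum
  have h2 : ∀ p, SuppIn (AtEnd p.2) (moveCat w M b r s p + movedVec w M b r s p) := fun p =>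
    (suppIn_moveCat p).add (suppIn_movedVec p)
  have h3 := hasSum_norm_sq_of_orthogonal
    (fun p p' hp => (h2 p).inner_eq_zero (h2 p') (disjoint_atEnd hp)) h1
  have h4 : ∀ p, ‖moveCat w M b r s p + movedVec w M b r s p‖ ^ 2 ≤
      B ^ 2 * runningCost w M b s p := fun p => by
    have h5 : ‖moveCat w M b r s p + movedVec w M b r s p‖ ≤
        B * Real.sqrt (runningCost w M b s p) := by
      refine (norm_add_le _ _).trans ?_
      rw [add_mul]
      exact add_le_add (norm_moveCat_le_sqrt h hN p) (norm_movedVec_le h hN p)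
    have := pow_le_pow_left₀ (norm_nonneg _) h5 2
    rwa [mul_pow, Real.sq_sqrt (runningCost_nonneg h hN p)] at this
  have h5 := h3.summable.tsum_le_tsum h4 ((summable_runningCost (s := s) h hN).mul_left (B ^ 2))
  rw [h3.tsum_eq, tsum_mul_left] at h5
  refine (ENNReal.ofReal_le_ofReal h5).trans ?_
  rw [ENNReal.ofReal_mul (sq_nonneg _), ENNReal.ofReal_tsum_of_nonneg (runningCost_nonneg h hN)
    (summable_runningCost h hN)]
  exact mul_le_mul_right (tsum_runningCost_le h hN) _

/-- One round of the transducer, on the sum over all paths. -/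
theorem map_total (hs : s ∉ M) {TF TW TB : Space V 7 ≃ₗᵢ[ℂ] Space V 7} (hTF : Runs M b r feed TF)
    (hTW : IsWalkCall w M b r walkGuard 1 2 3 TW)
    (hTB : Runs M b r (mark ++ (advance ++ finish)) TB) :
    TB (TW (TF (ket (atVertex blankArr s 0 0) +
      (∑' p, moveCat w M b r s p + ∑' p, movedVec w M b r s p)))) =
      ∑' p, endVec w M b r s p + (∑' p, moveCat w M b r s p + ∑' p, movedVec w M b r s p) := by
  have hc := (summable_moveCat (s := s) h hN).hasSum
  have hm := (summable_movedVec (s := s) h hN).hasSum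
  have he := (summable_endVec (s := s) h hN).hasSum
  -- The input is the running state of the zero-length path at s, the one term that the catalyst
  -- leaves out; together they contain every running path once.
  have h1 : HasSum (fun p : Path V => if p.1 = 0 then liveVec w M b r s p else 0)
      (ket (atVertex blankArr s 0 0)) := by
    have e : ket (atVertex blankArr s 0 0) =
        (fun p : Path V => if p.1 = 0 then liveVec w M b r s p else 0) ⟨0, fun _ => s⟩ := by
      simp only [if_true, liveVec, Path.last, hs, if_false, pathVec, hist]
      rw [write_ket, writeEquiv_atVertex fun _ => rfl]
    rw [e]
    refine hasSum_single _ fun p hp => ?_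
    obtain ⟨_ | n, f⟩ := p
    · have : f 0 ≠ s := fun hf => hp (path_ext rfl fun i i' _ => by
        rw [Fin.fin_one_eq_zero i, hf])
      simp [liveVec, pathVec, hist, this]
    · simp
  have h2 : HasSum (fun p => liveVec w M b r s p + moveCat w M b r s p)
      (ket (atVertex blankArr s 0 0) +
        (∑' p, moveCat w M b r s p + ∑' p, movedVec w M b r s p)) := by
    convert h1.add (hc.add hm) using 2 with p
    unfold movedVec
    split_ifs <;> abel
  -- Leaving out paths of length zero loses nothing from the ended part, since the process starts
  -- outside the sink.
  have h3 : HasSum (fun p : Path V => if p.1 = 0 then 0 else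
      liveVec w M b r s p + endVec w M b r s p)
      (∑' p, movedVec w M b r s p + ∑' p, endVec w M b r s p) := by
    convert hm.add he using 2 with p
    unfold movedVec
    split_ifs with hp
    · obtain ⟨_ | n, f⟩ := p
      · by_cases hf : f 0 = s
        · simp [endVec, Path.last, hf, hs]
        · simp [endVec, pathVec, hist, hf]
      · simp at hp
    · rfl
  have h4 := h2.mapL (((TF.trans TW).trans TB).toContinuousLinearEquiv :
    Space V 7 →L[ℂ] Space V 7)
  have h5 := hc.add (hasSum_snoc h3)
  have h6 : (fun p => (((TF.trans TW).trans TB).toContinuousLinearEquiv :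
      Space V 7 →L[ℂ] Space V 7) (liveVec w M b r s p + moveCat w M b r s p)) =
      fun p => moveCat w M b r s p +
        ∑ a, (liveVec w M b r s (p.snoc a) + endVec w M b r s (p.snoc a)) :=
    funext fun p => step_path h hN hTF hTW hTB p
  rw [h6] at h4
  refine (h4.unique h5).trans ?_
  abel

theorem isQuantumSample_endVec :
    IsQuantumSample (pathProb (elfStep w M) M s) (∑' p, endVec w M b r s p) := by
  classical
  have hsqrt : ∀ p, Real.sqrt (pathProb (elfStep w M) M s p) = ‖endVec w M b r s p‖ := fun p => by
    rw [← norm_sq_endVec h hN, Real.sqrt_sq (norm_nonneg _)]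
  -- The garbage is the normalised end state; for paths of probability 0 any unit vector that
  -- records the path will do.
  refine ⟨fun p => if endVec w M b r s p = 0 then ket ⟨fun _ => .num 0, fun _ => record p⟩ else
    ((‖endVec w M b r s p‖⁻¹ : ℝ) : ℂ) • endVec w M b r s p, fun p => ⟨?_, fun c hc => ?_⟩, ?_⟩
  · dsimp only
    split_ifs with h0
    · exact norm_ket _
    · rw [norm_smul, Complex.norm_real, norm_inv, norm_norm]
      exact inv_mul_cancel₀ (norm_ne_zero_iff.2 h0)
  · dsimp only
    split_ifs with h0
    · refine ket_apply_ne ?_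
      rintro rfl
      exact hc rfl
    · have := suppIn_endVec (w := w) (M := M) (b := b) (r := r) (s := s) p c fun h' => hc h'.2.2
      rw [lp.coeFn_smul, Pi.smul_apply, this, smul_zero]
  · convert (summable_endVec (s := s) h hN).hasSum using 2 with p
    rw [hsqrt]
    dsimp only
    split_ifs with h0
    · simp [h0]
    · rw [smul_smul, ← Complex.ofReal_mul, mul_inv_cancel₀ (norm_ne_zero_iff.2 h0),
        Complex.ofReal_one, one_smul]

end Bounds

theorem initConfig_eq (s : V) : initConfig 7 s = mem (setEntry blankArr 0 0 (.vtx (some s)))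
    (.num 0) (.num 0) (.num 0) (.num 0) (.num 0) (.num 0) (.num 0) (.num 0) := by
  refine Config.ext' (fun i => by fin_cases i <;> rfl) fun a l => ?_
  rw [mem_arr, setEntry_apply]
  by_cases ha : a = 0
  · subst ha
    simp only [initConfig, if_true, record, true_and, blankArr]
    by_cases hl : l = 0
    · subst hl; simp
    · rw [if_neg hl, dif_neg]
      rintro ⟨h1, h2⟩
      omega
  · simp [initConfig, ha, blankArr]

theorem mem_publicSpace_iff {k : ℕ} {ψ : Space V k} :
    ψ ∈ publicSpace V k ↔ SuppIn {c | c.cell 0 = .num 0} ψ := Iff.rfl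

/-- The flag makes running states private and ended states public. Loading turns the public input
into the private start and fixes the catalyst; the rest is `map_total`. -/
theorem transduces (h : IsEstimate κ w M b r) (hN : IsNetwork w M) (hs : s ∉ M)
    {TA TW TB : Space V 7 ≃ₗᵢ[ℂ] Space V 7} (hTA : Runs M b r (load ++ feed) TA)
    (hTW : IsWalkCall w M b r walkGuard 1 2 3 TW)
    (hTB : Runs M b r (mark ++ (advance ++ finish)) TB) :
    Transduces ((TA.trans TW).trans TB) (publicSpace V 7) (ket (initConfig 7 s))
      (∑' p, endVec w M b r s p) (∑' p, moveCat w M b r s p + ∑' p, movedVec w M b r s p) where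
  mem_in := mem_publicSpace_iff.2 (suppIn_ket rfl)
  mem_out := mem_publicSpace_iff.2 (SuppIn.tsum fun p => (suppIn_endVec p).mono fun _ hc => hc.1)
  mem_private := by
    rw [Submodule.mem_orthogonal]
    intro ψ hψ
    refine (mem_publicSpace_iff.1 hψ).inner_eq_zero (D' := {c | c.cell 0 = .num 1})
      ((SuppIn.tsum fun p => (suppIn_moveCat p).mono fun _ hc => hc.1).add
        (SuppIn.tsum fun p => (suppIn_movedVec p).mono fun _ hc => hc.1))
      (Set.disjoint_left.2 fun c hc hc' => ?_)
    have := hc.symm.trans hc'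
    simp at this
  map_eq := by
    obtain ⟨TL, TF, hTL, hTF, rfl⟩ := hTA.split
    rw [← map_total h hN hs hTF hTW hTB]
    change TB (TW (TF (TL _))) = _
    rw [map_add TL, initConfig_eq, load_init blankArr rfl TL hTL, load_loaded hTL]
    exact (SuppIn.tsum loaded_moveCat).add (SuppIn.tsum loaded_movedVec)

end Totals

end Elfs

end

theorem mainTheorem10 (κ : ℝ) (hκ : 1 ≤ κ) :
    -- one constant and one program, which depend on nothing but `κ`
    ∃ (C : ℝ≥0) (k : ℕ) (A B Q₁ Q₂ Q₃ : List (Elfs.Gate k)) (G G' : Elfs.Guard k)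
      (y x z : Fin (k + 1)),
      y ≠ x ∧ y ≠ z ∧ x ≠ z ∧
      ∀ (V : Type u) [Fintype V] [DecidableEq V] (w : V → V → ℝ) (M : Finset V) (s : V)
        (ETbar r : V → ℝ),
        Elfs.IsNetwork w M → s ∉ M →
        (∀ v, v ∉ M → Elfs.escapeTime w M v ≤ ENNReal.ofReal (ETbar v)) →
        (∀ v, v ∉ M → Elfs.effRes w M v * Elfs.deg w v / κ ≤ r v ∧
          r v ≤ κ * (Elfs.effRes w M v * Elfs.deg w v)) →
        -- the transducer
        (∃ TA TW TB : Elfs.Space V k ≃ₗᵢ[ℂ] Elfs.Space V k,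
          Elfs.Runs M ETbar r A TA ∧ Elfs.IsWalkCall w M ETbar r G y x z TW ∧
          Elfs.Runs M ETbar r B TB ∧
          (∃ h cat : Elfs.Space V k,
            Elfs.IsQuantumSample (Elfs.pathProb (Elfs.elfStep w M) M s) h ∧
            Elfs.Transduces ((TA.trans TW).trans TB) (Elfs.publicSpace V k)
              (Elfs.ket (Elfs.initConfig k s)) h cat ∧
            ENNReal.ofReal (‖cat‖ ^ 2) ≤ C * Elfs.elfCost w M s ETbar) ∧
          -- the call to the quantum walk operator, from the star states of the graph itself
          (∀ coin : V → Matrix (Option V) (Option V) ℂ, Elfs.IsStarPreparation w coin →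
            ∃ T₁ T₂ T₃ TC : Elfs.Space V k ≃ₗᵢ[ℂ] Elfs.Space V k,
              Elfs.Runs M ETbar r Q₁ T₁ ∧ Elfs.Runs M ETbar r Q₂ T₂ ∧
              Elfs.Runs M ETbar r Q₃ T₃ ∧ Elfs.IsCoinCall M coin G' x z TC ∧
              TW = (((T₁.trans TC.symm).trans T₂).trans TC).trans T₃)) ∧
        -- both processes stop almost surely, with the same arrival distribution
        Elfs.expect (Elfs.elfStep w M) M s (fun _ => 1) = 1 ∧
        Elfs.expect (Elfs.rwStep w) M s (fun _ => 1) = 1 ∧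
        (∀ m ∈ M, Elfs.arrival (Elfs.elfStep w M) M s m = Elfs.arrival (Elfs.rwStep w) M s m) ∧
        -- the bound for tight estimates of the escape times
        (∀ β : ℝ, (∀ v, v ∉ M → ENNReal.ofReal (ETbar v) ≤
            ENNReal.ofReal β * Elfs.escapeTime w M v) →
          Elfs.elfCost w M s ETbar ≤
            (2 * ENNReal.ofReal β * Elfs.elecHittingTime w M s * Elfs.hittingTime w M s) ^
              (1 / 2 : ℝ)) := by
  -- Inside the square: 3 = 2 + 1 bounds the walk vector and the failed state of one attempt,
  -- (κ+1)/2 bounds the geometric factor 1/(1 - |ε|), and the last 1 is for the states that have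
  -- just moved.
  refine ⟨⟨(3 * ((κ + 1) / 2) + 1) ^ 2, sq_nonneg _⟩, 7, Elfs.load ++ Elfs.feed,
    Elfs.mark ++ (Elfs.advance ++ Elfs.finish), Elfs.walkPre, Elfs.walkMid, Elfs.walkPost,
    Elfs.walkGuard, [], 1, 2, 3, by decide, by decide, by decide, ?_⟩
  intro V _ _ w M s ETbar r hN hs hET hr
  have h : Elfs.IsEstimate κ w M ETbar r :=
    ⟨hκ, hET, fun v hv => (hr v hv).1, fun v hv => (hr v hv).2⟩
  have hη : ∀ u, u ∉ M → 0 ≤ ETbar u / r u := fun u hu => h.weight_nonneg hN hu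
  refine ⟨?_, hN.elf_absorbing.expect_one s, hN.rw_absorbing.expect_one s,
    fun m _ => hN.arrival_elf_eq_rw s m, fun β hβ => hN.elfCost_le hs hET hβ⟩
  obtain ⟨TA, hTA⟩ := Elfs.exists_runs_load_feed (V := V) (M := M) (b := ETbar) (r := r)
  obtain ⟨TW, hTW⟩ := Elfs.exists_walkCall hN hη
  obtain ⟨TB, hTB⟩ := Elfs.exists_runs_mark_advance_finish (V := V) (M := M) (b := ETbar) (r := r)
  refine ⟨TA, TW, TB, hTA, hTW, hTB, ⟨_, _, Elfs.isQuantumSample_endVec h hN,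
    Elfs.transduces h hN hs hTA hTW hTB, ?_⟩, fun coin hcoin => ?_⟩
  · refine (Elfs.norm_sq_catalyst_le h hN).trans (le_of_eq ?_)
    congr 1
    exact ENNReal.ofReal_eq_coe_nnreal (sq_nonneg _)
  · exact hTW.exists_factorization (fun x hx => hN.deg_pos hx) hη hcoin
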